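/- **Setting.** Let $c,\bar c,\eta,\bar\eta\in\mathbb C$ with $c+\bar c=28$, $\eta+\bar\eta=0$, $\eta\neq 0$. The algebra $W_2$ with central charges $(c,\eta)$ has generators $\mathcal L_n,a_n$ ($n\in\mathbb Z$) and relations $$[\mathcal L_n,\mathcal L_m]=(n-m)\mathcal L_{n+m}+\tfrac{c}{12}(n^3-n)\delta_{n,-m},\quad [a_n,a_m]=2\eta n\,\delta_{n+m,0},\quad [\mathcal L_n,a_m]=-m\,a_{n+m}.$$ Let $W$, $\bar W$ be complex representations of $W_2$ with central charges $(c,\eta)$, $(\bar c,\bar\eta)$ on which every vector is annihilated by all generators of sufficiently large index. Write $\mathcal L(z)=\sum\mathcal L_nz^{-n-2}$, $a(z)=\sum a_nz^{-n-1}$ for the fields of $W$, $\bar{\mathcal L}(z),\bar a(z)$ for those of $\bar W$, and $a^\pm=a\pm\bar a$, $$L=\mathcal L-\tfrac1{4\eta}{:}a^2{:},\qquad \bar L=\bar{\mathcal L}-\tfrac1{4\bar\eta}{:}\bar a^2{:}\,.$$ Let $M=\Lambda\otimes\Lambda'$ be the Fock space of the ghosts with $\{b_n,c_m\}=\{\psi_n,\chi_m\}=\delta_{n+m,0}$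 and all other anticommutators zero, with vacuum $\mathbf 1$ satisfying $c_k\mathbf 1=0$ $(k\ge2)$, $b_k\mathbf 1=0$ $(k\ge-1)$, $\psi_k\mathbf 1=0$ $(k\ge1)$, $\chi_k\mathbf 1=0$ $(k\ge0)$, and with fields $b(z)=\sum b_nz^{-n-2}$, $c(z)=\sum c_nz^{-n+1}$, $\psi(z)=\sum\psi_nz^{-n}$, $\chi(z)=\sum\chi_nz^{-n-1}$. Put $$L^{\Lambda}=2{:}\partial c\,b{:}+{:}c\,\partial b{:},\qquad L^M=L^\Lambda+{:}\partial\psi\,\chi{:}\,.$$ On $W\otimes\bar W\otimes M$, graded by the eigenvalues $k\in\mathbb Z$ of the zero mode of the ghost number current ${:}cb{:}+{:}\psi\chi{:}$, let $$Q=\operatorname{Res}_z\Big({:}c(\mathcal L+\bar{\mathcal L}){:}+{:}c\,\partial c\,b{:}+\tfrac32\partial^2c+\psi a^++{:}c\,\partial\psi\,\chi{:}\Big),\qquad R=\tfrac1{4\eta}\operatorname{Res}_z\, c\,a^-\chi ,$$ and for every field $A$ let $\tilde A(z)=e^RA(z)e^{-R}$. Put $$T=\tfrac1{4\eta}{:}\tilde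 a^+\tilde a^-{:}+{:}\partial\tilde\psi\,\tilde\chi{:},\qquad S=\tfrac1{4\eta}a^-\chi .$$ For a field of conformal weight $\Delta$ write $A(z)=\sum_n A_nz^{-n-\Delta}$; the weights are $2$ for $L,\bar L,L^\Lambda,L^M,T,S,b$ and $1$ for $a,\bar a,\chi$. Finally $H^{\frac\infty2+k}$ is the space of $Q$-cycles of ghost number $k$ modulo the $Q$-images of vectors of ghost number $k-1$. **Corollary 3.2.** (0) $R$ is locally nilpotent, $Q^2=0$, and $Q$ raises the ghost number by one. (1) Each of the operators $$\text{(i) } L_0+\bar L_0+\tilde L^{\Lambda}_0,\qquad \text{(ii) } a_0+\bar a_0,\qquad \text{(iii) } T_0$$ is a BRST commutator: $$\{Q,\tilde b_0\}=L_0+\bar L_0+\tilde L^{\Lambda}_0,\qquad \{Q,\tilde\chi_0\}=a_0+\bar a_0,\qquad \{Q,S_0\}=T_0 .$$ (2) Every semi-infinite cohomology class lies in the kernels of (i), (ii), (iii): each of these operators commutes with $Q$, preserves the cycles of every ghost number, and induces the zero map on every $H^{\frac\infty2+k}$. If a cycle of ghost number $k$ is an eigenvector of one of these operators and its class in $H^{\frac\infty2+k}$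 is nonzero, then it lies in the kernel of that operator. (3) Suppose that on each of $W$ and $\bar W$ the operators $\mathcal L_0$, $a_0$ (respectively $\bar{\mathcal L}_0$, $\bar a_0$) are diagonalizable and the real parts of the eigenvalues of $\mathcal L_0$ (respectively $\bar{\mathcal L}_0$) are bounded below, as is the case for highest weight modules. Then every class in $H^{\frac\infty2+k}$ has a representative of ghost number $k$ that lies simultaneously in the kernels of $L_0+\bar L_0+\tilde L^{\Lambda}_0$, of $L_0+\bar L_0+\tilde L^{M}_0$, of $a_0+\bar a_0$ and of $T_0$. Moreover a cycle of ghost number $k$ that is an eigenvector of $L_0+\bar L_0+\tilde L^M_0$ and has a nonzero class in $H^{\frac\infty2+k}$ lies in the kernel of $L_0+\bar L_0+\tilde L^M_0$. -/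

import Mathlib

noncomputable section

open scoped TensorProduct VertexOperator

namespace W2BRST

/-! ## Fields -/

section Fields

variable {V : Type*} [AddCommGroup V] [Module ℂ V]

/-- The field `A(z) = ∑ₙ f n z^{-n-1}` with modes `A₍ₙ₎ = f n`; the hypothesis says that `A(z)v` is a
Laurent series for every vector `v`. -/
def ofModes (f : ℤ → Module.End ℂ V) (hf : ∀ v, ∃ N : ℤ, ∀ n, N ≤ n → f n v = 0) :
    VertexOperator ℂ V :=
  VertexOperator.of_coeff (fun n => f (-n - 1)) (by
    intro v
    obtain ⟨N, hN⟩ := hf v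
    refine ⟨-N, fun n hn => ?_⟩
    by_contra h
    exact hn (hN _ (by omega)))

theorem ofModes_ncoeff (f : ℤ → Module.End ℂ V)
    (hf : ∀ v, ∃ N : ℤ, ∀ n, N ≤ n → f n v = 0) (n : ℤ) : (ofModes f hf)[[n]] = f n := by
  ext v
  change f (-(-n - 1) - 1) v = f n v
  congr 2
  ring

theorem exists_ncoeff_eq_zero (A : VertexOperator ℂ V) (v : V) :
    ∃ N : ℤ, ∀ n, N ≤ n → (A[[n]]) v = 0 :=
  ⟨-((HahnModule.of ℂ).symm (A v)).order, fun _ hn =>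
    VertexOperator.ncoeff_eq_zero_of_lt_order A _ v (by omega)⟩

/-- A sum `∑ⱼ f j` of endomorphisms of which only finitely many act nontrivially on each vector. -/
def locSum (f : ℕ → Module.End ℂ V) (hf : ∀ v, ∃ N : ℕ, ∀ j, N ≤ j → f j v = 0) :
    Module.End ℂ V where
  toFun v := ∑ᶠ j, f j v
  map_add' v w := by
    have hfin : ∀ u, (Function.support fun j => f j u).Finite := fun u => by
      obtain ⟨N, hN⟩ := hf u
      exact (Set.finite_lt_nat N).subset fun j hj => by
        by_contra h
        exact hj (hN j (not_lt.1 h))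
    simp only [map_add]
    exact finsum_add_distrib (hfin v) (hfin w)
  map_smul' r v := by
    simp only [map_smul, RingHom.id_apply]
    exact (smul_finsum r _).symm

theorem locSum_apply (f : ℕ → Module.End ℂ V) (hf : ∀ v, ∃ N : ℕ, ∀ j, N ≤ j → f j v = 0) (v : V) :
    locSum f hf v = ∑ᶠ j, f j v := rfl

/-- The derivative `∂A(z)`, with modes `(∂A)₍ₙ₎ = -n A₍ₙ₋₁₎`. -/
def deriv (A : VertexOperator ℂ V) : VertexOperator ℂ V :=
  ofModes (fun n => (-(n : ℂ)) • A[[n - 1]]) (by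
    intro v
    obtain ⟨N, hN⟩ := exists_ncoeff_eq_zero A v
    exact ⟨N + 1, fun n hn => by simp [hN (n - 1) (by omega)]⟩)

/-- The normally ordered product `:A(z)B(z): = A(z)₋B(z) + s B(z)A(z)₊`, with modes
`(:AB:)₍ₙ₎ = ∑_{j ≥ 0} A₍₋ⱼ₋₁₎ B₍ₙ₊ⱼ₎ + s ∑_{j ≥ 0} B₍ₙ₋ⱼ₋₁₎ A₍ⱼ₎`.
Here `s` is the sign `(-1)^{|A||B|}`. -/
def normalProd (s : ℂ) (A B : VertexOperator ℂ V) : VertexOperator ℂ V :=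
  ofModes
    (fun n =>
      locSum (fun j : ℕ => A[[-(j : ℤ) - 1]] * B[[n + j]]) (by
        intro v
        obtain ⟨N, hN⟩ := exists_ncoeff_eq_zero B v
        exact ⟨(N - n).toNat, fun j hj => by simp [hN (n + j) (by omega)]⟩)
      + s • locSum (fun j : ℕ => B[[n - j - 1]] * A[[(j : ℤ)]]) (by
        intro v
        obtain ⟨N, hN⟩ := exists_ncoeff_eq_zero A v
        exact ⟨N.toNat, fun j hj => by simp [hN j (by omega)]⟩))
    (by
      intro v
      obtain ⟨N, hN⟩ := exists_ncoeff_eq_zero B v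
      obtain ⟨K, hK⟩ := exists_ncoeff_eq_zero A v
      choose P hP using fun j : ℕ => exists_ncoeff_eq_zero B ((A[[(j : ℤ)]]) v)
      obtain ⟨S, hS⟩ := (((Finset.range K.toNat).image P)).exists_le
      refine ⟨max N (S + K.toNat + 1), fun n hn => ?_⟩
      have h1 : ∀ j : ℕ, (A[[-(j : ℤ) - 1]]) ((B[[n + j]]) v) = 0 := fun j => by
        rw [hN (n + j) (by omega), map_zero]
      have h2 : ∀ j : ℕ, (B[[n - j - 1]]) ((A[[(j : ℤ)]]) v) = 0 := fun j => by
        by_cases hj : j < K.toNat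
        · refine hP j _ ?_
          have := hS (P j) (Finset.mem_image_of_mem _ (Finset.mem_range.2 hj))
          omega
        · rw [hK j (by omega), map_zero]
      simp [locSum_apply, h1, h2])

/-- Normally ordered product of two fields at least one of which is even. -/
abbrev nop (A B : VertexOperator ℂ V) : VertexOperator ℂ V := normalProd 1 A B

/-- Normally ordered product of two odd fields. -/
abbrev nopOdd (A B : VertexOperator ℂ V) : VertexOperator ℂ V := normalProd (-1) A B

/-- `R` is locally nilpotent. -/
def LocallyNilpotent (R : Module.End ℂ V) : Prop := ∀ v, ∃ n : ℕ, (R ^ n) v = 0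

open Classical in
/-- The exponential `∑ⱼ Rʲ / j!` of a locally nilpotent endomorphism (`0` for any other one). -/
def locExp (R : Module.End ℂ V) : Module.End ℂ V :=
  if h : LocallyNilpotent R then
    locSum (fun j : ℕ => ((j.factorial : ℂ)⁻¹) • R ^ j) (by
      intro v
      obtain ⟨n, hn⟩ := h v
      refine ⟨n, fun j hj => ?_⟩
      obtain ⟨k, rfl⟩ := Nat.exists_eq_add_of_le' hj
      simp [pow_add, hn])
  else 0

/-- The field with modes `g A₍ₙ₎ g'`. -/
def conjField (g g' : Module.End ℂ V) (A : VertexOperator ℂ V) : VertexOperator ℂ V :=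
  ofModes (fun n => g * A[[n]] * g') (by
    intro v
    obtain ⟨N, hN⟩ := exists_ncoeff_eq_zero A (g' v)
    exact ⟨N, fun n hn => by simp [hN n hn]⟩)

end Fields

/-! ## Representations of `W₂` -/

/-- A representation of `W₂` with central charges `(c, η)` on a complex vector space `W`, on which
the fields `∑ Lₙ z^{-n-2}` and `∑ aₙ z^{-n-1}` are defined: every vector is annihilated by all
`Lₙ`, `aₙ` with `n` large. -/
structure W2Module (c η : ℂ) (W : Type*) [AddCommGroup W] [Module ℂ W] where
  L : ℤ → Module.End ℂ W
  a : ℤ → Module.End ℂ W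
  L_L : ∀ n m : ℤ, ⁅L n, L m⁆ = ((n : ℂ) - m) • L (m + n) +
    if n = -m then (c / 12 * ((n : ℂ) ^ 3 - n)) • (1 : Module.End ℂ W) else 0
  a_a : ∀ n m : ℤ, ⁅a n, a m⁆ =
    if n + m = 0 then (2 * η * n) • (1 : Module.End ℂ W) else 0
  L_a : ∀ n m : ℤ, ⁅L n, a m⁆ = (-(m : ℂ)) • a (n + m)
  smooth : ∀ w, ∃ N : ℤ, ∀ n, N ≤ n → L n w = 0 ∧ a n w = 0

/-- Weight modules with energy bounded below: `L₀` and `a₀` are diagonalizable and the real parts of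
the eigenvalues of `L₀` are bounded below. -/
def W2Module.IsPositiveEnergy {c η : ℂ} {W : Type*} [AddCommGroup W] [Module ℂ W]
    (ρ : W2Module c η W) : Prop :=
  (⨆ μ : ℂ, (ρ.L 0).eigenspace μ = ⊤) ∧ (⨆ μ : ℂ, (ρ.a 0).eigenspace μ = ⊤) ∧
    ∃ B : ℝ, ∀ μ : ℂ, (ρ.L 0).HasEigenvalue μ → B ≤ μ.re

/-! ## Ghosts -/

/-- The four ghost fields. -/
inductive Ghost
  | b | c | ψ | χ

/-- The conjugate ghost field. -/
def Ghost.dual : Ghost → Ghost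
  | b => c
  | c => b
  | ψ => χ
  | χ => ψ

/-- The ghost Fock space `M = Λ ⊗ Λ'`, realized as the exterior algebra on the span of the creation
modes: the basis vector `(g, j)` stands for `g₍₋ⱼ₋₁₎`, that is for `b_{-j-2}`, `c_{1-j}`, `ψ_{-j}`,
`χ_{-j-1}`, and the vacuum is `1`. -/
abbrev GhostFock : Type := ExteriorAlgebra ℂ (Ghost × ℕ →₀ ℂ)

/-- The modes of the ghost fields: `g₍₋ⱼ₋₁₎` is exterior multiplication by the corresponding
generator and `g₍ⱼ₎` is the contraction that pairs to one with the conjugate mode `g.dual₍₋ⱼ₋₁₎`.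
In conformal indexing `b_m = b₍ₘ₊₁₎`, `c_m = c₍ₘ₋₂₎`, `ψ_m = ψ₍ₘ₋₁₎`, `χ_m = χ₍ₘ₎`. -/
def ghostMode (g : Ghost) : ℤ → Module.End ℂ GhostFock
  | Int.ofNat j => CliffordAlgebra.contractLeft (Finsupp.lapply (R := ℂ) (g.dual, j))
  | Int.negSucc j => LinearMap.mulLeft ℂ (ExteriorAlgebra.ι ℂ (Finsupp.single (g, j) (1 : ℂ)))

theorem ghostMode_smooth (g : Ghost) (x : GhostFock) :
    ∃ N : ℤ, ∀ n, N ≤ n → ghostMode g n x = 0 := by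
  induction x using CliffordAlgebra.left_induction with
  | algebraMap r =>
    refine ⟨0, fun n hn => ?_⟩
    obtain ⟨j, rfl⟩ := Int.eq_ofNat_of_zero_le hn
    exact CliffordAlgebra.contractLeft_algebraMap (Q := (0 : QuadraticForm ℂ (Ghost × ℕ →₀ ℂ)))
      (Finsupp.lapply (R := ℂ) (g.dual, j)) r
  | add x y hx hy =>
    obtain ⟨N, hN⟩ := hx
    obtain ⟨K, hK⟩ := hy
    exact ⟨max N K, fun n hn => by
      rw [map_add, hN n (by omega), hK n (by omega), add_zero]⟩
  | ι_mul x m hx =>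
    obtain ⟨N, hN⟩ := hx
    obtain ⟨K, hK⟩ := (m.support.image Prod.snd).exists_le
    refine ⟨max N (K + 1), fun n hn => ?_⟩
    obtain ⟨j, rfl⟩ := Int.eq_ofNat_of_zero_le (a := n) (by omega)
    have h1 : CliffordAlgebra.contractLeft (Finsupp.lapply (R := ℂ) (g.dual, j)) x = 0 :=
      hN j (by omega)
    have h2 : m (g.dual, j) = 0 := by
      by_contra h
      have := hK j (Finset.mem_image.2 ⟨(g.dual, j), Finsupp.mem_support_iff.2 h, rfl⟩)
      omega
    change CliffordAlgebra.contractLeft (Finsupp.lapply (R := ℂ) (g.dual, j)) _ = 0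
    rw [CliffordAlgebra.contractLeft_ι_mul, h1]
    simp [h2]

/-! ## The complex and its fields -/

/-- The semi-infinite complex `W ⊗ W̄ ⊗ M`. -/
abbrev BRSTComplex (W Wbar : Type*) [AddCommGroup W] [Module ℂ W] [AddCommGroup Wbar]
    [Module ℂ Wbar] : Type _ :=
  W ⊗[ℂ] (Wbar ⊗[ℂ] GhostFock)

section Lifts

variable {W Wbar : Type*} [AddCommGroup W] [Module ℂ W] [AddCommGroup Wbar] [Module ℂ Wbar]

theorem smooth_rTensor {V U : Type*} [AddCommGroup V] [Module ℂ V] [AddCommGroup U] [Module ℂ U]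
    (f : ℤ → Module.End ℂ V) (hf : ∀ v, ∃ N : ℤ, ∀ n, N ≤ n → f n v = 0) (x : V ⊗[ℂ] U) :
    ∃ N : ℤ, ∀ n, N ≤ n → (f n).rTensor U x = 0 := by
  induction x using TensorProduct.induction_on with
  | zero => exact ⟨0, fun n _ => map_zero _⟩
  | tmul v u =>
    obtain ⟨N, hN⟩ := hf v
    exact ⟨N, fun n hn => by rw [LinearMap.rTensor_tmul, hN n hn, TensorProduct.zero_tmul]⟩
  | add x y hx hy =>
    obtain ⟨N, hN⟩ := hx
    obtain ⟨K, hK⟩ := hy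
    exact ⟨max N K, fun n hn => by
      rw [map_add, hN n (by omega), hK n (by omega), add_zero]⟩

theorem smooth_lTensor {V U : Type*} [AddCommGroup V] [Module ℂ V] [AddCommGroup U] [Module ℂ U]
    (f : ℤ → Module.End ℂ V) (hf : ∀ v, ∃ N : ℤ, ∀ n, N ≤ n → f n v = 0) (x : U ⊗[ℂ] V) :
    ∃ N : ℤ, ∀ n, N ≤ n → (f n).lTensor U x = 0 := by
  induction x using TensorProduct.induction_on with
  | zero => exact ⟨0, fun n _ => map_zero _⟩
  | tmul u v =>
    obtain ⟨N, hN⟩ := hf v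
    exact ⟨N, fun n hn => by rw [LinearMap.lTensor_tmul, hN n hn, TensorProduct.tmul_zero]⟩
  | add x y hx hy =>
    obtain ⟨N, hN⟩ := hx
    obtain ⟨K, hK⟩ := hy
    exact ⟨max N K, fun n hn => by
      rw [map_add, hN n (by omega), hK n (by omega), add_zero]⟩

/-- The field on the complex given by modes acting on the factor `W`. -/
def fieldLeft (f : ℤ → Module.End ℂ W) (hf : ∀ v, ∃ N : ℤ, ∀ n, N ≤ n → f n v = 0) :
    VertexOperator ℂ (BRSTComplex W Wbar) :=
  ofModes (fun n => (f n).rTensor (Wbar ⊗[ℂ] GhostFock)) (smooth_rTensor f hf)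

/-- The field on the complex given by modes acting on the factor `W̄`. -/
def fieldRight (f : ℤ → Module.End ℂ Wbar) (hf : ∀ v, ∃ N : ℤ, ∀ n, N ≤ n → f n v = 0) :
    VertexOperator ℂ (BRSTComplex W Wbar) :=
  ofModes (fun n => ((f n).rTensor GhostFock).lTensor W)
    (smooth_lTensor _ (smooth_rTensor f hf))

/-- The ghost fields `b(z) = ∑ bₙ z^{-n-2}`, `c(z) = ∑ cₙ z^{-n+1}`, `ψ(z) = ∑ ψₙ z^{-n}`,
`χ(z) = ∑ χₙ z^{-n-1}` on the complex. -/
def ghost (W Wbar : Type*) [AddCommGroup W] [Module ℂ W] [AddCommGroup Wbar] [Module ℂ Wbar]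
    (g : Ghost) : VertexOperator ℂ (BRSTComplex W Wbar) :=
  ofModes (fun n => ((ghostMode g n).lTensor Wbar).lTensor W)
    (smooth_lTensor _ (smooth_lTensor _ (ghostMode_smooth g)))

end Lifts

section BRST

variable {W Wbar : Type*} [AddCommGroup W] [Module ℂ W] [AddCommGroup Wbar] [Module ℂ Wbar]
variable {c cbar η ηbar : ℂ} (ρ : W2Module c η W) (σ : W2Module cbar ηbar Wbar)

theorem W2Module.smooth_L (ρ : W2Module c η W) (w : W) :
    ∃ N : ℤ, ∀ n, N ≤ n → ρ.L (n - 1) w = 0 := by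
  obtain ⟨N, hN⟩ := ρ.smooth w
  exact ⟨N + 1, fun n hn => (hN (n - 1) (by omega)).1⟩

theorem W2Module.smooth_a (ρ : W2Module c η W) (w : W) :
    ∃ N : ℤ, ∀ n, N ≤ n → ρ.a n w = 0 := by
  obtain ⟨N, hN⟩ := ρ.smooth w
  exact ⟨N, fun n hn => (hN n hn).2⟩

/-- `𝓛(z) = ∑ 𝓛ₙ z^{-n-2}`. -/
def calL : VertexOperator ℂ (BRSTComplex W Wbar) := fieldLeft (fun n => ρ.L (n - 1)) ρ.smooth_L

/-- `𝓛̄(z) = ∑ 𝓛̄ₙ z^{-n-2}`. -/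
def calLbar : VertexOperator ℂ (BRSTComplex W Wbar) := fieldRight (fun n => σ.L (n - 1)) σ.smooth_L

/-- `a(z) = ∑ aₙ z^{-n-1}`. -/
def aField : VertexOperator ℂ (BRSTComplex W Wbar) := fieldLeft ρ.a ρ.smooth_a

/-- `ā(z) = ∑ āₙ z^{-n-1}`. -/
def abarField : VertexOperator ℂ (BRSTComplex W Wbar) := fieldRight σ.a σ.smooth_a

/-- `a⁺(z) = a(z) + ā(z)`. -/
def aPlus : VertexOperator ℂ (BRSTComplex W Wbar) := aField ρ + abarField σ

/-- `a⁻(z) = a(z) - ā(z)`. -/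
def aMinus : VertexOperator ℂ (BRSTComplex W Wbar) := aField ρ - abarField σ

/-- `L(z) = 𝓛(z) - (1/4η) :a(z)²:`. -/
def virL : VertexOperator ℂ (BRSTComplex W Wbar) :=
  calL ρ - (1 / (4 * η)) • nop (aField ρ) (aField ρ)

/-- `L̄(z) = 𝓛̄(z) - (1/4η̄) :ā(z)²:`. -/
def virLbar : VertexOperator ℂ (BRSTComplex W Wbar) :=
  calLbar σ - (1 / (4 * ηbar)) • nop (abarField σ) (abarField σ)

/-- The Virasoro field `2 :∂c b: + :c ∂b:` of the `(b, c)` ghosts, of weights `(2, -1)`. -/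
def virBC (W Wbar : Type*) [AddCommGroup W] [Module ℂ W] [AddCommGroup Wbar] [Module ℂ Wbar] :
    VertexOperator ℂ (BRSTComplex W Wbar) :=
  (2 : ℂ) • nopOdd (deriv (ghost W Wbar .c)) (ghost W Wbar .b)
    + nopOdd (ghost W Wbar .c) (deriv (ghost W Wbar .b))

/-- The Virasoro field of all ghosts, `L^M(z) = 2 :∂c b: + :c ∂b: + :∂ψ χ:`. -/
def virM (W Wbar : Type*) [AddCommGroup W] [Module ℂ W] [AddCommGroup Wbar] [Module ℂ Wbar] :
    VertexOperator ℂ (BRSTComplex W Wbar) :=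
  virBC W Wbar + nopOdd (deriv (ghost W Wbar .ψ)) (ghost W Wbar .χ)

/-- The ghost number current `N_g(z) = :c b: + :ψ χ:`. -/
def ghostCurrent (W Wbar : Type*) [AddCommGroup W] [Module ℂ W] [AddCommGroup Wbar]
    [Module ℂ Wbar] : VertexOperator ℂ (BRSTComplex W Wbar) :=
  nopOdd (ghost W Wbar .c) (ghost W Wbar .b) + nopOdd (ghost W Wbar .ψ) (ghost W Wbar .χ)

/-- The BRST current
`J(z) = :c(𝓛 + 𝓛̄): + :c ∂c b: + (3/2) ∂²c + ψ a⁺ + :c ∂ψ χ:`. -/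
def brstCurrent : VertexOperator ℂ (BRSTComplex W Wbar) :=
  nop (ghost W Wbar .c) (calL ρ + calLbar σ)
    + nop (ghost W Wbar .c) (nopOdd (deriv (ghost W Wbar .c)) (ghost W Wbar .b))
    + (3 / 2 : ℂ) • deriv (deriv (ghost W Wbar .c))
    + nop (ghost W Wbar .ψ) (aPlus ρ σ)
    + nop (ghost W Wbar .c) (nopOdd (deriv (ghost W Wbar .ψ)) (ghost W Wbar .χ))

/-- The BRST operator `Q`, the residue of `J(z)`. -/
def Q : Module.End ℂ (BRSTComplex W Wbar) := (brstCurrent ρ σ)[[0]]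

/-- `S(z) = (1/4η) a⁻(z) χ(z)`. -/
def S : VertexOperator ℂ (BRSTComplex W Wbar) :=
  (1 / (4 * η)) • nop (aMinus ρ σ) (ghost W Wbar .χ)

/-- `R = (1/8πiη) ∮ c(z) a⁻(z) χ(z) dz`, that is `1/4η` times the residue of `c a⁻ χ`. -/
def R : Module.End ℂ (BRSTComplex W Wbar) :=
  (1 / (4 * η)) • (nopOdd (ghost W Wbar .c) (nop (aMinus ρ σ) (ghost W Wbar .χ)))[[0]]

/-- `Ã(z) = e^R A(z) e^{-R}`. -/
def tilde (A : VertexOperator ℂ (BRSTComplex W Wbar)) : VertexOperator ℂ (BRSTComplex W Wbar) :=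
  conjField (locExp (R ρ σ)) (locExp (-R ρ σ)) A

/-- `T(z) = (1/4η) :ã⁺ ã⁻: + :∂ψ̃ χ̃:`. -/
def T : VertexOperator ℂ (BRSTComplex W Wbar) :=
  (1 / (4 * η)) • nop (tilde ρ σ (aPlus ρ σ)) (tilde ρ σ (aMinus ρ σ))
    + nopOdd (deriv (tilde ρ σ (ghost W Wbar .ψ))) (tilde ρ σ (ghost W Wbar .χ))

/-- The zero mode `A₀` of a field of conformal weight two, `A(z) = ∑ Aₙ z^{-n-2}`. -/
def zeroMode₂ {V : Type*} [AddCommGroup V] [Module ℂ V] (A : VertexOperator ℂ V) :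
    Module.End ℂ V := A[[1]]

/-- The zero mode `A₀` of a field of conformal weight one, `A(z) = ∑ Aₙ z^{-n-1}`. -/
def zeroMode₁ {V : Type*} [AddCommGroup V] [Module ℂ V] (A : VertexOperator ℂ V) :
    Module.End ℂ V := A[[0]]

/-- `L₀ + L̄₀ + L̃^Λ₀`, with the Virasoro field of the `(b, c)` ghosts only. -/
def energyBC : Module.End ℂ (BRSTComplex W Wbar) :=
  zeroMode₂ (virL ρ) + zeroMode₂ (virLbar σ) + zeroMode₂ (tilde ρ σ (virBC W Wbar))

/-- `L₀ + L̄₀ + L̃^M₀`, with the Virasoro field of all ghosts. -/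
def energyM : Module.End ℂ (BRSTComplex W Wbar) :=
  zeroMode₂ (virL ρ) + zeroMode₂ (virLbar σ) + zeroMode₂ (tilde ρ σ (virM W Wbar))

/-- `a₀ + ā₀`. -/
def charge : Module.End ℂ (BRSTComplex W Wbar) :=
  zeroMode₁ (aField ρ) + zeroMode₁ (abarField σ)

/-- `T₀`. -/
def T₀ : Module.End ℂ (BRSTComplex W Wbar) := zeroMode₂ (T ρ σ)

/-! ## Cohomology -/

/-- The vectors of ghost number `k`. -/
def ghostDegree (W Wbar : Type*) [AddCommGroup W] [Module ℂ W] [AddCommGroup Wbar]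
    [Module ℂ Wbar] (k : ℤ) : Submodule ℂ (BRSTComplex W Wbar) :=
  (zeroMode₁ (ghostCurrent W Wbar)).eigenspace (k : ℂ)

/-- The cycles of ghost number `k`. -/
def cycles (k : ℤ) : Submodule ℂ (BRSTComplex W Wbar) :=
  ghostDegree W Wbar k ⊓ LinearMap.ker (Q ρ σ)

/-- The exact elements of ghost number `k`. -/
def boundaries (k : ℤ) : Submodule ℂ (BRSTComplex W Wbar) :=
  (ghostDegree W Wbar (k - 1)).map (Q ρ σ)

/-- The semi-infinite cohomology `H^{∞/2+k}`. -/
abbrev Cohomology (k : ℤ) : Type _ :=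
  cycles ρ σ k ⧸ (boundaries ρ σ k).submoduleOf (cycles ρ σ k)

/-- The cohomology class of a cycle. -/
def cls (k : ℤ) : cycles ρ σ k →ₗ[ℂ] Cohomology ρ σ k := Submodule.mkQ _

/-- `O` commutes with `Q`, preserves cycles in each ghost number, and the endomorphism that it induces
on cohomology is zero: every cohomology class lies in the kernel of `O`. -/
def KillsCohomology (O : Module.End ℂ (BRSTComplex W Wbar)) : Prop :=
  Commute (Q ρ σ) O ∧
    ∀ (k : ℤ) (Φ : cycles ρ σ k), ∃ h : O Φ ∈ cycles ρ σ k, cls ρ σ k ⟨O Φ, h⟩ = 0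

/-- A cycle which is an eigenvector of `O` and represents a nontrivial class lies in `ker O`. -/
def NontrivialEigencyclesInKer (O : Module.End ℂ (BRSTComplex W Wbar)) : Prop :=
  ∀ (k : ℤ) (Φ : cycles ρ σ k) (δ : ℂ), O Φ = δ • (Φ : BRSTComplex W Wbar) →
    cls ρ σ k Φ ≠ 0 → O Φ = 0

end BRST

end W2BRST

end

noncomputable section

open scoped TensorProduct VertexOperator

namespace W2BRST


/-! ## Calculus of fields -/

section Calculus

variable {V : Type*} [AddCommGroup V] [Module ℂ V]

/-! Every computation is made mode by mode in the algebra of fields. A bracket of an operator with a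
field is recorded by `Bracket`, and satisfies a Leibniz rule for normally ordered products;
contractions of modes with fields are powers of `z`, so Wick calculus reduces to multiplying by
`z^m`. Since `Q` is the residue of a current, its brackets with the generators are read off from the
brackets of their modes with that current.

`Q² = 0`. It suffices to test `Q²` against the ghosts. The only anomaly occurs for `b`: there `{Q,
b} = K` is the total Virasoro field and `[Q, K]` is a multiple of `∂³c` with coefficient `(c + c̄ -
26 - 2)/12`, which vanishes at `28` (`bracket_Q_totalVir`). An operator commuting with all ghosts
and having ghost number two must vanish, because it sends each `w ⊗ w̄ ⊗ 𝟏` to a vector annihilated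
by all ghost annihilators, which has ghost number zero (`eq_zero_of_bracket_ghost`).

Commutators. As `η + η̄ = 0`, the modes of `a⁻` commute among themselves, so `ad R` squares to zero
on every generator and `Ã = A + [R, A]`; in particular `b̃ = b - S` and `χ̃ = χ`. Direct computation
gives `{Q, S} = T` (`bracket_Q_S`), and the identity `K - T = L + L̄ + L̃^Λ` (`totalVir_sub_T`)
turns `{Q, b - S}` into the required energy. An operator `{Q, X}` with `X` of ghost number `-1` is
null-homotopic, hence zero on cohomology; an eigenvector with nonzero eigenvalue is then exact.

Representatives. If `O` kills cohomology and `p(0) = 1`, then `p(O)Φ` is cohomologous to `Φ`; for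
`Φ` a sum of eigenvectors of `O`, a suitable `p` puts `p(O)Φ` in `ker O`. This is applied to `K₀`,
to `a₀ + ā₀` and to `T₀`, which commute. The operator `L₀ + L̄₀ + L̃^M₀` differs from `K₀ - T₀` by
the conjugate `e^R G e^{-R}` of the zero mode `G` of `:∂ψ χ:`. On the kernel of `a₀ + ā₀` one has
`T₀ = e^R (N + G) e^{-R}` with `N` the oscillator energy of `a^±`. Bounded energy makes `N + G`
diagonalizable with nonnegative integral eigenvalues and forces its kernel into `ker G`
(`gradedPart_eq_top`, `ker_le_ker_of_gradedPart`), so the extra term vanishes on the representative.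
-/

theorem field_ext {A B : VertexOperator ℂ V} (h : ∀ n, A[[n]] = B[[n]]) : A = B := by
  refine HVertexOperator.coeff_inj (funext fun n => ?_)
  simp [h]

theorem ncoeff_add (A B : VertexOperator ℂ V) (n : ℤ) : (A + B)[[n]] = A[[n]] + B[[n]] := by
  simp

theorem ncoeff_sub (A B : VertexOperator ℂ V) (n : ℤ) : (A - B)[[n]] = A[[n]] - B[[n]] := by
  simp

theorem ncoeff_neg (A : VertexOperator ℂ V) (n : ℤ) : (-A)[[n]] = -A[[n]] := by
  simp

theorem ncoeff_smul (r : ℂ) (A : VertexOperator ℂ V) (n : ℤ) : (r • A)[[n]] = r • A[[n]] := by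
  simp

theorem ncoeff_zero (n : ℤ) : (0 : VertexOperator ℂ V)[[n]] = 0 := by
  simp

theorem deriv_ncoeff (A : VertexOperator ℂ V) (n : ℤ) :
    (deriv A)[[n]] = (-(n : ℂ)) • A[[n - 1]] := by
  rw [deriv, ofModes_ncoeff]

theorem deriv_add (A B : VertexOperator ℂ V) : deriv (A + B) = deriv A + deriv B :=
  field_ext fun n => by simp only [deriv_ncoeff, ncoeff_add, smul_add]

theorem deriv_sub (A B : VertexOperator ℂ V) : deriv (A - B) = deriv A - deriv B :=
  field_ext fun n => by simp only [deriv_ncoeff, ncoeff_sub, smul_sub]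

theorem deriv_smul (r : ℂ) (A : VertexOperator ℂ V) : deriv (r • A) = r • deriv A :=
  field_ext fun n => by simp only [deriv_ncoeff, ncoeff_smul, smul_comm r]

theorem deriv_zero : deriv (0 : VertexOperator ℂ V) = 0 :=
  field_ext fun n => by simp only [deriv_ncoeff, ncoeff_zero, smul_zero]

/-- The `p`-th summand of the `n`-th mode of `:AB:`. -/
def ordTerm (s : ℂ) (A B : VertexOperator ℂ V) (n p : ℤ) : Module.End ℂ V :=
  if p < 0 then A[[p]] * B[[n - 1 - p]] else s • (B[[n - 1 - p]] * A[[p]])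

theorem finite_comp (A B : VertexOperator ℂ V) (e K : ℤ) (v : V) :
    {p : ℤ | p < K ∧ (A[[p]]) ((B[[e - p]]) v) ≠ 0}.Finite := by
  obtain ⟨N, hN⟩ := exists_ncoeff_eq_zero B v
  refine (Set.finite_Ioo (e - N) K).subset fun p hp => ⟨?_, hp.1⟩
  by_contra h
  exact hp.2 (by rw [hN _ (by omega), map_zero])

theorem ordTerm_finite (s : ℂ) (A B : VertexOperator ℂ V) (n : ℤ) (v : V) :
    Function.HasFiniteSupport fun p => ordTerm s A B n p v := by
  obtain ⟨K, hK⟩ := exists_ncoeff_eq_zero A v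
  refine ((finite_comp A B (n - 1) 0 v).union (Set.finite_Ico 0 K)).subset fun p hp => ?_
  rw [Function.mem_support, ordTerm] at hp
  split_ifs at hp with h
  · exact Or.inl ⟨h, hp⟩
  · refine Or.inr ⟨not_lt.1 h, not_le.1 fun h' => hp ?_⟩
    simp [hK p h']

theorem finsum_int {M : Type*} [AddCommMonoid M] {f : ℤ → M} (hf : Function.HasFiniteSupport f) :
    ∑ᶠ p, f p = ∑ᶠ j : ℕ, f (-(j : ℤ) - 1) + ∑ᶠ j : ℕ, f j := by
  have h1 : Function.Injective fun j : ℕ => -(j : ℤ) - 1 := fun i j h => by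
    simp only at h; omega
  have h2 : Function.Injective fun j : ℕ => (j : ℤ) := Nat.cast_injective
  have h3 : (Set.range fun j : ℕ => -(j : ℤ) - 1) ∪ (Set.range fun j : ℕ => (j : ℤ)) =
      Set.univ := by
    refine Set.eq_univ_of_forall fun p => ?_
    rcases lt_or_ge p 0 with h | h
    · exact Or.inl ⟨(-p - 1).toNat, by simp only; omega⟩
    · exact Or.inr ⟨p.toNat, by simp only; omega⟩
  rw [← finsum_mem_range (f := f) h1, ← finsum_mem_range (f := f) h2,
    ← finsum_mem_union' _ (hf.subset Set.inter_subset_right) (hf.subset Set.inter_subset_right),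
    h3, finsum_mem_univ]
  rw [Set.disjoint_left]
  rintro _ ⟨i, rfl⟩ ⟨j, hj⟩
  simp only at hj
  omega

/-- Merging the two half-line sums into one sum over the index of the first factor allows identities
between normally ordered products to be checked term by term. -/
theorem normalProd_apply (s : ℂ) (A B : VertexOperator ℂ V) (n : ℤ) (v : V) :
    ((normalProd s A B)[[n]]) v = ∑ᶠ p, ordTerm s A B n p v := by
  rw [finsum_int (ordTerm_finite s A B n v), normalProd, ofModes_ncoeff, LinearMap.add_apply,
    LinearMap.smul_apply, locSum_apply, locSum_apply, smul_finsum]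
  congr 1
  · refine finsum_congr fun j => ?_
    rw [ordTerm, if_pos (by omega)]
    rw [show n - 1 - (-(j : ℤ) - 1) = n + j by ring]
  · refine finsum_congr fun j => ?_
    rw [ordTerm, if_neg (by omega)]
    rw [show n - 1 - (j : ℤ) = n - j - 1 by ring]
    rfl

theorem mul_normalProd_apply (X : Module.End ℂ V) (s : ℂ) (A B : VertexOperator ℂ V) (n : ℤ)
    (v : V) : X (((normalProd s A B)[[n]]) v) = ∑ᶠ p, X (ordTerm s A B n p v) := by
  rw [normalProd_apply]
  exact AddMonoidHom.map_finsum X.toAddMonoidHom (ordTerm_finite s A B n v)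

theorem normalProd_ext {s t : ℂ} {A B C D : VertexOperator ℂ V} {n m : ℤ}
    (h : ∀ p, ordTerm s A B n p = ordTerm t C D m p) :
    (normalProd s A B)[[n]] = (normalProd t C D)[[m]] := by
  ext v
  simp only [normalProd_apply, h]

theorem normalProd_add_left (s : ℂ) (A A' B : VertexOperator ℂ V) :
    normalProd s (A + A') B = normalProd s A B + normalProd s A' B := by
  refine field_ext fun n => LinearMap.ext fun v => ?_
  rw [ncoeff_add, LinearMap.add_apply]
  simp only [normalProd_apply]
  rw [← finsum_add_distrib (ordTerm_finite _ _ _ _ _) (ordTerm_finite _ _ _ _ _)]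
  refine finsum_congr fun p => ?_
  simp only [ordTerm, ncoeff_add]
  split_ifs
  · simp [add_mul]
  · simp [mul_add]

theorem normalProd_add_right (s : ℂ) (A B B' : VertexOperator ℂ V) :
    normalProd s A (B + B') = normalProd s A B + normalProd s A B' := by
  refine field_ext fun n => LinearMap.ext fun v => ?_
  rw [ncoeff_add, LinearMap.add_apply]
  simp only [normalProd_apply]
  rw [← finsum_add_distrib (ordTerm_finite _ _ _ _ _) (ordTerm_finite _ _ _ _ _)]
  refine finsum_congr fun p => ?_
  simp only [ordTerm, ncoeff_add]
  split_ifs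
  · simp [mul_add]
  · simp [add_mul]

theorem normalProd_smul_left (s r : ℂ) (A B : VertexOperator ℂ V) :
    normalProd s (r • A) B = r • normalProd s A B := by
  refine field_ext fun n => LinearMap.ext fun v => ?_
  rw [ncoeff_smul, LinearMap.smul_apply]
  simp only [normalProd_apply]
  rw [smul_finsum]
  refine finsum_congr fun p => ?_
  simp only [ordTerm, ncoeff_smul]
  split_ifs
  · simp
  · simp [smul_comm r]

theorem normalProd_smul_right (s r : ℂ) (A B : VertexOperator ℂ V) :
    normalProd s A (r • B) = r • normalProd s A B := by
  refine field_ext fun n => LinearMap.ext fun v => ?_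
  rw [ncoeff_smul, LinearMap.smul_apply]
  simp only [normalProd_apply]
  rw [smul_finsum]
  refine finsum_congr fun p => ?_
  simp only [ordTerm, ncoeff_smul]
  split_ifs
  · simp
  · simp [smul_comm r]

theorem normalProd_zero_left (s : ℂ) (B : VertexOperator ℂ V) : normalProd s 0 B = 0 := by
  simpa using normalProd_smul_left s 0 0 B

theorem normalProd_zero_right (s : ℂ) (A : VertexOperator ℂ V) : normalProd s A 0 = 0 := by
  simpa using normalProd_smul_right s 0 A 0

theorem normalProd_neg_right (s : ℂ) (A B : VertexOperator ℂ V) :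
    normalProd s A (-B) = -normalProd s A B := by
  rw [eq_neg_iff_add_eq_zero, ← normalProd_add_right, neg_add_cancel, normalProd_zero_right]

theorem normalProd_sub_right (s : ℂ) (A B B' : VertexOperator ℂ V) :
    normalProd s A (B - B') = normalProd s A B - normalProd s A B' := by
  rw [sub_eq_add_neg, normalProd_add_right, normalProd_neg_right, sub_eq_add_neg]

/-- `∂` is a derivation of the normally ordered product. -/
theorem deriv_normalProd (s : ℂ) (A B : VertexOperator ℂ V) :
    deriv (normalProd s A B) = normalProd s (deriv A) B + normalProd s A (deriv B) := by
  refine field_ext fun n => LinearMap.ext fun v => ?_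
  rw [ncoeff_add, LinearMap.add_apply, deriv_ncoeff, LinearMap.smul_apply]
  simp only [normalProd_apply]
  rw [← finsum_comp_equiv (Equiv.addRight (1 : ℤ)) (f := fun p => ordTerm s (deriv A) B n p v),
    ← finsum_add_distrib _ (ordTerm_finite _ _ _ _ _), smul_finsum]
  · refine finsum_congr fun p => ?_
    simp only [ordTerm, deriv_ncoeff, Equiv.coe_addRight, add_sub_cancel_right]
    rw [show n - 1 - (p + 1) = n - 1 - 1 - p by ring, show n - 1 - p - 1 = n - 1 - 1 - p by ring]
    -- After the reindexing `p ↦ p + 1` the cut between creation and annihilation modes of `∂A` is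
    -- displaced only at `p = -1`, where the coefficient of `(∂A)₍₀₎` is zero. Elsewhere the
    -- coefficients `-(p + 1)` and `-(n - 1 - p)` add up to `-n`.
    rcases lt_trichotomy p (-1) with h | rfl | h
    · rw [if_pos (by omega), if_pos (by omega), if_pos (by omega)]
      simp only [LinearMap.smul_apply, Module.End.mul_apply, map_smul, ← add_smul]
      congr 1
      push_cast
      ring
    · simp
    · rw [if_neg (by omega), if_neg (by omega), if_neg (by omega)]
      simp only [LinearMap.smul_apply, Module.End.mul_apply, map_smul, ← add_smul,
        smul_comm s]
      congr 1
      push_cast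
      ring
  · exact (ordTerm_finite s (deriv A) B n v).preimage (Equiv.injective _).injOn

/-! ### Shifts -/

/-- The field `z^m A(z)`. -/
def shift (m : ℤ) (A : VertexOperator ℂ V) : VertexOperator ℂ V :=
  ofModes (fun n => A[[n + m]]) (by
    intro v
    obtain ⟨N, hN⟩ := exists_ncoeff_eq_zero A v
    exact ⟨N - m, fun n hn => hN _ (by omega)⟩)

/-- The field `z^m`. -/
def zpowField (V : Type*) [AddCommGroup V] [Module ℂ V] (m : ℤ) : VertexOperator ℂ V :=
  ofModes (fun n => if n = -1 - m then 1 else 0) (by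
    intro v
    exact ⟨-m, fun n hn => by rw [if_neg (by omega)]; rfl⟩)

theorem shift_ncoeff (m : ℤ) (A : VertexOperator ℂ V) (n : ℤ) : (shift m A)[[n]] = A[[n + m]] := by
  rw [shift, ofModes_ncoeff]

theorem zpowField_ncoeff (m n : ℤ) :
    (zpowField V m)[[n]] = if n = -1 - m then 1 else 0 := by
  rw [zpowField, ofModes_ncoeff]

theorem deriv_zpowField (m : ℤ) : deriv (zpowField V m) = (m : ℂ) • zpowField V (m - 1) := by
  refine field_ext fun n => ?_
  rw [deriv_ncoeff, ncoeff_smul, zpowField_ncoeff, zpowField_ncoeff]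
  by_cases h : n = -m
  · subst h
    rw [if_pos (by ring), if_pos (by ring)]
    simp
  · rw [if_neg (by omega), if_neg (by omega)]
    simp

theorem normalProd_shift_right (s : ℂ) (m : ℤ) (A B : VertexOperator ℂ V) :
    normalProd s A (shift m B) = shift m (normalProd s A B) := by
  refine field_ext fun n => ?_
  rw [shift_ncoeff]
  refine normalProd_ext fun p => ?_
  simp only [ordTerm, shift_ncoeff]
  rw [show n - 1 - p + m = n + m - 1 - p by ring]

/-- Contracting one factor of a product leaves a scalar power of `z` in its place; such a factor
only translates the modes of the other one. -/
theorem normalProd_zpowField_left (m : ℤ) (B : VertexOperator ℂ V) :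
    normalProd 1 (zpowField V m) B = shift m B := by
  refine field_ext fun n => LinearMap.ext fun v => ?_
  rw [normalProd_apply, finsum_eq_single _ (-1 - m), shift_ncoeff]
  · simp only [ordTerm, zpowField_ncoeff]
    rw [show n - 1 - (-1 - m) = n + m by ring]
    simp
  · intro p hp
    simp [ordTerm, zpowField_ncoeff, hp]

theorem normalProd_zpowField_right (m : ℤ) (A : VertexOperator ℂ V) :
    normalProd 1 A (zpowField V m) = shift m A := by
  refine field_ext fun n => LinearMap.ext fun v => ?_
  rw [normalProd_apply, finsum_eq_single _ (n + m), shift_ncoeff]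
  · simp only [ordTerm, zpowField_ncoeff]
    rw [if_pos (show n - 1 - (n + m) = -1 - m by ring)]
    simp
  · intro p hp
    simp only [ordTerm, zpowField_ncoeff]
    rw [if_neg (show ¬ n - 1 - p = -1 - m by omega)]
    simp

/-! ### Brackets with operators -/

/-- `X A(z) - s A(z) X = A'(z)`. -/
def Bracket (s : ℂ) (X : Module.End ℂ V) (A A' : VertexOperator ℂ V) : Prop :=
  ∀ n, X * A[[n]] = s • (A[[n]] * X) + A'[[n]]

namespace Bracket

variable {s s' t : ℂ} {X Y : Module.End ℂ V} {A A' A'' B B' : VertexOperator ℂ V}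

theorem congr (h : Bracket s X A A') (e : A' = A'') : Bracket s X A A'' := e ▸ h

theorem deriv (h : Bracket s X A A') : Bracket s X (deriv A) (deriv A') := fun n => by
  simp only [deriv_ncoeff, mul_smul_comm, h (n - 1), smul_add, smul_mul_assoc]
  rw [smul_comm]

theorem smul (h : Bracket s X A A') (r : ℂ) : Bracket s X (r • A) (r • A') := fun n => by
  simp only [ncoeff_smul, mul_smul_comm, h n, smul_add, smul_mul_assoc]
  rw [smul_comm]

theorem add (h : Bracket s X A A') (k : Bracket s X B B') : Bracket s X (A + B) (A' + B') :=
  fun n => by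
    simp only [ncoeff_add, mul_add, add_mul, h n, k n, smul_add]
    abel

theorem neg (h : Bracket s X A A') : Bracket s X (-A) (-A') := by
  rw [← neg_one_smul ℂ A, ← neg_one_smul ℂ A']
  exact h.smul (-1)

theorem sub (h : Bracket s X A A') (k : Bracket s X B B') : Bracket s X (A - B) (A' - B') := by
  simpa [sub_eq_add_neg] using h.add k.neg

/-- The Leibniz rule holds without contraction terms, because the operator acts on the modes of each
summand and does not disturb their order. The ordering sign changes to `t * s'` or `t * s` because
bracketing with an odd operator flips the parity of the factor. -/
theorem normalProd (h : Bracket s X A A') (k : Bracket s' X B B') (hs : s * s = 1) (t : ℂ) :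
    Bracket (s * s') X (normalProd t A B)
      (W2BRST.normalProd (t * s') A' B + s • W2BRST.normalProd (t * s) A B') := fun n => by
  ext v
  simp only [ncoeff_add, ncoeff_smul, LinearMap.add_apply, LinearMap.smul_apply,
    Module.End.mul_apply]
  rw [mul_normalProd_apply]
  simp only [normalProd_apply]
  have f1 := ordTerm_finite (t * s') A' B n v
  have f2 := ordTerm_finite (t * s) A B' n v
  have f3 := ordTerm_finite t A B n (X v)
  rw [smul_finsum, smul_finsum, ← finsum_add_distrib f1 (by fun_prop),
    ← finsum_add_distrib (by fun_prop) (by fun_prop)]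
  refine finsum_congr fun p => ?_
  have hA := fun u => LinearMap.congr_fun (h p) u
  have hB := fun u => LinearMap.congr_fun (k (n - 1 - p)) u
  simp only [Module.End.mul_apply, LinearMap.add_apply, LinearMap.smul_apply] at hA hB
  simp only [ordTerm]
  split_ifs
  · simp only [Module.End.mul_apply, hA, hB, map_add, map_smul]
    module
  · simp only [Module.End.mul_apply, LinearMap.smul_apply, hA, hB, map_add, map_smul]
    rw [smul_smul s, show s * (t * s) = t by linear_combination t * hs]
    module

end Bracket

end Calculus


/-! ## Commutativity and associativity of normally ordered products -/

section Associativity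

variable {V : Type*} [AddCommGroup V] [Module ℂ V]

/-- The fields `A` and `B` commute up to the sign `s`. -/
def SuperCommute (s : ℂ) (A B : VertexOperator ℂ V) : Prop :=
  ∀ p q, A[[p]] * B[[q]] = s • (B[[q]] * A[[p]])

namespace SuperCommute

variable {s s' : ℂ} {A B C : VertexOperator ℂ V}

theorem symm (h : SuperCommute s A B) (hs : s * s = 1) : SuperCommute s B A := fun p q => by
  rw [h q p, smul_smul, hs, one_smul]

theorem deriv_right (h : SuperCommute s A B) : SuperCommute s A (deriv B) := fun p q => by
  simp only [deriv_ncoeff, mul_smul_comm, smul_mul_assoc, h p (q - 1)]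
  rw [smul_comm]

theorem deriv_left (h : SuperCommute s A B) : SuperCommute s (deriv A) B := fun p q => by
  simp only [deriv_ncoeff, mul_smul_comm, smul_mul_assoc, h (p - 1) q]
  rw [smul_comm]

theorem add_right (h : SuperCommute s A B) (k : SuperCommute s A C) :
    SuperCommute s A (B + C) := fun p q => by
  simp only [ncoeff_add, mul_add, add_mul, h p q, k p q, smul_add]

theorem sub_right (h : SuperCommute s A B) (k : SuperCommute s A C) :
    SuperCommute s A (B - C) := fun p q => by
  simp only [ncoeff_sub, mul_sub, sub_mul, h p q, k p q, smul_sub]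

theorem smul_right (h : SuperCommute s A B) (r : ℂ) : SuperCommute s A (r • B) := fun p q => by
  simp only [ncoeff_smul, mul_smul_comm, smul_mul_assoc, h p q]
  rw [smul_comm]

theorem bracket (h : SuperCommute s A B) (p : ℤ) : Bracket s (A[[p]]) B 0 := fun q => by
  rw [h p q, ncoeff_zero, add_zero]

theorem of_bracket (h : ∀ p, Bracket s (A[[p]]) B 0) : SuperCommute s A B := fun p q => by
  rw [h p q, ncoeff_zero, add_zero]

theorem normalProd_right (h : SuperCommute s A B) (k : SuperCommute s' A C) (hs : s * s = 1)
    (t : ℂ) : SuperCommute (s * s') A (normalProd t B C) :=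
  of_bracket fun p => (((h.bracket p).normalProd (k.bracket p) hs t).congr (by
    rw [normalProd_zero_left, normalProd_zero_right, smul_zero, add_zero]))

theorem ordTerm_eq (h : SuperCommute s A B) (n p : ℤ) :
    ordTerm s A B n p = A[[p]] * B[[n - 1 - p]] := by
  rw [ordTerm]
  split_ifs
  · rfl
  · rw [h]

/-- For fields commuting up to the sign used in the ordering, the order of the modes is immaterial
and the product is a plain convolution. -/
theorem normalProd_apply (h : SuperCommute s A B) (n : ℤ) (v : V) :
    ((normalProd s A B)[[n]]) v = ∑ᶠ p, (A[[p]]) ((B[[n - 1 - p]]) v) := by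
  rw [W2BRST.normalProd_apply]
  exact finsum_congr fun p => by rw [h.ordTerm_eq, Module.End.mul_apply]

theorem finite (h : SuperCommute s A B) (n : ℤ) (v : V) :
    Function.HasFiniteSupport fun p => (A[[p]]) ((B[[n - 1 - p]]) v) := by
  have := ordTerm_finite s A B n v
  simp only [h.ordTerm_eq] at this
  exact this

/-- Moving `A₍ₚ₎` onto `v` gives a bound that is uniform in the index of `B`; this is what makes the
double sums for triple products finite. -/
theorem exists_zero_left (h : SuperCommute s A B) (v : V) :
    ∃ N : ℤ, ∀ p q, N ≤ p → (A[[p]]) ((B[[q]]) v) = 0 := by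
  obtain ⟨N, hN⟩ := exists_ncoeff_eq_zero A v
  refine ⟨N, fun p q hp => ?_⟩
  rw [← Module.End.mul_apply, h, LinearMap.smul_apply, Module.End.mul_apply, hN p hp, map_zero,
    smul_zero]

theorem normalProd_comm (h : SuperCommute s A B) (hs : s * s = 1) :
    normalProd s A B = s • normalProd s B A := by
  refine field_ext fun n => LinearMap.ext fun v => ?_
  rw [ncoeff_smul, LinearMap.smul_apply, h.normalProd_apply, (h.symm hs).normalProd_apply,
    smul_finsum, ← finsum_comp_equiv (Equiv.subLeft (n - 1))]
  refine finsum_congr fun p => ?_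
  rw [Equiv.subLeft_apply, sub_sub_cancel, ← Module.End.mul_apply, h]
  rfl

theorem normalProd_self (h : SuperCommute (-1) A A) : normalProd (-1) A A = 0 := by
  have h1 := h.normalProd_comm (by norm_num)
  have h2 : (2 : ℂ) • normalProd (-1) A A = 0 := by
    rw [two_smul]
    nth_rewrite 1 [h1]
    module
  exact (smul_eq_zero.1 h2).resolve_left two_ne_zero

end SuperCommute

/-- Two fields whose modes satisfy a Heisenberg commutation relation have a symmetric normally
ordered product. -/
theorem normalProd_comm_of_heisenberg {A B : VertexOperator ℂ V} {κ : ℂ}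
    (h : ∀ p q, A[[p]] * B[[q]] = B[[q]] * A[[p]] +
      if p + q = 0 then (κ * p) • (1 : Module.End ℂ V) else 0) :
    normalProd 1 A B = normalProd 1 B A := by
  refine field_ext fun n => LinearMap.ext fun v => ?_
  rw [normalProd_apply, normalProd_apply, ← finsum_comp_equiv (Equiv.subLeft (n - 1))]
  refine finsum_congr fun p => ?_
  rw [Equiv.subLeft_apply]
  congr 1
  simp only [ordTerm, sub_sub_cancel, one_smul]
  have h1 := h (n - 1 - p) p
  -- The two indices sum to `n - 1`, so a contraction can occur only for `n = 1`. There both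
  -- products use the same order when `p ≠ 0`, and at `p = 0` the contraction `κ * 0` is zero.
  by_cases hn : n = 1
  · subst hn
    rcases lt_trichotomy p 0 with hp | rfl | hp
    · rw [if_neg (by omega), if_pos hp]
    · simpa using h1.symm
    · rw [if_pos (by omega), if_neg (by omega)]
  · rw [if_neg (by omega), add_zero] at h1
    rw [h1]
    split_ifs <;> rfl

/-- Finiteness on pairs of indices justifies exchanging an iterated sum for a sum over `ℤ × ℤ`. The
outer index is bounded first, and each fibre is then finite because it comes from a single product.
-/
theorem finite_triple_left {sAB : ℂ} {A B C : VertexOperator ℂ V} (hAB : SuperCommute sAB A B)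
    (s : ℂ) (n : ℤ) (v : V) :
    Function.HasFiniteSupport fun x : ℤ × ℤ =>
      if x.1 < 0 then (A[[x.2]]) ((B[[x.1 - 1 - x.2]]) ((C[[n - 1 - x.1]]) v))
      else s • (C[[n - 1 - x.1]]) ((A[[x.2]]) ((B[[x.1 - 1 - x.2]]) v)) := by
  obtain ⟨NA, hNA⟩ := hAB.exists_zero_left v
  obtain ⟨NB, hNB⟩ := exists_ncoeff_eq_zero B v
  obtain ⟨NC, hNC⟩ := exists_ncoeff_eq_zero C v
  refine Set.Finite.of_finite_fibers Prod.fst ?_ fun m _ => ?_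
  · refine (Set.finite_Ioo (min (n - 1 - NC) (-1)) (max (NA + NB + 1) 0)).subset ?_
    rintro _ ⟨⟨m, p⟩, hx, rfl⟩
    simp only [Function.mem_support] at hx
    split_ifs at hx with h
    · by_contra h'
      refine hx ?_
      rw [hNC _ (by simp at h'; omega)]
      simp
    · by_contra h'
      refine hx ?_
      rcases le_or_gt NA p with h1 | h1
      · rw [hNA _ _ h1]
        simp
      · rw [hNB _ (by simp at h'; omega)]
        simp
  · refine Set.Finite.subset ((((hAB.finite m ((C[[n - 1 - m]]) v)).union
      (hAB.finite m v)).image fun p => (m, p))) ?_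
    rintro ⟨m', p⟩ ⟨hx, rfl⟩
    simp only [Function.mem_support] at hx
    refine ⟨p, ?_, rfl⟩
    split_ifs at hx with h
    · exact Or.inl hx
    · refine Or.inr fun h' => hx ?_
      simp only at h'
      rw [h', map_zero, smul_zero]

theorem finite_triple_right (A B C : VertexOperator ℂ V) (s t : ℂ) (n : ℤ) (v : V) :
    Function.HasFiniteSupport fun x : ℤ × ℤ =>
      if x.1 < 0 then (A[[x.1]]) (ordTerm s B C (n - 1 - x.1) x.2 v)
      else t • ordTerm s B C (n - 1 - x.1) x.2 ((A[[x.1]]) v) := by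
  obtain ⟨NA, hNA⟩ := exists_ncoeff_eq_zero A v
  obtain ⟨NB, hNB⟩ := exists_ncoeff_eq_zero B v
  obtain ⟨NC, hNC⟩ := exists_ncoeff_eq_zero C v
  -- Only the finitely many indices `0 ≤ q < NB` leave `B₍q₎ v` possibly nonzero, so one bound `S`
  -- serves for the action of `C` on all these vectors.
  choose P hP using fun j : ℕ => exists_ncoeff_eq_zero C ((B[[(j : ℤ)]]) v)
  obtain ⟨S, hS⟩ := ((Finset.range NB.toNat).image P).exists_le
  refine Set.Finite.of_finite_fibers Prod.fst ?_ fun m _ => ?_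
  · refine (Set.finite_Ioo (min (min (n - 2 - NC) (n - 2 - S - NB)) (-1)) (max NA 0)).subset ?_
    rintro _ ⟨⟨p, q⟩, hx, rfl⟩
    simp only [Function.mem_support] at hx
    by_contra h'
    refine hx ?_
    split_ifs with h
    · rw [ordTerm]
      split_ifs with hq
      · rw [Module.End.mul_apply, hNC _ (by simp at h'; omega)]
        simp
      · rw [LinearMap.smul_apply, Module.End.mul_apply]
        rcases le_or_gt NB q with h1 | h1
        · rw [hNB q h1]
          simp
        · obtain ⟨j, rfl⟩ := Int.eq_ofNat_of_zero_le (not_lt.1 hq)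
          have := hS (P j) (Finset.mem_image_of_mem _ (Finset.mem_range.2 (by omega)))
          rw [hP j _ (by simp at h'; omega)]
          simp
    · rw [hNA _ (by simp at h'; omega)]
      simp
  · refine Set.Finite.subset ((((ordTerm_finite s B C (n - 1 - m) v).union
      (ordTerm_finite s B C (n - 1 - m) ((A[[m]]) v))).image fun p => (m, p))) ?_
    rintro ⟨m', p⟩ ⟨hx, rfl⟩
    simp only [Function.mem_support] at hx
    refine ⟨p, ?_, rfl⟩
    split_ifs at hx with h
    · refine Or.inl fun h' => hx ?_
      simp only at h'
      rw [h', map_zero]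
    · refine Or.inr fun h' => hx ?_
      simp only at h'
      rw [h', smul_zero]

/-- The pair records the indices of `A` and `B`. The corresponding mode of `:AB:` is `p + q + 1`, so
it is a creation mode exactly when `p + q < -1`, whereas in the other bracketing the condition
concerns `p` and `q` separately. -/
theorem normalProd_normalProd_left_apply {sAB : ℂ} {A B C : VertexOperator ℂ V}
    (hAB : SuperCommute sAB A B) (s : ℂ) (n : ℤ) (v : V) :
    ((normalProd s (normalProd sAB A B) C)[[n]]) v = ∑ᶠ x : ℤ × ℤ,
      if x.1 + x.2 < -1 then (A[[x.1]]) ((B[[x.2]]) ((C[[n - 2 - x.1 - x.2]]) v))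
      else s • (C[[n - 2 - x.1 - x.2]]) ((A[[x.1]]) ((B[[x.2]]) v)) := by
  let e : ℤ × ℤ ≃ ℤ × ℤ :=
    { toFun := fun x => (x.1 + x.2 + 1, x.1)
      invFun := fun y => (y.2, y.1 - 1 - y.2)
      left_inv := fun x => by ext <;> simp
      right_inv := fun y => by ext <;> simp }
  have h1 := finsum_comp_equiv e (f := fun x : ℤ × ℤ =>
      if x.1 < 0 then (A[[x.2]]) ((B[[x.1 - 1 - x.2]]) ((C[[n - 1 - x.1]]) v))
      else s • (C[[n - 1 - x.1]]) ((A[[x.2]]) ((B[[x.1 - 1 - x.2]]) v)))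
  rw [finsum_curry _ (finite_triple_left hAB s n v)] at h1
  rw [normalProd_apply]
  refine Eq.trans (finsum_congr fun m => ?_) (h1.symm.trans (finsum_congr fun x => ?_))
  · rw [ordTerm]
    simp only
    split_ifs
    · rw [Module.End.mul_apply, hAB.normalProd_apply]
    · rw [LinearMap.smul_apply, Module.End.mul_apply, hAB.normalProd_apply, ← smul_finsum]
      congr 1
      exact AddMonoidHom.map_finsum (C[[n - 1 - m]]).toAddMonoidHom (hAB.finite m v)
  · obtain ⟨p, q⟩ := x
    simp only [e, Equiv.coe_fn_mk]
    rw [show n - 1 - (p + q + 1) = n - 2 - p - q by ring, show p + q + 1 - 1 - p = q by ring]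
    by_cases h : p + q < -1
    · rw [if_pos h, if_pos (by omega)]
    · rw [if_neg h, if_neg (by omega)]

theorem normalProd_normalProd_right_apply (A B C : VertexOperator ℂ V) (s t : ℂ) (n : ℤ) (v : V) :
    ((normalProd t A (normalProd s B C))[[n]]) v = ∑ᶠ x : ℤ × ℤ,
      if x.1 < 0 then (A[[x.1]]) (ordTerm s B C (n - 1 - x.1) x.2 v)
      else t • ordTerm s B C (n - 1 - x.1) x.2 ((A[[x.1]]) v) := by
  rw [finsum_curry _ (finite_triple_right A B C s t n v), normalProd_apply]
  refine finsum_congr fun p => ?_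
  rw [ordTerm]
  simp only
  split_ifs
  · rw [Module.End.mul_apply, mul_normalProd_apply]
  · rw [LinearMap.smul_apply, Module.End.mul_apply, normalProd_apply, smul_finsum]

/-- Associativity for fields that commute up to signs. -/
theorem normalProd_assoc {sAB sAC sBC : ℂ} {A B C : VertexOperator ℂ V}
    (hAB : SuperCommute sAB A B) (hAC : SuperCommute sAC A C) (hBC : SuperCommute sBC B C) :
    normalProd (sAC * sBC) (normalProd sAB A B) C =
      normalProd (sAB * sAC) A (normalProd sBC B C) := by
  refine field_ext fun n => LinearMap.ext fun v => ?_
  rw [normalProd_normalProd_left_apply hAB, normalProd_normalProd_right_apply]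
  refine finsum_congr fun ⟨p, q⟩ => ?_
  have e1 : ∀ p q v, (A[[p]]) ((B[[q]]) v) = sAB • (B[[q]]) ((A[[p]]) v) := fun p q v =>
    LinearMap.congr_fun (hAB p q) v
  have e2 : ∀ p q v, (A[[p]]) ((C[[q]]) v) = sAC • (C[[q]]) ((A[[p]]) v) := fun p q v =>
    LinearMap.congr_fun (hAC p q) v
  have e3 : ∀ p q v, (B[[p]]) ((C[[q]]) v) = sBC • (C[[q]]) ((B[[p]]) v) := fun p q v =>
    LinearMap.congr_fun (hBC p q) v
  simp only [ordTerm]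
  rw [show n - 1 - p - 1 - q = n - 2 - p - q by ring]
  -- Whatever the order prescribed in each case, moving the modes into the order `C B A` produces
  -- the same coefficient `sAB * sAC * sBC`.
  split_ifs <;> simp only [LinearMap.smul_apply, Module.End.mul_apply, e1, e2, e3, map_smul] <;>
    module

/-- This is the telescoping sum of `β = Δσ` over the signed interval from `0` to `-1 - p`. The two
branches are the two orientations of the interval; it evaluates the total contraction when a triple
product is rebracketed. -/
theorem finsum_interval (σ β : ℤ → ℂ) (hσ0 : σ 0 = 0) (hσ : ∀ k, σ (k + 1) = σ k + β k) (p : ℤ)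
    (y : V) :
    ∑ᶠ q : ℤ, (if p < 0 ∧ 0 ≤ q ∧ p + q < -1 then β q • y
      else if 0 ≤ p ∧ q < 0 ∧ -1 ≤ p + q then -(β q • y) else 0) = σ (-1 - p) • y := by
  have key : ∀ (k : ℕ), (∑ᶠ q : ℤ, if 0 ≤ q ∧ q < k then β q • y else 0) = σ k • y ∧
      (∑ᶠ q : ℤ, if q < 0 ∧ -(k : ℤ) ≤ q then -(β q • y) else 0) = σ (-k) • y := by
    intro k
    induction k with
    | zero =>
      constructor
      · rw [finsum_eq_zero_of_forall_eq_zero]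
        · simp [hσ0]
        · intro q; rw [if_neg (by push_cast; omega)]
      · rw [finsum_eq_zero_of_forall_eq_zero]
        · simp [hσ0]
        · intro q; rw [if_neg (by push_cast; omega)]
    | succ k ih =>
      constructor
      · have h1 : ∀ q : ℤ, (if 0 ≤ q ∧ q < (k + 1 : ℕ) then β q • y else 0) =
            (if 0 ≤ q ∧ q < k then β q • y else 0) + if q = k then β q • y else 0 := by
          intro q
          by_cases h : q = k
          · rw [if_pos (by push_cast; omega), if_neg (by omega), if_pos h, zero_add]
          · by_cases h' : 0 ≤ q ∧ q < k
            · rw [if_pos (by push_cast; omega), if_pos h', if_neg h, add_zero]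
            · rw [if_neg (by push_cast; omega), if_neg h', if_neg h, add_zero]
        simp only [h1]
        rw [finsum_add_distrib, ih.1, finsum_eq_single _ (k : ℤ), if_pos rfl]
        · push_cast
          rw [hσ, add_smul]
        · intro q hq
          rw [if_neg hq]
        · refine (Set.finite_Ico (0 : ℤ) k).subset fun q hq => ?_
          by_contra h
          exact hq (if_neg h)
        · refine (Set.finite_singleton (k : ℤ)).subset fun q hq => ?_
          by_contra h
          exact hq (if_neg h)
      · have h1 : ∀ q : ℤ, (if q < 0 ∧ -((k + 1 : ℕ) : ℤ) ≤ q then -(β q • y) else 0) =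
            (if q < 0 ∧ -(k : ℤ) ≤ q then -(β q • y) else 0) +
              if q = -(k : ℤ) - 1 then -(β q • y) else 0 := by
          intro q
          by_cases h : q = -(k : ℤ) - 1
          · rw [if_pos (by push_cast; omega), if_neg (by omega), if_pos h, zero_add]
          · by_cases h' : q < 0 ∧ -(k : ℤ) ≤ q
            · rw [if_pos (by push_cast; omega), if_pos h', if_neg h, add_zero]
            · rw [if_neg (by push_cast; omega), if_neg h', if_neg h, add_zero]
        simp only [h1]
        rw [finsum_add_distrib, ih.2, finsum_eq_single _ (-(k : ℤ) - 1), if_pos rfl]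
        · have := hσ (-(k : ℤ) - 1)
          rw [sub_add_cancel] at this
          rw [this]
          push_cast
          rw [show (-((k : ℤ) + 1)) = -(k : ℤ) - 1 by ring]
          module
        · intro q hq
          rw [if_neg hq]
        · refine (Set.finite_Ico (-(k : ℤ)) 0).subset fun q hq => ?_
          by_contra h
          exact hq (if_neg fun h' => h ⟨h'.2, h'.1⟩)
        · refine (Set.finite_singleton (-(k : ℤ) - 1)).subset fun q hq => ?_
          by_contra h
          exact hq (if_neg h)
  rcases lt_or_ge p 0 with hp | hp
  · obtain ⟨k, hk⟩ := Int.eq_ofNat_of_zero_le (a := -1 - p) (by omega)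
    rw [hk]
    refine (finsum_congr fun q => ?_).trans (key k).1
    by_cases h' : 0 ≤ q ∧ q < k
    · rw [if_pos (by omega), if_pos h']
    · rw [if_neg (by omega), if_neg (by omega), if_neg h']
  · obtain ⟨k, hk⟩ := Int.eq_ofNat_of_zero_le (a := p + 1) (by omega)
    rw [show -1 - p = -(k : ℤ) by omega]
    refine (finsum_congr fun q => ?_).trans (key k).2
    rw [if_neg (by omega)]
    by_cases h' : q < 0 ∧ -(k : ℤ) ≤ q
    · rw [if_pos (by omega), if_pos h']
    · rw [if_neg (by omega), if_neg h']

end Associativity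


/-! ### Rebracketing triple products with contractions; conjugation of fields; weights. -/

section QuasiAssociativity

variable {V : Type*} [AddCommGroup V] [Module ℂ V]

/-- The contribution of a contraction to the difference of two nested normal orderings. -/
def reorderTerm (β : ℤ → ℂ) (p q : ℤ) (y : V) : V :=
  if p < 0 ∧ 0 ≤ q ∧ p + q < -1 then β q • y
  else if 0 ≤ p ∧ q < 0 ∧ -1 ≤ p + q then -(β q • y) else 0

theorem finite_reorderTerm (β : ℤ → ℂ) (p₀ : ℤ) (y : ℤ → V) :
    Function.HasFiniteSupport fun x : ℤ × ℤ =>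
      if x.1 = p₀ then reorderTerm β x.1 x.2 (y x.1) else 0 := by
  refine ((Set.finite_singleton p₀).prod (Set.finite_Ico (-|p₀| - 1) (|p₀| + 1))).subset ?_
  rintro ⟨p, q⟩ hx
  simp only [Function.mem_support, reorderTerm] at hx
  have h1 := le_abs_self p₀
  have h2 := neg_abs_le p₀
  split_ifs at hx with h3 h4 h5
  · exact ⟨h3, by constructor <;> simp only <;> omega⟩
  · exact ⟨h3, by constructor <;> simp only <;> omega⟩
  · exact absurd rfl hx
  · exact absurd rfl hx

theorem finsum_reorderTerm {σ β : ℤ → ℂ} (hσ0 : σ 0 = 0) (hσ : ∀ k, σ (k + 1) = σ k + β k)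
    (p₀ : ℤ) (y : ℤ → V) :
    ∑ᶠ x : ℤ × ℤ, (if x.1 = p₀ then reorderTerm β x.1 x.2 (y x.1) else 0) =
      σ (-1 - p₀) • y p₀ := by
  rw [finsum_curry _ (finite_reorderTerm β p₀ y), finsum_eq_single _ p₀]
  · simp only [if_true, reorderTerm]
    exact finsum_interval σ β hσ0 hσ p₀ (y p₀)
  · intro p hp
    simp [hp]

/-- Associativity up to contractions for three odd fields, the first two of which anticommute. -/
theorem normalProd_quasiAssoc {A B C : VertexOperator ℂ V} {α β σ τ : ℤ → ℂ} {d e : ℤ}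
    (hAB : SuperCommute (-1) A B)
    (hAC : ∀ p r, A[[p]] * C[[r]] = (-1 : ℂ) • (C[[r]] * A[[p]]) +
      if p + r = d then α p • (1 : Module.End ℂ V) else 0)
    (hBC : ∀ p r, B[[p]] * C[[r]] = (-1 : ℂ) • (C[[r]] * B[[p]]) +
      if p + r = e then β p • (1 : Module.End ℂ V) else 0)
    (hτ0 : τ 0 = 0) (hτ : ∀ k, τ (k + 1) = τ k + α k)
    (hσ0 : σ 0 = 0) (hσ : ∀ k, σ (k + 1) = σ k + β k) (n : ℤ) :
    (normalProd 1 (normalProd (-1) A B) C)[[n]] =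
      (normalProd 1 A (normalProd (-1) B C))[[n]] + σ (e + 1 - n) • A[[n - 2 - e]]
        - τ (d + 1 - n) • B[[n - 2 - d]] := by
  ext v
  have f1 := finite_triple_right A B C (-1) 1 n v
  have f2 := finite_reorderTerm β (n - 2 - e) (fun p => (A[[p]]) v)
  have f3 := finite_reorderTerm α (n - 2 - d) (fun p => (B[[p]]) v)
  -- The contraction of `A` with `C` is the mirror image of that of `B` with `C`, with the roles of
  -- the two indices exchanged.
  have f3' : Function.HasFiniteSupport fun x : ℤ × ℤ =>
      if x.2 = n - 2 - d then reorderTerm α x.2 x.1 ((B[[x.2]]) v) else 0 :=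
    f3.preimage (Equiv.prodComm ℤ ℤ).injective.injOn
  have s2 := finsum_reorderTerm hσ0 hσ (n - 2 - e) (fun p => (A[[p]]) v)
  have s3 := finsum_reorderTerm hτ0 hτ (n - 2 - d) (fun p => (B[[p]]) v)
  rw [show -1 - (n - 2 - e) = e + 1 - n by ring] at s2
  rw [show -1 - (n - 2 - d) = d + 1 - n by ring] at s3
  have s3' : ∑ᶠ x : ℤ × ℤ, (if x.2 = n - 2 - d then reorderTerm α x.2 x.1 ((B[[x.2]]) v) else 0) =
      τ (d + 1 - n) • (B[[n - 2 - d]]) v := by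
    rw [← s3, ← finsum_comp_equiv (Equiv.prodComm ℤ ℤ)]
    rfl
  rw [LinearMap.sub_apply, LinearMap.add_apply, LinearMap.smul_apply, LinearMap.smul_apply,
    ← s2, ← s3', normalProd_normalProd_left_apply hAB, normalProd_normalProd_right_apply,
    ← finsum_add_distrib f1 f2, ← finsum_sub_distrib (by fun_prop) f3']
  refine finsum_congr fun ⟨p, q⟩ => ?_
  have eAB : ∀ p q v, (A[[p]]) ((B[[q]]) v) = -(B[[q]]) ((A[[p]]) v) := fun p q v => by
    rw [← Module.End.mul_apply, hAB, neg_one_smul]; rfl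
  have eAC : ∀ v, (A[[p]]) ((C[[n - 2 - p - q]]) v) = -(C[[n - 2 - p - q]]) ((A[[p]]) v) +
      if q = n - 2 - d then α p • v else 0 := fun v => by
    rw [← Module.End.mul_apply, hAC, neg_one_smul]
    by_cases h : q = n - 2 - d
    · rw [if_pos h, if_pos (by omega)]; rfl
    · rw [if_neg h, if_neg (by omega)]; simp
  have eBC : ∀ v, (B[[q]]) ((C[[n - 2 - p - q]]) v) = -(C[[n - 2 - p - q]]) ((B[[q]]) v) +
      if p = n - 2 - e then β q • v else 0 := fun v => by
    rw [← Module.End.mul_apply, hBC, neg_one_smul]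
    by_cases h : p = n - 2 - e
    · rw [if_pos h, if_pos (by omega)]; rfl
    · rw [if_neg h, if_neg (by omega)]; simp
  simp only [ordTerm, reorderTerm, one_smul, neg_one_smul]
  rw [show n - 1 - p - 1 - q = n - 2 - p - q by ring]
  -- When `p` and `q` are both negative or both nonnegative, the two nestings agree after
  -- anticommuting `A` and `B`. For mixed signs, the side of `p + q = -1` decides whether `C` has to
  -- pass `A` or `B`, and this yields the single contraction recorded by `reorderTerm`.
  rcases lt_or_ge p 0 with hp | hp <;> rcases lt_or_ge q 0 with hq | hq
  · rw [if_pos (show p + q < -1 by omega), if_pos hp, if_pos hq,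
      if_neg (show ¬(p < 0 ∧ 0 ≤ q ∧ p + q < -1) by omega),
      if_neg (show ¬(0 ≤ p ∧ q < 0 ∧ -1 ≤ p + q) by omega),
      if_neg (show ¬(q < 0 ∧ 0 ≤ p ∧ q + p < -1) by omega),
      if_neg (show ¬(0 ≤ q ∧ p < 0 ∧ -1 ≤ q + p) by omega)]
    simp
  · rw [if_pos hp, if_neg (show ¬ q < 0 by omega),
      if_neg (show ¬(q < 0 ∧ 0 ≤ p ∧ q + p < -1) by omega)]
    by_cases h : p + q < -1
    · rw [if_pos h, if_pos (show (p < 0 ∧ 0 ≤ q ∧ p + q < -1) by omega),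
        if_neg (show ¬(0 ≤ q ∧ p < 0 ∧ -1 ≤ q + p) by omega)]
      rw [eBC]
      split_ifs <;> simp
    · rw [if_neg h, if_neg (show ¬(p < 0 ∧ 0 ≤ q ∧ p + q < -1) by omega),
        if_neg (show ¬(0 ≤ p ∧ q < 0 ∧ -1 ≤ p + q) by omega),
        if_pos (show (0 ≤ q ∧ p < 0 ∧ -1 ≤ q + p) by omega)]
      simp only [LinearMap.neg_apply, Module.End.mul_apply, map_neg, eAC]
      split_ifs <;> simp
  · rw [if_neg (show ¬ p < 0 by omega), if_pos hq,
      if_neg (show ¬(p < 0 ∧ 0 ≤ q ∧ p + q < -1) by omega)]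
    by_cases h : p + q < -1
    · rw [if_pos h, if_neg (show ¬(0 ≤ p ∧ q < 0 ∧ -1 ≤ p + q) by omega),
        if_pos (show (q < 0 ∧ 0 ≤ p ∧ q + p < -1) by omega)]
      rw [eAB, eAC]
      split_ifs <;> simp <;> abel
    · rw [if_neg h, if_pos (show (0 ≤ p ∧ q < 0 ∧ -1 ≤ p + q) by omega),
        if_neg (show ¬(q < 0 ∧ 0 ≤ p ∧ q + p < -1) by omega),
        if_neg (show ¬(0 ≤ q ∧ p < 0 ∧ -1 ≤ q + p) by omega)]
      simp only [Module.End.mul_apply, eAB, eBC, map_neg]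
      split_ifs <;> simp
  · rw [if_neg (show ¬ p + q < -1 by omega), if_neg (show ¬ p < 0 by omega),
      if_neg (show ¬ q < 0 by omega),
      if_neg (show ¬(p < 0 ∧ 0 ≤ q ∧ p + q < -1) by omega),
      if_neg (show ¬(0 ≤ p ∧ q < 0 ∧ -1 ≤ p + q) by omega),
      if_neg (show ¬(q < 0 ∧ 0 ≤ p ∧ q + p < -1) by omega),
      if_neg (show ¬(0 ≤ q ∧ p < 0 ∧ -1 ≤ q + p) by omega)]
    simp [eAB]

/-! ### Conjugation -/

theorem conjField_ncoeff (g g' : Module.End ℂ V) (A : VertexOperator ℂ V) (n : ℤ) :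
    (conjField g g' A)[[n]] = g * A[[n]] * g' := by
  rw [conjField, ofModes_ncoeff]

theorem conjField_add (g g' : Module.End ℂ V) (A B : VertexOperator ℂ V) :
    conjField g g' (A + B) = conjField g g' A + conjField g g' B :=
  field_ext fun n => by simp only [conjField_ncoeff, ncoeff_add, mul_add, add_mul]

theorem conjField_smul (g g' : Module.End ℂ V) (r : ℂ) (A : VertexOperator ℂ V) :
    conjField g g' (r • A) = r • conjField g g' A :=
  field_ext fun n => by simp only [conjField_ncoeff, ncoeff_smul, mul_smul_comm, smul_mul_assoc]

theorem conjField_deriv (g g' : Module.End ℂ V) (A : VertexOperator ℂ V) :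
    conjField g g' (deriv A) = deriv (conjField g g' A) :=
  field_ext fun n => by simp only [conjField_ncoeff, deriv_ncoeff, mul_smul_comm, smul_mul_assoc]

theorem conjField_normalProd {g g' : Module.End ℂ V} (h : g' * g = 1) (s : ℂ)
    (A B : VertexOperator ℂ V) :
    conjField g g' (normalProd s A B) = normalProd s (conjField g g' A) (conjField g g' B) := by
  refine field_ext fun n => LinearMap.ext fun v => ?_
  rw [conjField_ncoeff, Module.End.mul_apply, Module.End.mul_apply, mul_normalProd_apply,
    normalProd_apply]
  refine finsum_congr fun p => ?_
  have h' : ∀ v, g' (g v) = v := fun v => LinearMap.congr_fun h v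
  simp only [ordTerm, conjField_ncoeff]
  split_ifs <;> simp [h']

/-! ### Weights -/

/-- `[X, A₍ₙ₎] = (α - κ n) A₍ₙ₎`. -/
def HasWeight (X : Module.End ℂ V) (κ α : ℂ) (A : VertexOperator ℂ V) : Prop :=
  ∀ n, X * A[[n]] = A[[n]] * X + (α - κ * n) • A[[n]]

namespace HasWeight

variable {X : Module.End ℂ V} {κ α β γ : ℂ} {A B : VertexOperator ℂ V}

theorem congr (h : HasWeight X κ α A) (e : α = β) : HasWeight X κ β A := e ▸ h

theorem deriv (h : HasWeight X κ α A) : HasWeight X κ (α + κ) (deriv A) := fun n => by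
  simp only [deriv_ncoeff, mul_smul_comm, h (n - 1), smul_add, smul_mul_assoc, smul_smul]
  congr 2
  push_cast
  ring

theorem smul (h : HasWeight X κ α A) (r : ℂ) : HasWeight X κ α (r • A) := fun n => by
  simp only [ncoeff_smul, mul_smul_comm, h n, smul_add, smul_mul_assoc]
  rw [smul_comm r]

theorem add (h : HasWeight X κ α A) (k : HasWeight X κ α B) : HasWeight X κ α (A + B) :=
  fun n => by
    simp only [ncoeff_add, mul_add, add_mul, h n, k n, smul_add]
    abel

theorem sub (h : HasWeight X κ α A) (k : HasWeight X κ α B) : HasWeight X κ α (A - B) :=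
  fun n => by
    simp only [ncoeff_sub, mul_sub, sub_mul, h n, k n, smul_sub]
    abel

/-- In every summand the two indices add up to `n - 1`, so all summands have the same weight; the
missing unit accounts for the extra `κ`. -/
theorem normalProd (h : HasWeight X κ α A) (k : HasWeight X κ β B) (s : ℂ) :
    HasWeight X κ (α + β + κ) (normalProd s A B) := fun n => by
  ext v
  simp only [LinearMap.add_apply, LinearMap.smul_apply, Module.End.mul_apply]
  rw [mul_normalProd_apply]
  simp only [normalProd_apply]
  have f1 := ordTerm_finite s A B n v
  have f2 := ordTerm_finite s A B n (X v)
  rw [smul_finsum, ← finsum_add_distrib f2 (by fun_prop)]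
  refine finsum_congr fun p => ?_
  have hA := fun u => LinearMap.congr_fun (h p) u
  have hB := fun u => LinearMap.congr_fun (k (n - 1 - p)) u
  simp only [Module.End.mul_apply, LinearMap.add_apply, LinearMap.smul_apply] at hA hB
  push_cast at hB
  simp only [ordTerm]
  split_ifs
  · simp only [Module.End.mul_apply, hA, hB, map_add, map_smul]
    module
  · simp only [Module.End.mul_apply, LinearMap.smul_apply, hA, hB, map_add, map_smul]
    module

theorem commute (h : HasWeight X κ α A) {n : ℤ} (e : α = κ * n) : Commute X (A[[n]]) := by
  rw [Commute, SemiconjBy, h n, e, sub_self, zero_smul, add_zero]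

end HasWeight

end QuasiAssociativity


/-! ## Commutation relations of the fields of the complex -/

namespace Bracket

variable {V : Type*} [AddCommGroup V] [Module ℂ V] {X : Module.End ℂ V}
  {A A' B B' F : VertexOperator ℂ V}

/-- The bracket of two odd fields is symmetric. -/
theorem swap_odd {F' : ℤ → VertexOperator ℂ V} (h : ∀ m, Bracket (-1) (A[[m]]) F (F' m)) (n : ℤ)
    (h' : ∀ m, (F' m)[[n]] = A'[[m]]) : Bracket (-1) (F[[n]]) A A' := fun m => by
  have := h m n
  rw [h'] at this
  rw [this]
  module

/-- The bracket of an even field with another field is antisymmetric. -/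
theorem swap_even {F' : ℤ → VertexOperator ℂ V} (h : ∀ m, Bracket 1 (A[[m]]) F (F' m)) (n : ℤ)
    (h' : ∀ m, (F' m)[[n]] = -A'[[m]]) : Bracket 1 (F[[n]]) A A' := fun m => by
  have := h m n
  rw [h'] at this
  rw [this]
  module

theorem nopOdd_odd (h : Bracket (-1) X A A') (k : Bracket (-1) X B B') :
    Bracket 1 X (nopOdd A B) (nop A' B - nop A B') := by
  have := h.normalProd k (by norm_num) (-1)
  rw [show (-1 : ℂ) * -1 = 1 by norm_num] at this
  exact this.congr (by module)

theorem nop_odd_even (h : Bracket (-1) X A A') (k : Bracket 1 X B B') :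
    Bracket (-1) X (nop A B) (nop A' B - nopOdd A B') := by
  have := h.normalProd k (by norm_num) 1
  simp only [mul_one, one_mul] at this
  exact this.congr (by module)

theorem nop_even_odd (h : Bracket 1 X A A') (k : Bracket (-1) X B B') :
    Bracket (-1) X (nop A B) (nopOdd A' B + nop A B') := by
  have := h.normalProd k (by norm_num) 1
  rw [mul_one, one_mul] at this
  exact this.congr (by module)

theorem normalProd_even (h : Bracket 1 X A A') (k : Bracket 1 X B B') (t : ℂ) :
    Bracket 1 X (W2BRST.normalProd t A B)
      (W2BRST.normalProd t A' B + W2BRST.normalProd t A B') := by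
  have := h.normalProd k (by norm_num) t
  rw [mul_one, mul_one] at this
  exact this.congr (by module)

end Bracket

-- These are the canonical anticommutation relations in the exterior algebra. The mixed case is the
-- antiderivation rule for a contraction; two contractions anticommute, and so do two exterior
-- multiplications. In these mode indices conjugate modes pair when their indices sum to `-1`, for
-- all four ghosts alike.
open Classical in
theorem ghostMode_mul (g h : Ghost) (m n : ℤ) :
    ghostMode g m * ghostMode h n = (-1 : ℂ) • (ghostMode h n * ghostMode g m) +
      if h = g.dual ∧ n = -1 - m then 1 else 0 := by
  have hs : ∀ f : Module.End ℂ GhostFock, (-1 : ℂ) • f = -f := fun f => neg_one_smul ℂ f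
  rw [hs]
  have key : ∀ (g h : Ghost) (i j : ℕ), ghostMode g (Int.ofNat i) * ghostMode h (Int.negSucc j) =
      -(ghostMode h (Int.negSucc j) * ghostMode g (Int.ofNat i)) +
        if h = g.dual ∧ i = j then 1 else 0 := by
    intro g h i j
    refine LinearMap.ext fun x => ?_
    simp only [ghostMode, Module.End.mul_apply, LinearMap.mulLeft_apply, LinearMap.add_apply,
      LinearMap.neg_apply]
    refine (CliffordAlgebra.contractLeft_ι_mul _ _ _).trans ?_
    rw [sub_eq_neg_add]
    congr 1
    simp only [Finsupp.lapply_apply, Finsupp.single_apply, Prod.mk.injEq]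
    by_cases e : h = g.dual ∧ i = j
    · rw [if_pos ⟨e.1, e.2.symm⟩, if_pos e, one_smul]; rfl
    · rw [if_neg fun e' => e ⟨e'.1, e'.2.symm⟩, if_neg e, zero_smul]; rfl
  have dual_dual : ∀ g : Ghost, g.dual.dual = g := fun g => by cases g <;> rfl
  match m, n with
  | Int.ofNat i, Int.ofNat j =>
    rw [if_neg (by simp only [Int.ofNat_eq_natCast]; omega), add_zero]
    refine LinearMap.ext fun x => ?_
    exact CliffordAlgebra.contractLeft_comm _ _ _
  | Int.ofNat i, Int.negSucc j =>
    rw [key]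
    congr 1
    have : (Int.negSucc j = -1 - Int.ofNat i) ↔ i = j := by
      rw [Int.negSucc_eq]; simp only [Int.ofNat_eq_natCast]; omega
    simp only [this]
  | Int.negSucc i, Int.ofNat j =>
    have h1 := key h g j i
    have : (Int.ofNat j = -1 - Int.negSucc i) ↔ j = i := by
      rw [Int.negSucc_eq]; simp only [Int.ofNat_eq_natCast]; omega
    have h2 : (g = h.dual) ↔ (h = g.dual) := by
      constructor <;> rintro rfl <;> rw [dual_dual]
    simp only [h2] at h1
    simp only [this]
    rw [h1]
    abel
  | Int.negSucc i, Int.negSucc j =>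
    rw [if_neg (by rw [Int.negSucc_eq, Int.negSucc_eq]; omega), add_zero]
    refine LinearMap.ext fun x => ?_
    simp only [ghostMode, Module.End.mul_apply, LinearMap.mulLeft_apply, LinearMap.neg_apply]
    rw [← mul_assoc, ← mul_assoc, ← neg_mul]
    congr 1
    exact eq_neg_of_add_eq_zero_left (ExteriorAlgebra.ι_add_mul_swap _ _)

section Complex

variable (W Wbar : Type*) [AddCommGroup W] [Module ℂ W] [AddCommGroup Wbar] [Module ℂ Wbar]

/-- The action on the complex of an operator on `W`. -/
def leftHom : Module.End ℂ W →ₐ[ℂ] Module.End ℂ (BRSTComplex W Wbar) :=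
  Module.End.rTensorAlgHom ℂ _ _

/-- The action on the complex of an operator on `W̄`. -/
def rightHom : Module.End ℂ Wbar →ₐ[ℂ] Module.End ℂ (BRSTComplex W Wbar) :=
  (Module.End.lTensorAlgHom ℂ _ _).comp (Module.End.rTensorAlgHom ℂ _ _)

/-- The action on the complex of an operator on the ghost Fock space. -/
def ghostHom : Module.End ℂ GhostFock →ₐ[ℂ] Module.End ℂ (BRSTComplex W Wbar) :=
  (Module.End.lTensorAlgHom ℂ _ _).comp (Module.End.lTensorAlgHom ℂ _ _)

variable {W Wbar}

theorem leftHom_mul_rightHom (f : Module.End ℂ W) (g : Module.End ℂ Wbar) :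
    leftHom W Wbar f * rightHom W Wbar g = rightHom W Wbar g * leftHom W Wbar f :=
  (LinearMap.rTensor_comp_lTensor ..).trans (LinearMap.lTensor_comp_rTensor ..).symm

theorem leftHom_mul_ghostHom (f : Module.End ℂ W) (g : Module.End ℂ GhostFock) :
    leftHom W Wbar f * ghostHom W Wbar g = ghostHom W Wbar g * leftHom W Wbar f :=
  (LinearMap.rTensor_comp_lTensor ..).trans (LinearMap.lTensor_comp_rTensor ..).symm

theorem rightHom_mul_ghostHom (f : Module.End ℂ Wbar) (g : Module.End ℂ GhostFock) :
    rightHom W Wbar f * ghostHom W Wbar g = ghostHom W Wbar g * rightHom W Wbar f := by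
  refine (LinearMap.lTensor_mul _ _ _).symm.trans (Eq.trans ?_ (LinearMap.lTensor_mul _ _ _))
  congr 1
  exact (LinearMap.rTensor_comp_lTensor ..).trans (LinearMap.lTensor_comp_rTensor ..).symm

theorem ghost_ncoeff (g : Ghost) (n : ℤ) :
    (ghost W Wbar g)[[n]] = ghostHom W Wbar (ghostMode g n) := by
  rw [ghost, ofModes_ncoeff]
  rfl

variable {c cbar η ηbar : ℂ} (ρ : W2Module c η W) (σ : W2Module cbar ηbar Wbar)

theorem aField_ncoeff (n : ℤ) :
    (aField (Wbar := Wbar) ρ)[[n]] = leftHom W Wbar (ρ.a n) := by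
  rw [aField, fieldLeft, ofModes_ncoeff]
  rfl

theorem abarField_ncoeff (n : ℤ) :
    (abarField (W := W) σ)[[n]] = rightHom W Wbar (σ.a n) := by
  rw [abarField, fieldRight, ofModes_ncoeff]
  rfl

theorem calL_ncoeff (n : ℤ) :
    (calL (Wbar := Wbar) ρ)[[n]] = leftHom W Wbar (ρ.L (n - 1)) := by
  rw [calL, fieldLeft, ofModes_ncoeff]
  rfl

theorem calLbar_ncoeff (n : ℤ) :
    (calLbar (W := W) σ)[[n]] = rightHom W Wbar (σ.L (n - 1)) := by
  rw [calLbar, fieldRight, ofModes_ncoeff]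
  rfl

/-! ### Brackets of modes with fields -/

theorem bracket_ghost_dual (g : Ghost) (m : ℤ) :
    Bracket (-1) ((ghost W Wbar g)[[m]]) (ghost W Wbar g.dual) (zpowField _ m) := fun n => by
  simp only [ghost_ncoeff, ← map_mul, ghostMode_mul g, zpowField_ncoeff, true_and, map_add,
    map_smul]
  congr 1
  split_ifs
  · exact map_one _
  · exact map_zero _

theorem bracket_ghost_of_ne {g h : Ghost} (e : h ≠ g.dual) (m : ℤ) :
    Bracket (-1) ((ghost W Wbar g)[[m]]) (ghost W Wbar h) 0 := fun n => by
  simp only [ghost_ncoeff, ← map_mul, ghostMode_mul g, ncoeff_zero, e, false_and, if_false,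
    map_add, map_smul, map_zero]

theorem superCommute_ghost {g h : Ghost} (e : h ≠ g.dual) :
    SuperCommute (-1) (ghost W Wbar g) (ghost W Wbar h) :=
  SuperCommute.of_bracket (bracket_ghost_of_ne e)

theorem superCommute_ghost_aField (g : Ghost) :
    SuperCommute 1 (ghost W Wbar g) (aField ρ) := fun p q => by
  rw [ghost_ncoeff, aField_ncoeff, leftHom_mul_ghostHom, one_smul]

theorem superCommute_ghost_abarField (g : Ghost) :
    SuperCommute 1 (ghost W Wbar g) (abarField σ) := fun p q => by
  rw [ghost_ncoeff, abarField_ncoeff, rightHom_mul_ghostHom, one_smul]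

theorem superCommute_ghost_calL (g : Ghost) :
    SuperCommute 1 (ghost W Wbar g) (calL ρ) := fun p q => by
  rw [ghost_ncoeff, calL_ncoeff, leftHom_mul_ghostHom, one_smul]

theorem superCommute_ghost_calLbar (g : Ghost) :
    SuperCommute 1 (ghost W Wbar g) (calLbar σ) := fun p q => by
  rw [ghost_ncoeff, calLbar_ncoeff, rightHom_mul_ghostHom, one_smul]

theorem superCommute_aField_abarField :
    SuperCommute 1 (aField ρ) (abarField σ) := fun p q => by
  rw [aField_ncoeff, abarField_ncoeff, leftHom_mul_rightHom, one_smul]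

theorem superCommute_aField_calLbar :
    SuperCommute 1 (aField ρ) (calLbar σ) := fun p q => by
  rw [aField_ncoeff, calLbar_ncoeff, leftHom_mul_rightHom, one_smul]

theorem superCommute_calL_abarField :
    SuperCommute 1 (calL ρ) (abarField σ) := fun p q => by
  rw [calL_ncoeff, abarField_ncoeff, leftHom_mul_rightHom, one_smul]

theorem superCommute_calL_calLbar :
    SuperCommute 1 (calL ρ) (calLbar σ) := fun p q => by
  rw [calL_ncoeff, calLbar_ncoeff, leftHom_mul_rightHom, one_smul]

section Modes

variable {V : Type*} [AddCommGroup V] [Module ℂ V] (φ : Module.End ℂ W →ₐ[ℂ] Module.End ℂ V)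
  {A L : VertexOperator ℂ V}

/-- Stating this for a homomorphism `φ` covers both tensor factors, with `leftHom` and `rightHom` as
the two instances. -/
theorem W2Module.bracket_a_a (hA : ∀ n, A[[n]] = φ (ρ.a n)) (m : ℤ) :
    Bracket 1 (A[[m]]) A ((2 * η * m) • zpowField V (m - 1)) := fun n => by
  rw [hA, hA, ncoeff_smul, zpowField_ncoeff, ← map_mul, ← map_mul, one_smul, ← sub_eq_iff_eq_add',
    ← map_sub, ← Ring.lie_def, ρ.a_a]
  by_cases h : m + n = 0
  · rw [if_pos h, if_pos (by omega), map_smul, map_one]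
  · rw [if_neg h, if_neg (by omega), map_zero, smul_zero]

theorem W2Module.bracket_L_a (hA : ∀ n, A[[n]] = φ (ρ.a n)) (hL : ∀ n, L[[n]] = φ (ρ.L (n - 1)))
    (m : ℤ) : Bracket 1 (L[[m]]) A (shift m (deriv A) + (m : ℂ) • shift (m - 1) A) := fun n => by
  rw [ncoeff_add, ncoeff_smul, shift_ncoeff, shift_ncoeff, deriv_ncoeff, hL, hA, hA, hA,
    ← map_mul, ← map_mul, one_smul, ← sub_eq_iff_eq_add', ← map_sub, ← Ring.lie_def, ρ.L_a,
    show n + (m - 1) = m - 1 + n by ring, show n + m - 1 = m - 1 + n by ring, map_smul, ← add_smul]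
  congr 1
  push_cast
  ring

theorem W2Module.bracket_a_L (hA : ∀ n, A[[n]] = φ (ρ.a n)) (hL : ∀ n, L[[n]] = φ (ρ.L (n - 1)))
    (m : ℤ) : Bracket 1 (A[[m]]) L ((m : ℂ) • shift (m - 1) A) := fun n => by
  rw [ncoeff_smul, shift_ncoeff, hL, hA, hA,
    ← map_mul, ← map_mul, one_smul, ← sub_eq_iff_eq_add', ← map_sub, ← neg_sub,
    ← Ring.lie_def, ρ.L_a, show n + (m - 1) = n - 1 + m by ring, ← neg_smul, neg_neg, map_smul]

/-- The index shift `L₍ₙ₎ = 𝓛ₙ₋₁` turns the cocycle `k³ - k` at `k = m - 1` into `m (m - 1) (m -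
2)`, the coefficient of a third derivative. -/
theorem W2Module.bracket_L_L (hL : ∀ n, L[[n]] = φ (ρ.L (n - 1))) (m : ℤ) :
    Bracket 1 (L[[m]]) L (shift m (deriv L) + (2 * m : ℂ) • shift (m - 1) L
      + (c / 12 * (m * (m - 1) * (m - 2))) • zpowField V (m - 3)) := fun n => by
  rw [ncoeff_add, ncoeff_add, ncoeff_smul, ncoeff_smul, shift_ncoeff, shift_ncoeff, deriv_ncoeff,
    zpowField_ncoeff, hL, hL, hL, hL, ← map_mul, ← map_mul, one_smul, ← sub_eq_iff_eq_add',
    ← map_sub, ← Ring.lie_def, ρ.L_L, show n + (m - 1) - 1 = n - 1 + (m - 1) by ring,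
    show n + m - 1 - 1 = n - 1 + (m - 1) by ring, map_add, map_smul, ← add_smul]
  congr 1
  · congr 1
    push_cast
    ring
  · by_cases h : m - 1 = -(n - 1)
    · rw [if_pos h, if_pos (by omega), map_smul, map_one]
      congr 1
      push_cast
      ring
    · rw [if_neg h, if_neg (by omega), map_zero, smul_zero]

end Modes

/-! ### The vacuum -/

/-- The vector `w ⊗ w̄ ⊗ 𝟏`. -/
def vacTensor (w : W) (wbar : Wbar) : BRSTComplex W Wbar := w ⊗ₜ (wbar ⊗ₜ (1 : GhostFock))

theorem ghost_vacTensor (g : Ghost) {n : ℤ} (hn : 0 ≤ n) (w : W) (wbar : Wbar) :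
    ((ghost W Wbar g)[[n]]) (vacTensor w wbar) = 0 := by
  obtain ⟨j, rfl⟩ := Int.eq_ofNat_of_zero_le hn
  have : ghostMode g j 1 = 0 :=
    CliffordAlgebra.contractLeft_one (Q := (0 : QuadraticForm ℂ (Ghost × ℕ →₀ ℂ))) _
  rw [ghost_ncoeff]
  change w ⊗ₜ[ℂ] (wbar ⊗ₜ[ℂ] (ghostMode g j 1)) = 0
  rw [this, TensorProduct.tmul_zero, TensorProduct.tmul_zero]

/-- The ghost creation operators generate the complex from the vectors `w ⊗ w̄ ⊗ 𝟏`. -/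
theorem creation_induction {P : BRSTComplex W Wbar → Prop} (zero : P 0)
    (add : ∀ x y, P x → P y → P (x + y)) (smul : ∀ (r : ℂ) x, P x → P (r • x))
    (vac : ∀ w wbar, P (vacTensor w wbar))
    (ghost : ∀ (g : Ghost) (j : ℕ) x, P x → P (((ghost W Wbar g)[[-(j : ℤ) - 1]]) x)) :
    ∀ x, P x := by
  have key : ∀ (m : GhostFock) (w : W) (wbar : Wbar), P (w ⊗ₜ (wbar ⊗ₜ m)) := by
    intro m
    induction m using CliffordAlgebra.left_induction with
    | algebraMap r =>
      intro w wbar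
      have := smul r _ (vac w wbar)
      rw [vacTensor, ← TensorProduct.tmul_smul, ← TensorProduct.tmul_smul] at this
      rwa [Algebra.algebraMap_eq_smul_one]
    | add x y hx hy =>
      intro w wbar
      rw [TensorProduct.tmul_add, TensorProduct.tmul_add]
      exact add _ _ (hx w wbar) (hy w wbar)
    | ι_mul x m hx =>
      intro w wbar
      induction m using Finsupp.induction_linear with
      | zero => simpa using zero
      | add f g hf hg =>
        rw [map_add, add_mul, TensorProduct.tmul_add, TensorProduct.tmul_add]
        exact add _ _ hf hg
      | single i r =>
        obtain ⟨g, j⟩ := i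
        have h1 := smul r _ (ghost g j _ (hx w wbar))
        rw [ghost_ncoeff, show (-(j : ℤ) - 1) = Int.negSucc j by rw [Int.negSucc_eq]; ring] at h1
        change P (r • w ⊗ₜ[ℂ] (wbar ⊗ₜ[ℂ] (ExteriorAlgebra.ι ℂ (Finsupp.single (g, j) (1 : ℂ)) * x)))
          at h1
        rw [← TensorProduct.tmul_smul, ← TensorProduct.tmul_smul, ← smul_mul_assoc, ← map_smul,
          Finsupp.smul_single, smul_eq_mul, mul_one] at h1
        exact h1
  intro x
  induction x using TensorProduct.induction_on with
  | zero => exact zero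
  | add x y hx hy => exact add _ _ hx hy
  | tmul w y =>
    induction y using TensorProduct.induction_on with
    | zero => simpa using zero
    | add x y hx hy =>
      rw [TensorProduct.tmul_add]
      exact add _ _ hx hy
    | tmul wbar m => exact key m w wbar

end Complex


/-! ## The BRST operator -/

section Annihilated

variable {V : Type*} [AddCommGroup V] [Module ℂ V]

/-- All modes `A₍ₙ₎` with `n ≥ 0` annihilate `v`. -/
def Annihilates (A : VertexOperator ℂ V) (v : V) : Prop := ∀ n : ℤ, 0 ≤ n → (A[[n]]) v = 0

namespace Annihilates

variable {A B : VertexOperator ℂ V} {v : V}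

theorem deriv (h : Annihilates A v) : Annihilates (deriv A) v := fun n hn => by
  rw [deriv_ncoeff, LinearMap.smul_apply]
  rcases hn.eq_or_lt with rfl | hn
  · simp
  · rw [h _ (by omega), smul_zero]

theorem add (h : Annihilates A v) (k : Annihilates B v) : Annihilates (A + B) v := fun n hn => by
  rw [ncoeff_add, LinearMap.add_apply, h n hn, k n hn, add_zero]

theorem smul (h : Annihilates A v) (r : ℂ) : Annihilates (r • A) v := fun n hn => by
  rw [ncoeff_smul, LinearMap.smul_apply, h n hn, smul_zero]

/-- For `n ≥ 0` the mode acting first has a nonnegative index in every summand: either `p ≥ 0`, or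
`p < 0` and then `n - 1 - p ≥ 0`. -/
theorem normalProd (h : Annihilates A v) (k : Annihilates B v) (s : ℂ) :
    Annihilates (normalProd s A B) v := fun n hn => by
  rw [normalProd_apply]
  refine finsum_eq_zero_of_forall_eq_zero fun p => ?_
  rw [ordTerm]
  split_ifs with hp
  · rw [Module.End.mul_apply, k _ (by omega), map_zero]
  · rw [LinearMap.smul_apply, Module.End.mul_apply, h _ (by omega), map_zero, smul_zero]

end Annihilates

theorem Bracket.comp {s : ℂ} {X : Module.End ℂ V} {A A' A'' : VertexOperator ℂ V}
    (hs : s * s = 1) (h : Bracket s X A A') (k : Bracket (-s) X A' A'') :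
    Bracket 1 (X * X) A A'' := fun n => by
  rw [mul_assoc, h n, mul_add, k n, mul_smul_comm, ← mul_assoc, h n, add_mul, smul_add, smul_mul_assoc,
    smul_smul, hs, mul_assoc]
  module

theorem Bracket.add_op {s : ℂ} {X Y : Module.End ℂ V} {A A' A'' : VertexOperator ℂ V}
    (h : Bracket s X A A') (k : Bracket s Y A A'') : Bracket s (X + Y) A (A' + A'') := fun n => by
  rw [add_mul, mul_add, h n, k n, ncoeff_add]
  module

end Annihilated

section BRST

variable {W Wbar : Type*} [AddCommGroup W] [Module ℂ W] [AddCommGroup Wbar] [Module ℂ Wbar]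
variable {c cbar η ηbar : ℂ} (ρ : W2Module c η W) (σ : W2Module cbar ηbar Wbar)

local notation "gc" => ghost W Wbar Ghost.c
local notation "gb" => ghost W Wbar Ghost.b
local notation "gψ" => ghost W Wbar Ghost.ψ
local notation "gχ" => ghost W Wbar Ghost.χ

/-- The matter Virasoro field `𝓛 + 𝓛̄`. -/
def matterVir : VertexOperator ℂ (BRSTComplex W Wbar) := calL ρ + calLbar σ

/-- The total Virasoro field `𝓛 + 𝓛̄ + L^M`. -/
def totalVir : VertexOperator ℂ (BRSTComplex W Wbar) := matterVir ρ σ + virM W Wbar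

theorem annihilates_ghost (g : Ghost) (w : W) (wbar : Wbar) :
    Annihilates (ghost W Wbar g) (vacTensor w wbar) :=
  fun _ hn => ghost_vacTensor g hn w wbar

theorem superCommute_ghost_aPlus (g : Ghost) : SuperCommute 1 (ghost W Wbar g) (aPlus ρ σ) :=
  (superCommute_ghost_aField ρ g).add_right (superCommute_ghost_abarField σ g)

theorem superCommute_ghost_aMinus (g : Ghost) : SuperCommute 1 (ghost W Wbar g) (aMinus ρ σ) :=
  (superCommute_ghost_aField ρ g).sub_right (superCommute_ghost_abarField σ g)

theorem superCommute_ghost_matterVir (g : Ghost) :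
    SuperCommute 1 (ghost W Wbar g) (matterVir ρ σ) :=
  (superCommute_ghost_calL ρ g).add_right (superCommute_ghost_calLbar σ g)

/-! ### Brackets with the BRST current -/

/-- One application of the Leibniz rule serves all four ghosts: for the modes of a single ghost only
the bracket with its conjugate survives, and it is a power of `z`. -/
theorem bracket_brstCurrent_odd {X : Module.End ℂ (BRSTComplex W Wbar)}
    {c' b' ψ' χ' : VertexOperator ℂ (BRSTComplex W Wbar)}
    (hc : Bracket (-1) X gc c') (hb : Bracket (-1) X gb b') (hψ : Bracket (-1) X gψ ψ')
    (hχ : Bracket (-1) X gχ χ') (hL : Bracket 1 X (matterVir ρ σ) 0)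
    (ha : Bracket 1 X (aPlus ρ σ) 0) :
    Bracket (-1) X (brstCurrent ρ σ)
      (nop c' (matterVir ρ σ)
        + (nop c' (nopOdd (deriv gc) gb) - nopOdd gc (nop (deriv c') gb - nop (deriv gc) b'))
        + (3 / 2 : ℂ) • deriv (deriv c')
        + nop ψ' (aPlus ρ σ)
        + (nop c' (nopOdd (deriv gψ) gχ) - nopOdd gc (nop (deriv ψ') gχ - nop (deriv gψ) χ'))) := by
  have h1 := (hc.nop_odd_even hL).congr (by rw [nopOdd, normalProd_zero_right, sub_zero])
  have h2 := (hψ.nop_odd_even ha).congr (by rw [nopOdd, normalProd_zero_right, sub_zero])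
  exact (((h1.add (hc.nop_odd_even (hc.deriv.nopOdd_odd hb))).add (hc.deriv.deriv.smul _)).add
    h2).add (hc.nop_odd_even (hψ.deriv.nopOdd_odd hχ))

theorem bracket_brstCurrent_even {X : Module.End ℂ (BRSTComplex W Wbar)}
    {L' a' : VertexOperator ℂ (BRSTComplex W Wbar)}
    (hg : ∀ g, Bracket 1 X (ghost W Wbar g) 0) (hL : Bracket 1 X (matterVir ρ σ) L')
    (ha : Bracket 1 X (aPlus ρ σ) a') :
    Bracket 1 X (brstCurrent ρ σ) (nop gc L' + nop gψ a') := by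
  have h := ((((hg .c).normalProd_even hL 1).add ((hg .c).normalProd_even
    ((hg .c).deriv.normalProd_even (hg .b) (-1)) 1)).add
    ((hg .c).deriv.deriv.smul (3 / 2))).add ((hg .ψ).normalProd_even ha 1)
  refine (h.add ((hg .c).normalProd_even ((hg .ψ).deriv.normalProd_even (hg .χ) (-1)) 1)).congr ?_
  simp only [nop, normalProd_zero_left, normalProd_zero_right, deriv_zero, smul_zero,
    add_zero, zero_add]

theorem bracket_brstCurrent_ghost (g : Ghost) (m : ℤ)
    {c' b' ψ' χ' : VertexOperator ℂ (BRSTComplex W Wbar)}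
    (hc : Bracket (-1) ((ghost W Wbar g)[[m]]) gc c')
    (hb : Bracket (-1) ((ghost W Wbar g)[[m]]) gb b')
    (hψ : Bracket (-1) ((ghost W Wbar g)[[m]]) gψ ψ')
    (hχ : Bracket (-1) ((ghost W Wbar g)[[m]]) gχ χ') :
    Bracket (-1) ((ghost W Wbar g)[[m]]) (brstCurrent ρ σ)
      (nop c' (matterVir ρ σ)
        + (nop c' (nopOdd (deriv gc) gb) - nopOdd gc (nop (deriv c') gb - nop (deriv gc) b'))
        + (3 / 2 : ℂ) • deriv (deriv c')
        + nop ψ' (aPlus ρ σ)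
        + (nop c' (nopOdd (deriv gψ) gχ) - nopOdd gc (nop (deriv ψ') gχ - nop (deriv gψ) χ'))) :=
  bracket_brstCurrent_odd ρ σ hc hb hψ hχ ((superCommute_ghost_matterVir ρ σ g).bracket m)
    ((superCommute_ghost_aPlus ρ σ g).bracket m)

/-- The modes of `b` contract with each factor `c` of the current. The term `(3/2) ∂²c` contributes
a total derivative, whose residue is zero. -/
theorem bracket_Q_b : Bracket (-1) (Q ρ σ) gb (totalVir ρ σ) := by
  refine Bracket.swap_odd (fun m => bracket_brstCurrent_ghost ρ σ .b m
    (bracket_ghost_dual .b m) (bracket_ghost_of_ne (by simp [Ghost.dual]) m)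
    (bracket_ghost_of_ne (by simp [Ghost.dual]) m)
    (bracket_ghost_of_ne (by simp [Ghost.dual]) m)) 0 fun m => ?_
  -- Contraction with `∂c` produces a derivative of `:c b:`, which has to be expanded to match `2
  -- :∂c b: + :c ∂b:`.
  have h := congrArg (fun A => A[[m]]) (deriv_normalProd (-1) gc gb)
  simp only [ncoeff_add, deriv_ncoeff _ m] at h
  simp only [totalVir, virM, virBC, nop, nopOdd, deriv_zpowField, normalProd_smul_left,
    normalProd_smul_right, normalProd_zero_left, normalProd_zero_right, deriv_zero,
    normalProd_zpowField_left, normalProd_shift_right, ncoeff_add, ncoeff_sub,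
    ncoeff_smul, shift_ncoeff, zero_add, deriv_ncoeff _ 0, smul_zero, sub_zero,
    add_zero, Int.cast_zero, neg_zero, zero_smul]
  linear_combination (norm := module) h

theorem bracket_Q_c : Bracket (-1) (Q ρ σ) gc (nopOdd gc (deriv gc)) := by
  refine Bracket.swap_odd (fun m => bracket_brstCurrent_ghost ρ σ .c m
    (bracket_ghost_of_ne (by simp [Ghost.dual]) m) (bracket_ghost_dual .c m)
    (bracket_ghost_of_ne (by simp [Ghost.dual]) m)
    (bracket_ghost_of_ne (by simp [Ghost.dual]) m)) 0 fun m => ?_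
  simp only [nop, nopOdd, normalProd_zpowField_right, normalProd_zero_left, normalProd_zero_right,
    deriv_zero, normalProd_shift_right, normalProd_neg_right, shift_ncoeff, zero_add,
    smul_zero, sub_zero, zero_sub, neg_neg, add_zero]

theorem bracket_Q_ψ : Bracket (-1) (Q ρ σ) gψ (nopOdd gc (deriv gψ)) := by
  refine Bracket.swap_odd (fun m => bracket_brstCurrent_ghost ρ σ .ψ m
    (bracket_ghost_of_ne (by simp [Ghost.dual]) m) (bracket_ghost_of_ne (by simp [Ghost.dual]) m)
    (bracket_ghost_of_ne (by simp [Ghost.dual]) m)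
    (bracket_ghost_dual .ψ m)) 0 fun m => ?_
  simp only [nop, nopOdd, normalProd_zpowField_right, normalProd_zero_left, normalProd_zero_right,
    deriv_zero, normalProd_shift_right, normalProd_neg_right, shift_ncoeff, zero_add,
    smul_zero, sub_zero, zero_sub, neg_neg, add_zero]

theorem bracket_Q_χ : Bracket (-1) (Q ρ σ) gχ (aPlus ρ σ + deriv (nopOdd gc gχ)) := by
  refine Bracket.swap_odd (fun m => bracket_brstCurrent_ghost ρ σ .χ m
    (bracket_ghost_of_ne (by simp [Ghost.dual]) m) (bracket_ghost_of_ne (by simp [Ghost.dual]) m)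
    (bracket_ghost_dual .χ m) (bracket_ghost_of_ne (by simp [Ghost.dual]) m)) 0 fun m => ?_
  simp only [nop, nopOdd, normalProd_zpowField_left, normalProd_zero_left, normalProd_zero_right,
    deriv_zero, deriv_zpowField, normalProd_shift_right, normalProd_smul_left,
    normalProd_smul_right, ncoeff_add, ncoeff_smul, deriv_ncoeff, shift_ncoeff,
    ncoeff_neg, zero_add, zero_sub, smul_zero, sub_zero, add_zero]
  module

/-! ### Matter -/

theorem bracket_aField_aPlus (m : ℤ) :
    Bracket 1 ((aField ρ)[[m]]) (aPlus ρ σ) ((2 * η * m) • zpowField _ (m - 1)) :=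
  ((ρ.bracket_a_a _ (aField_ncoeff ρ) m).add
    ((superCommute_aField_abarField ρ σ).bracket m)).congr (add_zero _)

theorem bracket_aField_aMinus (m : ℤ) :
    Bracket 1 ((aField ρ)[[m]]) (aMinus ρ σ) ((2 * η * m) • zpowField _ (m - 1)) :=
  ((ρ.bracket_a_a _ (aField_ncoeff ρ) m).sub
    ((superCommute_aField_abarField ρ σ).bracket m)).congr (sub_zero _)

theorem bracket_abarField_aPlus (m : ℤ) :
    Bracket 1 ((abarField σ)[[m]]) (aPlus ρ σ) ((2 * ηbar * m) • zpowField _ (m - 1)) :=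
  ((((superCommute_aField_abarField ρ σ).symm (by norm_num)).bracket m).add
    (σ.bracket_a_a _ (abarField_ncoeff σ) m)).congr (zero_add _)

theorem bracket_abarField_aMinus (m : ℤ) :
    Bracket 1 ((abarField σ)[[m]]) (aMinus ρ σ) (-((2 * ηbar * m) • zpowField _ (m - 1))) :=
  ((((superCommute_aField_abarField ρ σ).symm (by norm_num)).bracket m).sub
    (σ.bracket_a_a _ (abarField_ncoeff σ) m)).congr (zero_sub _)

theorem bracket_aField_matterVir (m : ℤ) :
    Bracket 1 ((aField ρ)[[m]]) (matterVir ρ σ) ((m : ℂ) • shift (m - 1) (aField ρ)) :=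
  ((ρ.bracket_a_L _ (aField_ncoeff ρ) (calL_ncoeff ρ) m).add
    ((superCommute_aField_calLbar ρ σ).bracket m)).congr (add_zero _)

theorem bracket_abarField_matterVir (m : ℤ) :
    Bracket 1 ((abarField σ)[[m]]) (matterVir ρ σ) ((m : ℂ) • shift (m - 1) (abarField σ)) :=
  ((((superCommute_calL_abarField ρ σ).symm (by norm_num)).bracket m).add
    (σ.bracket_a_L _ (abarField_ncoeff σ) (calLbar_ncoeff σ) m)).congr (zero_add _)

/-- The term `c 𝓛` of the current makes `a` transform as a primary field of weight one, giving `∂(c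
a)`; the Heisenberg contraction with `ψ a⁺` gives the multiple of `∂ψ`. -/
theorem bracket_Q_aField :
    Bracket 1 (Q ρ σ) (aField ρ) (deriv (nop gc (aField ρ)) + (2 * η) • deriv gψ) := by
  refine Bracket.swap_even (fun m => bracket_brstCurrent_even ρ σ
    (fun g => ((superCommute_ghost_aField ρ g).symm (by norm_num)).bracket m)
    (bracket_aField_matterVir ρ σ m) (bracket_aField_aPlus ρ σ m)) 0 fun m => ?_
  simp only [nop, normalProd_smul_right, normalProd_shift_right, normalProd_zpowField_right,
    ncoeff_add, ncoeff_smul, deriv_ncoeff, shift_ncoeff, zero_add]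
  module

theorem bracket_Q_abarField :
    Bracket 1 (Q ρ σ) (abarField σ) (deriv (nop gc (abarField σ)) + (2 * ηbar) • deriv gψ) := by
  refine Bracket.swap_even (fun m => bracket_brstCurrent_even ρ σ
    (fun g => ((superCommute_ghost_abarField σ g).symm (by norm_num)).bracket m)
    (bracket_abarField_matterVir ρ σ m) (bracket_abarField_aPlus ρ σ m)) 0 fun m => ?_
  simp only [nop, normalProd_smul_right, normalProd_shift_right, normalProd_zpowField_right,
    ncoeff_add, ncoeff_smul, deriv_ncoeff, shift_ncoeff, zero_add]
  module

/-- The two contributions in `∂ψ` have coefficients `2η` and `2η̄`. They cancel in the sum `a⁺` and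
reinforce one another to `4η` in the difference `a⁻`. -/
theorem bracket_Q_aPlus (hη : η + ηbar = 0) :
    Bracket 1 (Q ρ σ) (aPlus ρ σ) (deriv (nop gc (aPlus ρ σ))) := by
  obtain rfl : ηbar = -η := by linear_combination hη
  refine ((bracket_Q_aField ρ σ).add (bracket_Q_abarField ρ σ)).congr ?_
  rw [aPlus, nop, nop, nop, normalProd_add_right, deriv_add]
  module

theorem bracket_Q_aMinus (hη : η + ηbar = 0) :
    Bracket 1 (Q ρ σ) (aMinus ρ σ) (deriv (nop gc (aMinus ρ σ)) + (4 * η) • deriv gψ) := by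
  obtain rfl : ηbar = -η := by linear_combination hη
  refine ((bracket_Q_aField ρ σ).sub (bracket_Q_abarField ρ σ)).congr ?_
  rw [aMinus, nop, nop, nop, normalProd_sub_right, deriv_sub]
  module

theorem bracket_matterVir_aPlus (m : ℤ) :
    Bracket 1 ((matterVir ρ σ)[[m]]) (aPlus ρ σ)
      (shift m (deriv (aPlus ρ σ)) + (m : ℂ) • shift (m - 1) (aPlus ρ σ)) := by
  rw [matterVir, ncoeff_add]
  refine (((ρ.bracket_L_a _ (aField_ncoeff ρ) (calL_ncoeff ρ) m).add
    ((superCommute_calL_abarField ρ σ).bracket m)).add_op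
    ((((superCommute_aField_calLbar ρ σ).symm (by norm_num)).bracket m).add
      (σ.bracket_L_a _ (abarField_ncoeff σ) (calLbar_ncoeff σ) m))).congr (field_ext fun n => ?_)
  simp only [ncoeff_add, ncoeff_smul, shift_ncoeff, deriv_ncoeff, ncoeff_zero, aPlus]
  module

theorem bracket_matterVir_matterVir (m : ℤ) :
    Bracket 1 ((matterVir ρ σ)[[m]]) (matterVir ρ σ)
      (shift m (deriv (matterVir ρ σ)) + (2 * m : ℂ) • shift (m - 1) (matterVir ρ σ)
        + ((c + cbar) / 12 * (m * (m - 1) * (m - 2))) • zpowField _ (m - 3)) := by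
  rw [matterVir, ncoeff_add]
  refine (((ρ.bracket_L_L _ (calL_ncoeff ρ) m).add
    ((superCommute_calL_calLbar ρ σ).bracket m)).add_op
    ((((superCommute_calL_calLbar ρ σ).symm (by norm_num)).bracket m).add
      (σ.bracket_L_L _ (calLbar_ncoeff σ) m))).congr (field_ext fun n => ?_)
  simp only [ncoeff_add, ncoeff_smul, shift_ncoeff, deriv_ncoeff, ncoeff_zero]
  module

/-- The `∂³c` term is the matter anomaly, to be cancelled later by the double contractions of the
ghosts; the `∂ψ a⁺` term is cancelled by the variation of `χ` in `:∂ψ χ:`. -/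
theorem bracket_Q_matterVir :
    Bracket 1 (Q ρ σ) (matterVir ρ σ)
      (nop gc (deriv (matterVir ρ σ)) + (2 : ℂ) • nop (deriv gc) (matterVir ρ σ)
        + ((c + cbar) / 12) • deriv (deriv (deriv gc)) + nop (deriv gψ) (aPlus ρ σ)) := by
  refine Bracket.swap_even (fun m => bracket_brstCurrent_even ρ σ (fun g =>
    ((superCommute_ghost_matterVir ρ σ g).symm (by norm_num)).bracket m)
    (bracket_matterVir_matterVir ρ σ m) (bracket_matterVir_aPlus ρ σ m)) 0 fun m => ?_
  have h1 := congrArg (fun A => A[[m]]) (deriv_normalProd 1 gc (matterVir ρ σ))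
  have h2 := congrArg (fun A => A[[m]]) (deriv_normalProd 1 gψ (aPlus ρ σ))
  simp only [ncoeff_add, deriv_ncoeff _ m] at h1 h2
  simp only [nop, normalProd_add_right, normalProd_smul_right, normalProd_shift_right,
    normalProd_zpowField_right, ncoeff_add, ncoeff_smul, deriv_ncoeff gc, deriv_ncoeff (deriv gc),
    deriv_ncoeff (deriv (deriv gc)), shift_ncoeff, zero_add]
  rw [eq_sub_of_add_eq h1.symm, eq_sub_of_add_eq h2.symm, show m - 1 - 1 - 1 = m - 3 by ring]
  push_cast
  module

end BRST


/-! ## Nilpotency of the BRST operator -/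

section Contractions

variable {V : Type*} [AddCommGroup V] [Module ℂ V]

/-- Odd fields with `{A₍ₚ₎, C₍ᵣ₎} = α p δ_{p+r,d}`. -/
def Contraction (A C : VertexOperator ℂ V) (d : ℤ) (α : ℤ → ℂ) : Prop :=
  ∀ p r, A[[p]] * C[[r]] = (-1 : ℂ) • (C[[r]] * A[[p]]) +
    if p + r = d then α p • (1 : Module.End ℂ V) else 0

namespace Contraction

variable {A B C : VertexOperator ℂ V} {α α' β : ℤ → ℂ} {d d' : ℤ}

theorem congr (h : Contraction A C d α) (hd : d = d') (hα : ∀ p, α p = α' p) :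
    Contraction A C d' α' := by
  rw [← hd, ← funext hα]
  exact h

theorem deriv_left (h : Contraction A C d α) :
    Contraction (deriv A) C (d + 1) (fun p => -p * α (p - 1)) := fun p r => by
  rw [deriv_ncoeff, smul_mul_assoc, mul_smul_comm, h]
  by_cases e : p + r = d + 1
  · rw [if_pos e, if_pos (by omega)]
    module
  · rw [if_neg e, if_neg (by omega)]
    module

theorem deriv_right (h : Contraction A C d α) :
    Contraction A (deriv C) (d + 1) (fun p => -(d + 1 - p) * α p) := fun p r => by
  rw [deriv_ncoeff, smul_mul_assoc, mul_smul_comm, h]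
  by_cases e : p + r = d + 1
  · obtain rfl : r = d + 1 - p := by omega
    rw [if_pos e, if_pos (by omega)]
    push_cast
    module
  · rw [if_neg e, if_neg (by omega)]
    module

theorem of_superCommute (h : SuperCommute (-1) A C) (d : ℤ) : Contraction A C d 0 := fun p r => by
  rw [h]
  simp

end Contraction

theorem normalProd_assoc_odd {A B C : VertexOperator ℂ V}
    (hAB : SuperCommute (-1) A B) (hAC : SuperCommute (-1) A C) (hBC : SuperCommute (-1) B C) :
    normalProd 1 (normalProd (-1) A B) C = normalProd 1 A (normalProd (-1) B C) := by
  have := normalProd_assoc hAB hAC hBC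
  rwa [show (-1 : ℂ) * -1 = 1 by norm_num] at this

theorem normalProd_self_normalProd {A B : VertexOperator ℂ V}
    (hA : SuperCommute (-1) A A) (hAB : SuperCommute (-1) A B) :
    normalProd 1 A (normalProd (-1) A B) = 0 := by
  rw [← normalProd_assoc_odd hA hAB hAB, hA.normalProd_self, normalProd_zero_left]

theorem eq_zero_of_eq_neg {A : VertexOperator ℂ V} (h : A = -A) : A = 0 := by
  have h2 : (2 : ℂ) • A = 0 := by
    rw [two_smul]
    nth_rewrite 1 [h]
    exact neg_add_cancel A
  exact (smul_eq_zero.1 h2).resolve_left two_ne_zero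

/-- Left commutativity of normally ordered products of anticommuting fields. -/
theorem normalProd_left_comm {A B C : VertexOperator ℂ V} {α β σ τ : ℤ → ℂ} {d e : ℤ}
    (hAB : SuperCommute (-1) A B) (hAC : Contraction A C d α) (hBC : Contraction B C e β)
    (hτ0 : τ 0 = 0) (hτ : ∀ k, τ (k + 1) = τ k + α k)
    (hσ0 : σ 0 = 0) (hσ : ∀ k, σ (k + 1) = σ k + β k) :
    normalProd 1 A (normalProd (-1) B C) = -normalProd 1 B (normalProd (-1) A C) := by
  refine field_ext fun n => ?_
  -- Rebracketing `(AB)C` and `(BA)C` produces the same two corrections with opposite signs. Since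
  -- `:AB: = -:BA:`, they cancel and no anomaly remains.
  have h1 := normalProd_quasiAssoc hAB hAC hBC hτ0 hτ hσ0 hσ n
  have h2 := normalProd_quasiAssoc (hAB.symm (by norm_num)) hBC hAC hσ0 hσ hτ0 hτ n
  rw [hAB.normalProd_comm (by norm_num), normalProd_smul_left, ncoeff_smul, h2] at h1
  rw [ncoeff_neg]
  linear_combination (norm := module) -h1

end Contractions

section BRST

variable {W Wbar : Type*} [AddCommGroup W] [Module ℂ W] [AddCommGroup Wbar] [Module ℂ Wbar]
variable {c cbar η ηbar : ℂ} (ρ : W2Module c η W) (σ : W2Module cbar ηbar Wbar)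

local notation "gc" => ghost W Wbar Ghost.c
local notation "gb" => ghost W Wbar Ghost.b
local notation "gψ" => ghost W Wbar Ghost.ψ
local notation "gχ" => ghost W Wbar Ghost.χ

theorem contraction_ghost_dual (g : Ghost) :
    Contraction (ghost W Wbar g) (ghost W Wbar g.dual) (-1) (fun _ => 1) := fun p r => by
  rw [bracket_ghost_dual g p r, zpowField_ncoeff]
  congr 1
  by_cases h : p + r = -1
  · rw [if_pos h, if_pos (by omega), one_smul]
  · rw [if_neg h, if_neg (by omega)]

theorem superCommute_c_c : SuperCommute (-1) gc gc := superCommute_ghost (by simp [Ghost.dual])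

theorem superCommute_c_ψ : SuperCommute (-1) gc gψ := superCommute_ghost (by simp [Ghost.dual])

theorem superCommute_c_χ : SuperCommute (-1) gc gχ := superCommute_ghost (by simp [Ghost.dual])

theorem contraction_c_b : Contraction gc gb (-1) (fun _ => 1) := contraction_ghost_dual .c

theorem contraction_ψ_χ : Contraction gψ gχ (-1) (fun _ => 1) := contraction_ghost_dual .ψ

/-- The functions `α`, `β` describe the contractions with the last factor, and `τ`, `σ` are their
discrete antiderivatives vanishing at `0`. Contracting `c` with `b` contributes `-∂³c`, contracting
`∂²c` with `b` contributes `(1/3) ∂³c`. The other rebracketings below follow the same pattern. -/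
theorem reassoc_c_ddc_b : normalProd 1 (normalProd (-1) gc (deriv (deriv gc))) gb =
    normalProd 1 gc (normalProd (-1) (deriv (deriv gc)) gb)
      - (2 / 3 : ℂ) • deriv (deriv (deriv gc)) := by
  refine field_ext fun n => ?_
  have := normalProd_quasiAssoc (τ := fun k => k) (σ := fun k => k * (k - 1) * (k - 2) / 3)
    (β := fun k => k * (k - 1)) (superCommute_c_c (W := W) (Wbar := Wbar)).deriv_right.deriv_right contraction_c_b
    (contraction_c_b.deriv_left.deriv_left.congr (d' := 1) rfl fun p => by push_cast; ring)
    (by simp) (by intro k; push_cast; ring) (by simp) (by intro k; push_cast; ring) n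
  rw [this]
  simp only [ncoeff_sub, ncoeff_smul, deriv_ncoeff]
  rw [show n - 2 - 1 = n - 3 by ring, show n - 2 - -1 - 1 - 1 = n - 2 - 1 by ring,
    show n - 1 - 1 - 1 = n - 3 by ring, show n - 2 - 1 = n - 3 by ring]
  push_cast
  module

theorem reassoc_c_dc_db : normalProd 1 (normalProd (-1) gc (deriv gc)) (deriv gb) =
    normalProd 1 gc (normalProd (-1) (deriv gc) (deriv gb))
      - (5 / 6 : ℂ) • deriv (deriv (deriv gc)) := by
  refine field_ext fun n => ?_
  have := normalProd_quasiAssoc (τ := fun k => k * (k - 1) / 2) (α := fun k => k)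
    (σ := fun k => -(k * (k - 1) * (k - 2)) / 3) (β := fun k => -(k * (k - 1)))
    (superCommute_c_c (W := W) (Wbar := Wbar)).deriv_right
    (contraction_c_b.deriv_right.congr (d' := 0) rfl fun p => by push_cast; ring)
    (contraction_c_b.deriv_left.deriv_right.congr (d' := 1) rfl fun p => by push_cast; ring)
    (by simp) (by intro k; push_cast; ring) (by simp) (by intro k; push_cast; ring) n
  rw [this]
  simp only [ncoeff_sub, ncoeff_smul, deriv_ncoeff]
  rw [show n - 2 - 1 = n - 3 by ring, show n - 2 - 0 - 1 = n - 3 by ring,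
    show n - 1 - 1 - 1 = n - 3 by ring]
  push_cast
  module

theorem left_comm_dc_c_db : normalProd 1 (deriv gc) (normalProd (-1) gc (deriv gb)) =
    -normalProd 1 gc (normalProd (-1) (deriv gc) (deriv gb)) :=
  normalProd_left_comm (σ := fun k => k * (k - 1) / 2) (β := fun k => k)
    (τ := fun k => -(k * (k - 1) * (k - 2)) / 3) (α := fun k => -(k * (k - 1)))
    (superCommute_c_c (W := W) (Wbar := Wbar)).deriv_left
    (contraction_c_b.deriv_left.deriv_right.congr (d' := 1) rfl fun p => by push_cast; ring)
    (contraction_c_b.deriv_right.congr (d' := 0) rfl fun p => by push_cast; ring)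
    (by simp) (by intro k; push_cast; ring) (by simp) (by intro k; push_cast; ring)

/-- Exchanging the two equal odd factors changes the sign without correction, so the product equals
its own negative. -/
theorem normalProd_dc_dc_b : normalProd 1 (deriv gc) (normalProd (-1) (deriv gc) gb) = 0 := by
  have h := normalProd_left_comm (σ := fun k => -(k * (k - 1)) / 2) (β := fun k => -k)
    (τ := fun k => -(k * (k - 1)) / 2) (α := fun k => -k)
    (superCommute_c_c (W := W) (Wbar := Wbar)).deriv_left.deriv_right
    (contraction_c_b.deriv_left.congr (d' := 0) rfl fun p => by ring)
    (contraction_c_b.deriv_left.congr (d' := 0) rfl fun p => by ring)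
    (by simp) (by intro k; push_cast; ring) (by simp) (by intro k; push_cast; ring)
  exact eq_zero_of_eq_neg h

theorem normalProd_c_c_ddb : normalProd 1 gc (normalProd (-1) gc (deriv (deriv gb))) = 0 := by
  have h := normalProd_left_comm (σ := fun k => k * (k - 1) * (k - 2) / 3)
    (β := fun k => k * (k - 1)) (τ := fun k => k * (k - 1) * (k - 2) / 3)
    (α := fun k => k * (k - 1)) (superCommute_c_c (W := W) (Wbar := Wbar))
    (contraction_c_b.deriv_right.deriv_right.congr (d' := 1) rfl fun p => by push_cast; ring)
    (contraction_c_b.deriv_right.deriv_right.congr (d' := 1) rfl fun p => by push_cast; ring)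
    (by simp) (by intro k; push_cast; ring) (by simp) (by intro k; push_cast; ring)
  exact eq_zero_of_eq_neg h

theorem reassoc_dc_dψ_χ : normalProd 1 (normalProd (-1) (deriv gc) (deriv gψ)) gχ =
    normalProd 1 (deriv gc) (normalProd (-1) (deriv gψ) gχ)
      - (1 / 2 : ℂ) • deriv (deriv (deriv gc)) := by
  refine field_ext fun n => ?_
  have := normalProd_quasiAssoc (τ := 0) (σ := fun k => -(k * (k - 1)) / 2)
    (β := fun k => -k) (superCommute_c_ψ (W := W) (Wbar := Wbar)).deriv_left.deriv_right
    (Contraction.of_superCommute (superCommute_c_χ (W := W) (Wbar := Wbar)).deriv_left 0)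
    (contraction_ψ_χ.deriv_left.congr (d' := 0) rfl fun p => by ring)
    (by simp) (by simp) (by simp) (by intro k; push_cast; ring) n
  rw [this]
  simp only [ncoeff_sub, ncoeff_smul, deriv_ncoeff, Pi.zero_apply]
  rw [show n - 2 - 0 - 1 = n - 3 by ring, show n - 1 - 1 - 1 = n - 3 by ring]
  push_cast
  module

theorem reassoc_c_ddψ_χ : normalProd 1 (normalProd (-1) gc (deriv (deriv gψ))) gχ =
    normalProd 1 gc (normalProd (-1) (deriv (deriv gψ)) gχ)
      + (1 / 3 : ℂ) • deriv (deriv (deriv gc)) := by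
  refine field_ext fun n => ?_
  have := normalProd_quasiAssoc (τ := 0) (σ := fun k => k * (k - 1) * (k - 2) / 3)
    (β := fun k => k * (k - 1)) (superCommute_c_ψ (W := W) (Wbar := Wbar)).deriv_right.deriv_right
    (Contraction.of_superCommute (superCommute_c_χ (W := W) (Wbar := Wbar)) 0)
    (contraction_ψ_χ.deriv_left.deriv_left.congr (d' := 1) rfl fun p => by push_cast; ring)
    (by simp) (by simp) (by simp) (by intro k; push_cast; ring) n
  rw [this]
  simp only [ncoeff_add, ncoeff_smul, deriv_ncoeff, Pi.zero_apply]
  rw [show n - 2 - 1 = n - 3 by ring, show n - 1 - 1 - 1 = n - 3 by ring]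
  push_cast
  module

theorem left_comm_dψ_dc_χ : normalProd 1 (deriv gψ) (normalProd (-1) (deriv gc) gχ) =
    -normalProd 1 (deriv gc) (normalProd (-1) (deriv gψ) gχ) :=
  normalProd_left_comm (σ := 0) (τ := fun k => -(k * (k - 1)) / 2) (α := fun k => -k)
    ((superCommute_c_ψ (W := W) (Wbar := Wbar)).deriv_left.deriv_right.symm (by norm_num))
    (contraction_ψ_χ.deriv_left.congr (d' := 0) rfl fun p => by ring)
    (Contraction.of_superCommute (superCommute_c_χ (W := W) (Wbar := Wbar)).deriv_left 0)
    (by simp) (by intro k; push_cast; ring) (by simp) (by simp)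

theorem left_comm_dψ_c_dχ : normalProd 1 (deriv gψ) (normalProd (-1) gc (deriv gχ)) =
    -normalProd 1 gc (normalProd (-1) (deriv gψ) (deriv gχ)) :=
  normalProd_left_comm (σ := 0) (τ := fun k => -(k * (k - 1) * (k - 2)) / 3)
    (α := fun k => -(k * (k - 1)))
    ((superCommute_c_ψ (W := W) (Wbar := Wbar)).deriv_right.symm (by norm_num))
    (contraction_ψ_χ.deriv_left.deriv_right.congr (d' := 1) rfl fun p => by push_cast; ring)
    (Contraction.of_superCommute (superCommute_c_χ (W := W) (Wbar := Wbar)).deriv_right 0)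
    (by simp) (by intro k; push_cast; ring) (by simp) (by simp)

/-! ### The square of `Q` commutes with the ghosts -/

theorem bracket_Q_sq_c : Bracket 1 (Q ρ σ * Q ρ σ) gc 0 := by
  have h := bracket_Q_c ρ σ
  have k := h.nopOdd_odd h.deriv
  refine Bracket.comp (by norm_num) h ?_
  rw [neg_neg]
  refine k.congr ?_
  have cc := superCommute_c_c (W := W) (Wbar := Wbar)
  have e1 := cc.deriv_left.deriv_right
  simp only [nop, nopOdd, deriv_normalProd]
  rw [normalProd_assoc_odd cc.deriv_right cc.deriv_right e1, e1.normalProd_self, zero_add,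
    normalProd_self_normalProd cc cc.deriv_right.deriv_right, normalProd_zero_right, sub_zero]

theorem bracket_Q_sq_ψ : Bracket 1 (Q ρ σ * Q ρ σ) gψ 0 := by
  have h := bracket_Q_c ρ σ
  have h' := bracket_Q_ψ ρ σ
  have k := h.nopOdd_odd h'.deriv
  refine Bracket.comp (by norm_num) h' ?_
  rw [neg_neg]
  refine k.congr ?_
  have cc := superCommute_c_c (W := W) (Wbar := Wbar)
  have cψ := superCommute_c_ψ (W := W) (Wbar := Wbar)
  simp only [nop, nopOdd, deriv_normalProd]
  rw [normalProd_assoc_odd cc.deriv_right cψ.deriv_right cψ.deriv_left.deriv_right,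
    normalProd_add_right, normalProd_self_normalProd cc cψ.deriv_right.deriv_right, add_zero,
    sub_self]

/-- The variation `∂(c a⁺)` of `a⁺` is cancelled by the variation of `χ` inside `∂(c χ)`, and the
cubic ghost terms cancel because `c` is odd. -/
theorem bracket_Q_sq_χ (hη : η + ηbar = 0) : Bracket 1 (Q ρ σ * Q ρ σ) gχ 0 := by
  have h := bracket_Q_c ρ σ
  have h' := bracket_Q_χ ρ σ
  have k := (bracket_Q_aPlus ρ σ hη).add (h.nopOdd_odd h').deriv
  refine Bracket.comp (by norm_num) h' ?_
  rw [neg_neg]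
  refine k.congr ?_
  have cc := superCommute_c_c (W := W) (Wbar := Wbar)
  have cχ := superCommute_c_χ (W := W) (Wbar := Wbar)
  rw [← deriv_add]
  simp only [nop, nopOdd, deriv_normalProd (-1)]
  rw [normalProd_assoc_odd cc.deriv_right cχ cχ.deriv_left, normalProd_add_right,
    normalProd_add_right, normalProd_self_normalProd cc cχ.deriv_right, add_zero,
    ← deriv_zero]
  congr 1
  abel

/-- All quadratic and cubic terms cancel, leaving `∂³c`. Matter contributes `28/12`; the `(b, c)`
ghosts contribute `2 * (-2/3) - 5/6 = -26/12`; the `(ψ, χ)` ghosts contribute `-1/2 + 1/3 = -2/12`.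
-/
theorem bracket_Q_totalVir (hc : c + cbar = 28) : Bracket 1 (Q ρ σ) (totalVir ρ σ) 0 := by
  have hC := bracket_Q_c ρ σ
  have hB := bracket_Q_b ρ σ
  have hψ := bracket_Q_ψ ρ σ
  have hχ := bracket_Q_χ ρ σ
  refine ((bracket_Q_matterVir ρ σ).add ((((hC.deriv.nopOdd_odd hB).smul 2).add
    (hC.nopOdd_odd hB.deriv)).add (hψ.deriv.nopOdd_odd hχ))).congr ?_
  have cc := superCommute_c_c (W := W) (Wbar := Wbar)
  simp only [totalVir, virM, virBC, nop, nopOdd, deriv_add, deriv_smul, deriv_normalProd,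
    normalProd_add_left, normalProd_add_right, normalProd_smul_right,
    cc.deriv_left.deriv_right.normalProd_self, zero_add, reassoc_c_ddc_b,
    reassoc_c_dc_db, left_comm_dc_c_db, normalProd_dc_dc_b, normalProd_c_c_ddb, reassoc_dc_dψ_χ,
    reassoc_c_ddψ_χ, left_comm_dψ_dc_χ, left_comm_dψ_c_dχ, hc]
  module

theorem bracket_Q_sq_b (hc : c + cbar = 28) : Bracket 1 (Q ρ σ * Q ρ σ) gb 0 :=
  Bracket.comp (by norm_num) (bracket_Q_b ρ σ) (by
    rw [neg_neg]; exact bracket_Q_totalVir ρ σ hc)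

/-! ### Ghost number -/

variable (W Wbar) in
/-- The ghost number operator. -/
def ghostNumber : Module.End ℂ (BRSTComplex W Wbar) := zeroMode₁ (ghostCurrent W Wbar)

/-- The ghost numbers of the ghost fields. -/
def Ghost.number : Ghost → ℂ
  | .b => -1
  | .c => 1
  | .ψ => 1
  | .χ => -1

theorem hasWeight_of_bracket {V : Type*} [AddCommGroup V] [Module ℂ V]
    {A F : VertexOperator ℂ V} {κ α : ℂ} {F' : ℤ → VertexOperator ℂ V} {n : ℤ}
    (h : ∀ m, Bracket 1 (A[[m]]) F (F' m))
    (h' : ∀ m, (F' m)[[n]] = (-(α - κ * m)) • A[[m]]) : HasWeight (F[[n]]) κ α A := fun m => by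
  rw [h m n, h' m]
  module

theorem hasWeight_ghostNumber_ghost (g : Ghost) :
    HasWeight (ghostNumber W Wbar) 0 g.number (ghost W Wbar g) := by
  cases g
  · refine hasWeight_of_bracket (fun m => ((bracket_ghost_dual .b m).nopOdd_odd
      (bracket_ghost_of_ne (by simp [Ghost.dual]) m)).add
      ((bracket_ghost_of_ne (by simp [Ghost.dual]) m).nopOdd_odd
        (bracket_ghost_of_ne (by simp [Ghost.dual]) m))) fun m => ?_
    simp only [nop, normalProd_zpowField_left, normalProd_zero_left,
      normalProd_zero_right, ncoeff_add, ncoeff_sub, ncoeff_zero, shift_ncoeff, zero_add,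
      Ghost.number]
    module
  · refine hasWeight_of_bracket (fun m => ((bracket_ghost_of_ne (by simp [Ghost.dual]) m).nopOdd_odd
      (bracket_ghost_dual .c m)).add
      ((bracket_ghost_of_ne (by simp [Ghost.dual]) m).nopOdd_odd
        (bracket_ghost_of_ne (by simp [Ghost.dual]) m))) fun m => ?_
    simp only [nop, normalProd_zpowField_right, normalProd_zero_left,
      normalProd_zero_right, ncoeff_add, ncoeff_sub, ncoeff_zero, shift_ncoeff, zero_add,
      Ghost.number]
    module
  · refine hasWeight_of_bracket (fun m => ((bracket_ghost_of_ne (by simp [Ghost.dual]) m).nopOdd_odd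
      (bracket_ghost_of_ne (by simp [Ghost.dual]) m)).add
      ((bracket_ghost_of_ne (by simp [Ghost.dual]) m).nopOdd_odd
        (bracket_ghost_dual .ψ m))) fun m => ?_
    simp only [nop, normalProd_zpowField_right, normalProd_zero_left,
      normalProd_zero_right, ncoeff_add, ncoeff_sub, ncoeff_zero, shift_ncoeff, zero_add,
      Ghost.number]
    module
  · refine hasWeight_of_bracket (fun m => ((bracket_ghost_of_ne (by simp [Ghost.dual]) m).nopOdd_odd
      (bracket_ghost_of_ne (by simp [Ghost.dual]) m)).add
      ((bracket_ghost_dual .χ m).nopOdd_odd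
        (bracket_ghost_of_ne (by simp [Ghost.dual]) m))) fun m => ?_
    simp only [nop, normalProd_zpowField_left, normalProd_zero_left,
      normalProd_zero_right, ncoeff_add, ncoeff_sub, ncoeff_zero, shift_ncoeff, zero_add,
      Ghost.number]
    module

end BRST


section LocExp

variable {V : Type*} [AddCommGroup V] [Module ℂ V]

/-! ### Exponentials of locally nilpotent operators -/

theorem LocallyNilpotent.neg {R : Module.End ℂ V} (h : LocallyNilpotent R) :
    LocallyNilpotent (-R) := fun v => by
  obtain ⟨n, hn⟩ := h v
  refine ⟨n, ?_⟩
  rw [neg_pow, Module.End.mul_apply, hn, map_zero]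

theorem pow_apply_eq_zero_of_le {R : Module.End ℂ V} {v : V} {n m : ℕ} (h : (R ^ n) v = 0)
    (hnm : n ≤ m) : (R ^ m) v = 0 := by
  obtain ⟨k, rfl⟩ := Nat.exists_eq_add_of_le' hnm
  rw [pow_add, Module.End.mul_apply, h, map_zero]

theorem locExp_apply {R : Module.End ℂ V} (h : LocallyNilpotent R) {v : V} {n : ℕ}
    (hn : (R ^ n) v = 0) :
    locExp R v = ∑ j ∈ Finset.range n, ((j.factorial : ℂ)⁻¹) • (R ^ j) v := by
  rw [locExp, dif_pos h, locSum_apply]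
  refine finsum_eq_sum_of_support_subset _ fun j hj => ?_
  by_contra h'
  refine hj ?_
  change ((j.factorial : ℂ)⁻¹ • R ^ j) v = 0
  rw [LinearMap.smul_apply, pow_apply_eq_zero_of_le hn (by simpa using h'), smul_zero]

/-- On a vector killed by `R^n` both exponentials act as truncated exponential polynomials in `R`,
so the identity is inherited from formal power series modulo `X^n`. -/
theorem locExp_mul_locExp_neg {R : Module.End ℂ V} (h : LocallyNilpotent R) :
    locExp R * locExp (-R) = 1 := by
  refine LinearMap.ext fun v => ?_
  obtain ⟨n, hn⟩ := h v
  have hn' : ((-R) ^ n) v = 0 := by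
    rw [neg_pow, Module.End.mul_apply, hn, map_zero]
  set p := PowerSeries.trunc n (PowerSeries.exp ℂ) with hp
  set q := PowerSeries.trunc n (PowerSeries.evalNegHom (PowerSeries.exp ℂ)) with hq
  have e1 : ∀ w, (R ^ n) w = 0 → locExp R w = Polynomial.aeval R p w := fun w hw => by
    rw [locExp_apply h hw, hp, Polynomial.aeval_def, PowerSeries.eval₂_trunc_eq_sum_range,
      LinearMap.sum_apply]
    refine Finset.sum_congr rfl fun j _ => ?_
    rw [PowerSeries.coeff_exp, ← Algebra.smul_def]
    simp
  have e2 : locExp (-R) v = Polynomial.aeval R q v := by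
    rw [locExp_apply h.neg hn', hq, Polynomial.aeval_def, PowerSeries.eval₂_trunc_eq_sum_range,
      LinearMap.sum_apply]
    refine Finset.sum_congr rfl fun j _ => ?_
    rw [PowerSeries.evalNegHom, PowerSeries.coeff_rescale,
      PowerSeries.coeff_exp, ← Algebra.smul_def, ← neg_one_smul ℂ R, smul_pow,
      LinearMap.smul_apply, LinearMap.smul_apply, smul_smul, mul_comm]
    simp
  have e3 : Polynomial.X ^ n ∣ p * q - 1 := by
    rw [Polynomial.X_pow_dvd_iff]
    intro d hd
    have := PowerSeries.coeff_mul_eq_coeff_trunc_mul_trunc (PowerSeries.exp ℂ)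
      (PowerSeries.evalNegHom (PowerSeries.exp ℂ)) hd
    rw [PowerSeries.exp_mul_exp_neg_eq_one, PowerSeries.coeff_one] at this
    rw [← Polynomial.coe_mul, Polynomial.coeff_coe] at this
    rw [Polynomial.coeff_sub, hp, hq, ← this, Polynomial.coeff_one, sub_self]
  obtain ⟨r, hr⟩ := e3
  have e4 : (R ^ n) (Polynomial.aeval R q v) = 0 := by
    have : R ^ n * Polynomial.aeval R q = Polynomial.aeval R q * R ^ n := by
      rw [← Polynomial.aeval_X_pow (R := ℂ) R, ← map_mul, mul_comm, map_mul]
    rw [← Module.End.mul_apply, this, Module.End.mul_apply, hn, map_zero]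
  rw [Module.End.mul_apply, e2, e1 _ e4, ← Module.End.mul_apply, ← map_mul,
    eq_add_of_sub_eq hr, map_add, mul_comm, map_mul, map_pow, Polynomial.aeval_X, map_one,
    LinearMap.add_apply, Module.End.mul_apply, hn, map_zero, zero_add]

theorem pow_succ_mul_of_bracket {R A B : Module.End ℂ V} (h : R * A = A * R + B)
    (hB : R * B = B * R) (k : ℕ) :
    R ^ (k + 1) * A = A * R ^ (k + 1) + ((k : ℂ) + 1) • (B * R ^ k) := by
  induction k with
  | zero => simp [h]
  | succ k ih =>
    have hB' : R * (B * R ^ k) = B * R ^ (k + 1) := by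
      rw [← mul_assoc, hB, mul_assoc, ← pow_succ']
    rw [pow_succ' R (k + 1), mul_assoc, ih, mul_add, ← mul_assoc, h, mul_smul_comm, hB', add_mul,
      mul_assoc, ← pow_succ']
    push_cast
    module

/-- The series `e^{ad R} A` stops after the linear term because `[R, [R, A]] = 0`. Hence a tilded
field is the field plus its bracket with `R`. -/
theorem locExp_mul_of_bracket {R A B : Module.End ℂ V} (hR : LocallyNilpotent R)
    (h : R * A = A * R + B) (hB : R * B = B * R) : locExp R * A = (A + B) * locExp R := by
  refine LinearMap.ext fun v => ?_
  obtain ⟨n, hn⟩ := hR v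
  -- One extra power is needed: `R^(n+1) A` involves both `R^(n+1)` and `R^n` on `v`.
  have hn1 : (R ^ (n + 1)) v = 0 := pow_apply_eq_zero_of_le hn (Nat.le_succ n)
  have h1 := fun k => LinearMap.congr_fun (pow_succ_mul_of_bracket h hB k) v
  simp only [Module.End.mul_apply, LinearMap.add_apply, LinearMap.smul_apply] at h1
  have h2 : (R ^ (n + 1)) (A v) = 0 := by rw [h1, hn1, hn, map_zero, map_zero, smul_zero, add_zero]
  rw [Module.End.mul_apply, Module.End.mul_apply, LinearMap.add_apply, locExp_apply hR h2]
  rw [show B (locExp R v) = _ from congrArg B (locExp_apply hR hn),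
    locExp_apply hR hn1, Finset.sum_range_succ', Finset.sum_range_succ', map_add, map_sum, map_sum,
    add_right_comm, ← Finset.sum_add_distrib]
  simp only [h1, pow_zero, Module.End.one_apply, map_smul, smul_add]
  congr 1
  refine Finset.sum_congr rfl fun k _ => ?_
  congr 1
  rw [smul_smul]
  congr 1
  have := k.factorial_ne_zero
  have h3 : (k : ℂ) + 1 ≠ 0 := by exact_mod_cast Nat.succ_ne_zero k
  rw [Nat.factorial_succ]
  push_cast
  field_simp

end LocExp


/-! ### Ghost number grading and `Q² = 0`. -/

section GhostNumber

variable {W Wbar : Type*} [AddCommGroup W] [Module ℂ W] [AddCommGroup Wbar] [Module ℂ Wbar]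
variable {c cbar η ηbar : ℂ} (ρ : W2Module c η W) (σ : W2Module cbar ηbar Wbar)

local notation "gc" => ghost W Wbar Ghost.c
local notation "gb" => ghost W Wbar Ghost.b
local notation "gψ" => ghost W Wbar Ghost.ψ
local notation "gχ" => ghost W Wbar Ghost.χ

theorem hasWeight_ghostNumber_of_superCommute {A : VertexOperator ℂ (BRSTComplex W Wbar)}
    (h : ∀ g, SuperCommute 1 (ghost W Wbar g) A) : HasWeight (ghostNumber W Wbar) 0 0 A := by
  have h' := fun g m => ((h g).symm (by norm_num)).bracket m
  refine hasWeight_of_bracket (fun m => ((h' .c m).normalProd_even (h' .b m) (-1)).add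
    ((h' .ψ m).normalProd_even (h' .χ m) (-1))) fun m => ?_
  simp only [normalProd_zero_left, normalProd_zero_right, add_zero, ncoeff_zero]
  module

theorem hasWeight_ghostNumber_aPlus : HasWeight (ghostNumber W Wbar) 0 0 (aPlus ρ σ) :=
  hasWeight_ghostNumber_of_superCommute (superCommute_ghost_aPlus ρ σ)

theorem hasWeight_ghostNumber_aMinus : HasWeight (ghostNumber W Wbar) 0 0 (aMinus ρ σ) :=
  hasWeight_ghostNumber_of_superCommute (superCommute_ghost_aMinus ρ σ)

theorem hasWeight_ghostNumber_brstCurrent : HasWeight (ghostNumber W Wbar) 0 1 (brstCurrent ρ σ) := by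
  have hc := hasWeight_ghostNumber_ghost (W := W) (Wbar := Wbar) .c
  have hb := hasWeight_ghostNumber_ghost (W := W) (Wbar := Wbar) .b
  have hψ := hasWeight_ghostNumber_ghost (W := W) (Wbar := Wbar) .ψ
  have hχ := hasWeight_ghostNumber_ghost (W := W) (Wbar := Wbar) .χ
  have hL := hasWeight_ghostNumber_of_superCommute (superCommute_ghost_matterVir ρ σ)
  refine (((((hc.normalProd hL 1).congr ?_).add
    ((hc.normalProd (hc.deriv.normalProd hb (-1)) 1).congr ?_)).add
    ((hc.deriv.deriv.smul _).congr ?_)).add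
    ((hψ.normalProd (hasWeight_ghostNumber_aPlus ρ σ) 1).congr ?_)).add
    ((hc.normalProd (hψ.deriv.normalProd hχ (-1)) 1).congr ?_)
  all_goals norm_num [Ghost.number]

theorem ghostNumber_mul_Q : ghostNumber W Wbar * Q ρ σ = Q ρ σ * ghostNumber W Wbar + Q ρ σ := by
  have := hasWeight_ghostNumber_brstCurrent ρ σ 0
  rw [zero_mul, sub_zero, one_smul] at this
  exact this

theorem ghostNumber_of_annihilates {v : BRSTComplex W Wbar}
    (h : ∀ g, Annihilates (ghost W Wbar g) v) : ghostNumber W Wbar v = 0 :=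
  (((h .c).normalProd (h .b) (-1)).add ((h .ψ).normalProd (h .χ) (-1))) 0 le_rfl

/-- An operator of nonzero ghost number commuting with all ghosts vanishes. -/
theorem eq_zero_of_bracket_ghost {X : Module.End ℂ (BRSTComplex W Wbar)} {d : ℂ} (hd : d ≠ 0)
    (hX : ∀ g, Bracket 1 X (ghost W Wbar g) 0) (hN : ghostNumber W Wbar * X = X * ghostNumber W Wbar + d • X) : X = 0 := by
  have comm : ∀ g n v, X (((ghost W Wbar g)[[n]]) v) = ((ghost W Wbar g)[[n]]) (X v) :=
    fun g n v => by
      have := LinearMap.congr_fun (hX g n) v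
      rwa [one_smul, ncoeff_zero, add_zero] at this
  have key : ∀ v, X v = 0 := by
    refine creation_induction (map_zero X) ?_ ?_ ?_ ?_
    · intro x y hx hy
      rw [map_add, hx, hy, add_zero]
    · intro r x hx
      rw [map_smul, hx, smul_zero]
    · intro w wbar
      -- Commuting with the ghosts, `X` preserves annihilation by all nonnegative ghost modes, so
      -- the image has ghost number `0`; the grading assigns it ghost number `d ≠ 0`.
      have h1 : ghostNumber W Wbar (X (vacTensor w wbar)) = 0 := ghostNumber_of_annihilates fun g n hn => by
        rw [← comm, annihilates_ghost g w wbar n hn, map_zero]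
      have h2 := LinearMap.congr_fun hN (vacTensor w wbar)
      rw [Module.End.mul_apply, h1, LinearMap.add_apply, Module.End.mul_apply,
        ghostNumber_of_annihilates fun g => annihilates_ghost g w wbar, map_zero, zero_add,
        LinearMap.smul_apply] at h2
      exact (smul_eq_zero.1 h2.symm).resolve_left hd
    · intro g j x hx
      rw [comm, hx, map_zero]
  exact LinearMap.ext key

/-- Testing against the four ghosts is enough: no bracket of `Q²` with a matter field has to vanish
separately. -/
theorem Q_mul_Q (hc : c + cbar = 28) (hη : η + ηbar = 0) : Q ρ σ * Q ρ σ = 0 := by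
  refine eq_zero_of_bracket_ghost (d := 2) two_ne_zero (fun g => ?_) ?_
  · cases g
    · exact bracket_Q_sq_b ρ σ hc
    · exact bracket_Q_sq_c ρ σ
    · exact bracket_Q_sq_ψ ρ σ
    · exact bracket_Q_sq_χ ρ σ hη
  · rw [← mul_assoc, ghostNumber_mul_Q, add_mul, mul_assoc, ghostNumber_mul_Q, mul_add,
      ← mul_assoc]
    module

theorem mem_ghostDegree {k : ℤ} {v : BRSTComplex W Wbar} :
    v ∈ ghostDegree W Wbar k ↔ ghostNumber W Wbar v = (k : ℂ) • v :=
  Module.End.mem_eigenspace_iff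

theorem Q_mem_ghostDegree {k : ℤ} {v : BRSTComplex W Wbar} (hv : v ∈ ghostDegree W Wbar k) :
    Q ρ σ v ∈ ghostDegree W Wbar (k + 1) := by
  rw [mem_ghostDegree] at hv ⊢
  have := LinearMap.congr_fun (ghostNumber_mul_Q ρ σ) v
  rw [Module.End.mul_apply, LinearMap.add_apply, Module.End.mul_apply, hv, map_smul] at this
  rw [this]
  push_cast
  module

end GhostNumber

/-! ### Products of modes of anticommuting fields. -/

section Odd

variable {V : Type*} [AddCommGroup V] [Module ℂ V] {A B C : VertexOperator ℂ V}

theorem SuperCommute.commute_mul (hA : SuperCommute (-1) A C) (hB : SuperCommute (-1) B C)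
    (p q r : ℤ) : Commute (A[[p]] * B[[q]]) (C[[r]]) := by
  rw [Commute, SemiconjBy, mul_assoc, hB, mul_smul_comm, ← mul_assoc, hA, smul_mul_assoc, mul_assoc]
  module

theorem SuperCommute.mul_self (h : SuperCommute (-1) A A) (p : ℤ) : A[[p]] * A[[p]] = 0 := by
  have : (2 : ℂ) • (A[[p]] * A[[p]]) = 0 := by linear_combination (norm := module) h p p
  exact (smul_eq_zero.1 this).resolve_left two_ne_zero

end Odd

section Conjugation

variable {W Wbar : Type*} [AddCommGroup W] [Module ℂ W] [AddCommGroup Wbar] [Module ℂ Wbar]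
variable {c cbar η ηbar : ℂ} (ρ : W2Module c η W) (σ : W2Module cbar ηbar Wbar)

local notation "gc" => ghost W Wbar Ghost.c
local notation "gb" => ghost W Wbar Ghost.b
local notation "gψ" => ghost W Wbar Ghost.ψ
local notation "gχ" => ghost W Wbar Ghost.χ

/-! ### Brackets with `R` -/

/-- The central terms `2η` and `2η̄` add up to zero. This isotropy of `a⁻` is the reason why `S`
anticommutes with itself and `ad R` has square zero on the generators. -/
theorem superCommute_aMinus_aMinus (hη : η + ηbar = 0) :
    SuperCommute 1 (aMinus ρ σ) (aMinus ρ σ) := fun p q => by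
  obtain rfl : ηbar = -η := by linear_combination hη
  have h1 := bracket_aField_aMinus ρ σ p q
  have h2 := bracket_abarField_aMinus ρ σ p q
  have h3 : (aMinus ρ σ)[[p]] = (aField ρ)[[p]] - (abarField σ)[[p]] := ncoeff_sub _ _ _
  simp only [ncoeff_neg, ncoeff_smul] at h1 h2
  rw [h3, sub_mul, mul_sub, h1, h2]
  module

theorem superCommute_ghost_S {g : Ghost} (h : Ghost.χ ≠ g.dual) :
    SuperCommute (-1) (ghost W Wbar g) (S ρ σ) := by
  have := (superCommute_ghost_aMinus ρ σ g).normalProd_right (superCommute_ghost h) (by norm_num) 1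
  rw [one_mul] at this
  exact this.smul_right _

theorem superCommute_aMinus_S (hη : η + ηbar = 0) : SuperCommute 1 (aMinus ρ σ) (S ρ σ) := by
  have := (superCommute_aMinus_aMinus ρ σ hη).normalProd_right
    ((superCommute_ghost_aMinus ρ σ .χ).symm (by norm_num)) (by norm_num) 1
  rw [one_mul] at this
  exact this.smul_right _

theorem superCommute_S_S (hη : η + ηbar = 0) : SuperCommute (-1) (S ρ σ) (S ρ σ) := by
  have := ((superCommute_aMinus_S ρ σ hη).symm (by norm_num)).normalProd_right
    ((superCommute_ghost_S ρ σ (g := .χ) (by simp [Ghost.dual])).symm (by norm_num)) (by norm_num) 1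
  rw [one_mul] at this
  exact this.smul_right _

theorem R_eq : R ρ σ = (nopOdd gc (S ρ σ))[[0]] := by
  rw [R, S, nopOdd, nopOdd, normalProd_smul_right, ncoeff_smul]

/-- Passing a field across the product `c S` costs the sign `s` twice, so fields even and odd alike
commute with `R` once they commute up to `s` with `c` and with `S`. -/
theorem bracket_R_zero {s : ℂ} {A : VertexOperator ℂ (BRSTComplex W Wbar)} (hs : s * s = 1)
    (hc : SuperCommute s A gc) (hS : SuperCommute s A (S ρ σ)) : Bracket 1 (R ρ σ) A 0 := by
  rw [R_eq]
  refine Bracket.swap_even (F' := fun _ => 0) (fun m => ?_) 0 fun m => ?_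
  · have := hc.normalProd_right hS hs (-1)
    rw [hs] at this
    exact this.bracket m
  · rw [ncoeff_zero, ncoeff_zero, neg_zero]

theorem bracket_R_c : Bracket 1 (R ρ σ) gc 0 :=
  bracket_R_zero ρ σ (s := -1) (by norm_num) superCommute_c_c
    (superCommute_ghost_S ρ σ (by simp [Ghost.dual]))

theorem bracket_R_χ : Bracket 1 (R ρ σ) gχ 0 :=
  bracket_R_zero ρ σ (s := -1) (by norm_num) (superCommute_ghost (by simp [Ghost.dual]))
    (superCommute_ghost_S ρ σ (by simp [Ghost.dual]))

theorem bracket_R_S (hη : η + ηbar = 0) : Bracket 1 (R ρ σ) (S ρ σ) 0 :=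
  bracket_R_zero ρ σ (s := -1) (by norm_num)
    ((superCommute_ghost_S ρ σ (by simp [Ghost.dual])).symm (by norm_num))
    (superCommute_S_S ρ σ hη)

theorem bracket_R_aMinus (hη : η + ηbar = 0) : Bracket 1 (R ρ σ) (aMinus ρ σ) 0 :=
  bracket_R_zero ρ σ (s := 1) (by norm_num)
    ((superCommute_ghost_aMinus ρ σ .c).symm (by norm_num)) (superCommute_aMinus_S ρ σ hη)

theorem bracket_R_b : Bracket 1 (R ρ σ) gb (-S ρ σ) := by
  rw [R_eq]
  refine Bracket.swap_even (fun m => (bracket_ghost_dual .b m).nopOdd_odd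
    ((superCommute_ghost_S ρ σ (g := .b) (by simp [Ghost.dual])).bracket m)) 0 fun m => ?_
  rw [nop, nop, normalProd_zpowField_left, normalProd_zero_right, sub_zero, shift_ncoeff, zero_add,
    ncoeff_neg, neg_neg]

theorem bracket_R_ψ : Bracket 1 (R ρ σ) gψ ((1 / (4 * η)) • nop gc (aMinus ρ σ)) := by
  rw [R_eq]
  refine Bracket.swap_even (fun m => (bracket_ghost_of_ne (by simp [Ghost.dual]) m).nopOdd_odd
    ((((superCommute_ghost_aMinus ρ σ .ψ).bracket m).nop_even_odd
      (bracket_ghost_dual .ψ m)).smul (1 / (4 * η)))) 0 fun m => ?_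
  simp only [nop, nopOdd, normalProd_zero_left, normalProd_zpowField_right, normalProd_smul_right,
    normalProd_shift_right, ncoeff_sub, ncoeff_smul, ncoeff_zero, shift_ncoeff, zero_add]
  module

theorem bracket_aPlus_aMinus (hη : η + ηbar = 0) (m : ℤ) : Bracket 1 ((aPlus ρ σ)[[m]])
    (aMinus ρ σ) ((4 * η * m) • zpowField _ (m - 1)) := by
  obtain rfl : ηbar = -η := by linear_combination hη
  rw [aPlus, ncoeff_add]
  refine ((bracket_aField_aMinus ρ σ m).add_op (bracket_abarField_aMinus ρ σ m)).congr ?_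
  module

/-- The contraction of `a⁺` with `a⁻` is `4η`; the normalization `1/(4η)` in `R` makes the
coefficient of `∂(c χ)` equal to one. -/
theorem bracket_R_aPlus (hη : η + ηbar = 0) (hη0 : η ≠ 0) :
    Bracket 1 (R ρ σ) (aPlus ρ σ) (deriv (nopOdd gc gχ)) := by
  rw [R_eq]
  have h := fun g => (superCommute_ghost_aPlus ρ σ g).symm (by norm_num)
  refine Bracket.swap_even (fun m => ((h .c).bracket m).normalProd_even
    (((bracket_aPlus_aMinus ρ σ hη m).normalProd_even ((h .χ).bracket m) 1).smul (1 / (4 * η)))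
    (-1)) 0 fun m => ?_
  simp only [nopOdd, normalProd_zero_left, normalProd_zero_right, normalProd_smul_left,
    normalProd_zpowField_left, normalProd_smul_right, normalProd_shift_right, ncoeff_add,
    ncoeff_smul, ncoeff_zero, shift_ncoeff, zero_add, add_zero, deriv_ncoeff, smul_smul]
  rw [show 1 / (4 * η) * (4 * η * (m : ℂ)) = m by field_simp]
  module

/-- Two successive brackets with `R` annihilate each ghost. This propagates local nilpotency from
the vectors `w ⊗ w̄ ⊗ 𝟏` to the whole complex. -/
theorem exists_bracket_R_ghost (hη : η + ηbar = 0) (g : Ghost) :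
    ∃ B, Bracket 1 (R ρ σ) (ghost W Wbar g) B ∧ Bracket 1 (R ρ σ) B 0 := by
  cases g
  · exact ⟨_, bracket_R_b ρ σ, (bracket_R_S ρ σ hη).neg.congr neg_zero⟩
  · exact ⟨_, bracket_R_c ρ σ, fun n => by rw [ncoeff_zero]; simp⟩
  · refine ⟨_, bracket_R_ψ ρ σ, (((bracket_R_c ρ σ).normalProd_even
      (bracket_R_aMinus ρ σ hη) 1).smul _).congr ?_⟩
    rw [normalProd_zero_left, normalProd_zero_right, add_zero, smul_zero]
  · exact ⟨_, bracket_R_χ ρ σ, fun n => by rw [ncoeff_zero]; simp⟩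

/-! ### Local nilpotency of `R` -/

theorem R_apply (v : BRSTComplex W Wbar) :
    R ρ σ v = ∑ᶠ p : ℤ, (gc[[p]]) (((S ρ σ)[[-1 - p]]) v) := by
  rw [R_eq, (superCommute_ghost_S ρ σ (g := .c) (by simp [Ghost.dual])).normalProd_apply]
  simp only [zero_sub]

/-- On such a vector only finitely many summands `c₍ₚ₎ S₍₋₁₋ₚ₎` act nontrivially. They commute with
one another and each has square zero since `c₍ₚ₎² = 0`, so their sum is nilpotent. -/
theorem exists_R_pow_vacTensor (hη : η + ηbar = 0) (w : W) (wbar : Wbar) :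
    ∃ n : ℕ, (R ρ σ ^ n) (vacTensor w wbar) = 0 := by
  obtain ⟨N, hN⟩ := exists_ncoeff_eq_zero (S ρ σ) (vacTensor w wbar)
  have hcS := superCommute_ghost_S ρ σ (g := .c) (by simp [Ghost.dual])
  have hSS := superCommute_S_S ρ σ hη
  have hcc := superCommute_c_c (W := W) (Wbar := Wbar)
  set f : ℤ → Module.End ℂ (BRSTComplex W Wbar) := fun p => gc[[p]] * (S ρ σ)[[-1 - p]] with hf
  set RN := ∑ p ∈ Finset.Ioo (-1 - N) 0, f p with hRN
  have hfc : ∀ p q, Commute (f p) (gc[[q]]) := fun p q =>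
    hcc.commute_mul (hcS.symm (by norm_num)) _ _ _
  have hfS : ∀ p q, Commute (f p) ((S ρ σ)[[q]]) := fun p q => hcS.commute_mul hSS _ _ _
  have hsq : ∀ p, IsNilpotent (f p) := fun p => by
    refine ⟨2, ?_⟩
    rw [pow_two]
    nth_rewrite 2 [hf]
    rw [← mul_assoc, hfc p p, ← mul_assoc, hcc.mul_self, zero_mul, zero_mul]
  -- The vanishing conditions on `v` persist under `R`, which commutes with all modes of `c` and
  -- `S`; hence `R` may be replaced by the same finite sum at every iteration.
  have key : ∀ v, (∀ n, 0 ≤ n → (gc[[n]]) v = 0) → (∀ n, N ≤ n → ((S ρ σ)[[n]]) v = 0) →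
      ∀ n, (R ρ σ ^ n) v = (RN ^ n) v := by
    intro v hv hv' n
    induction n generalizing v with
    | zero => rfl
    | succ n ih =>
      have e : R ρ σ v = RN v := by
        rw [R_apply, hRN, LinearMap.sum_apply]
        refine finsum_eq_sum_of_support_subset _ fun p hp => ?_
        rw [Finset.coe_Ioo]
        refine ⟨?_, ?_⟩
        · by_contra h
          exact hp (by simp only; rw [hv' _ (by omega), map_zero])
        · by_contra h
          refine hp ?_
          simp only
          rw [← Module.End.mul_apply, hcS, LinearMap.smul_apply, Module.End.mul_apply,
            hv _ (by omega), map_zero, smul_zero]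
      rw [pow_succ, pow_succ, Module.End.mul_apply, Module.End.mul_apply, ← e]
      refine ih _ (fun m hm => ?_) fun m hm => ?_
      · have := LinearMap.congr_fun (bracket_R_c ρ σ m) v
        rw [one_smul, ncoeff_zero, add_zero, Module.End.mul_apply, Module.End.mul_apply, hv m hm,
          map_zero] at this
        exact this.symm
      · have := LinearMap.congr_fun (bracket_R_S ρ σ hη m) v
        rw [one_smul, ncoeff_zero, add_zero, Module.End.mul_apply, Module.End.mul_apply, hv' m hm,
          map_zero] at this
        exact this.symm
  obtain ⟨n, hn⟩ : IsNilpotent RN :=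
    Commute.isNilpotent_sum (fun p _ => hsq p) fun p q _ _ => (hfc p q).mul_right (hfS p _)
  refine ⟨n, ?_⟩
  rw [key _ (annihilates_ghost .c w wbar) hN, hn, LinearMap.zero_apply]

/-- The complex is generated by ghost creation modes from `w ⊗ w̄ ⊗ 𝟏`, and commuting a power of `R`
past one such mode costs at most one power of `R`. -/
theorem locallyNilpotent_R (hη : η + ηbar = 0) : LocallyNilpotent (R ρ σ) := by
  refine creation_induction ⟨0, map_zero _⟩ ?_ ?_ (exists_R_pow_vacTensor ρ σ hη) ?_
  · rintro x y ⟨n, hn⟩ ⟨m, hm⟩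
    refine ⟨max n m, ?_⟩
    rw [map_add, pow_apply_eq_zero_of_le hn (le_max_left _ _),
      pow_apply_eq_zero_of_le hm (le_max_right _ _), add_zero]
  · rintro r x ⟨n, hn⟩
    exact ⟨n, by rw [map_smul, hn, smul_zero]⟩
  · rintro g j x ⟨n, hn⟩
    obtain ⟨B, hB, hB'⟩ := exists_bracket_R_ghost ρ σ hη g
    have h1 := hB (-(j : ℤ) - 1)
    have h2 := hB' (-(j : ℤ) - 1)
    rw [one_smul] at h1
    rw [one_smul, ncoeff_zero, add_zero] at h2
    refine ⟨n + 1, ?_⟩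
    have := LinearMap.congr_fun (pow_succ_mul_of_bracket h1 h2 n) x
    rw [Module.End.mul_apply] at this
    rw [this, LinearMap.add_apply, Module.End.mul_apply,
      pow_apply_eq_zero_of_le hn (Nat.le_succ n), map_zero, LinearMap.smul_apply,
      Module.End.mul_apply, hn, map_zero, smul_zero, add_zero]

/-! ### Conjugated fields -/

theorem expR_mul_expNegR (hη : η + ηbar = 0) : locExp (R ρ σ) * locExp (-R ρ σ) = 1 :=
  locExp_mul_locExp_neg (locallyNilpotent_R ρ σ hη)

theorem expNegR_mul_expR (hη : η + ηbar = 0) : locExp (-R ρ σ) * locExp (R ρ σ) = 1 := by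
  have := locExp_mul_locExp_neg (locallyNilpotent_R ρ σ hη).neg
  rwa [neg_neg] at this

theorem tilde_eq_add (hη : η + ηbar = 0) {A B : VertexOperator ℂ (BRSTComplex W Wbar)}
    (h : Bracket 1 (R ρ σ) A B) (h' : Bracket 1 (R ρ σ) B 0) : tilde ρ σ A = A + B :=
  field_ext fun n => by
    have h1 := h n
    have h2 := h' n
    rw [one_smul] at h1
    rw [one_smul, ncoeff_zero, add_zero] at h2
    rw [tilde, conjField_ncoeff, locExp_mul_of_bracket (locallyNilpotent_R ρ σ hη) h1 h2, mul_assoc,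
      expR_mul_expNegR ρ σ hη, mul_one, ncoeff_add]

theorem tilde_eq_self (hη : η + ηbar = 0) {A : VertexOperator ℂ (BRSTComplex W Wbar)}
    (h : Bracket 1 (R ρ σ) A 0) : tilde ρ σ A = A := by
  rw [tilde_eq_add ρ σ hη h fun n => by rw [ncoeff_zero]; simp, add_zero]

theorem tilde_normalProd (hη : η + ηbar = 0) (s : ℂ)
    (A B : VertexOperator ℂ (BRSTComplex W Wbar)) :
    tilde ρ σ (normalProd s A B) = normalProd s (tilde ρ σ A) (tilde ρ σ B) :=
  conjField_normalProd (expNegR_mul_expR ρ σ hη) s A B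

theorem tilde_deriv (A : VertexOperator ℂ (BRSTComplex W Wbar)) :
    tilde ρ σ (deriv A) = deriv (tilde ρ σ A) := conjField_deriv _ _ A

theorem tilde_add (A B : VertexOperator ℂ (BRSTComplex W Wbar)) :
    tilde ρ σ (A + B) = tilde ρ σ A + tilde ρ σ B := conjField_add _ _ A B

theorem tilde_smul (r : ℂ) (A : VertexOperator ℂ (BRSTComplex W Wbar)) :
    tilde ρ σ (r • A) = r • tilde ρ σ A := conjField_smul _ _ r A

theorem tilde_c (hη : η + ηbar = 0) : tilde ρ σ gc = gc :=
  tilde_eq_self ρ σ hη (bracket_R_c ρ σ)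

theorem tilde_χ (hη : η + ηbar = 0) : tilde ρ σ gχ = gχ :=
  tilde_eq_self ρ σ hη (bracket_R_χ ρ σ)

theorem tilde_aMinus (hη : η + ηbar = 0) : tilde ρ σ (aMinus ρ σ) = aMinus ρ σ :=
  tilde_eq_self ρ σ hη (bracket_R_aMinus ρ σ hη)

theorem tilde_b (hη : η + ηbar = 0) : tilde ρ σ gb = gb - S ρ σ := by
  rw [tilde_eq_add ρ σ hη (bracket_R_b ρ σ) ((bracket_R_S ρ σ hη).neg.congr neg_zero),
    sub_eq_add_neg]

theorem tilde_ψ (hη : η + ηbar = 0) :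
    tilde ρ σ gψ = gψ + (1 / (4 * η)) • nop gc (aMinus ρ σ) := by
  refine tilde_eq_add ρ σ hη (bracket_R_ψ ρ σ) ((((bracket_R_c ρ σ).normalProd_even
      (bracket_R_aMinus ρ σ hη) 1).smul _).congr ?_)
  rw [normalProd_zero_left, normalProd_zero_right, add_zero, smul_zero]

theorem tilde_aPlus (hη : η + ηbar = 0) (hη0 : η ≠ 0) :
    tilde ρ σ (aPlus ρ σ) = aPlus ρ σ + deriv (nopOdd gc gχ) := by
  refine tilde_eq_add ρ σ hη (bracket_R_aPlus ρ σ hη hη0) (((bracket_R_c ρ σ).normalProd_even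
      (bracket_R_χ ρ σ) (-1)).deriv.congr ?_)
  rw [normalProd_zero_left, normalProd_zero_right, add_zero, deriv_zero]

end Conjugation


section Commutators

variable {W Wbar : Type*} [AddCommGroup W] [Module ℂ W] [AddCommGroup Wbar] [Module ℂ Wbar]
variable {c cbar η ηbar : ℂ} (ρ : W2Module c η W) (σ : W2Module cbar ηbar Wbar)

local notation "gc" => ghost W Wbar Ghost.c
local notation "gb" => ghost W Wbar Ghost.b
local notation "gψ" => ghost W Wbar Ghost.ψ
local notation "gχ" => ghost W Wbar Ghost.χ

/-! ### BRST commutators -/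

theorem charge_eq : charge ρ σ = (aPlus ρ σ)[[0]] := (ncoeff_add _ _ _).symm

theorem commutator_χ (hη : η + ηbar = 0) :
    Q ρ σ * zeroMode₁ (tilde ρ σ gχ) + zeroMode₁ (tilde ρ σ gχ) * Q ρ σ = charge ρ σ := by
  have h := bracket_Q_χ ρ σ 0
  rw [ncoeff_add, deriv_ncoeff] at h
  rw [tilde_χ ρ σ hη, charge_eq, zeroMode₁, h]
  push_cast
  module

theorem nop_aMinus_aPlus (hη : η + ηbar = 0) :
    nop (aMinus ρ σ) (aPlus ρ σ) = nop (aPlus ρ σ) (aMinus ρ σ) := by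
  refine (normalProd_comm_of_heisenberg (κ := 4 * η) fun p q => ?_).symm
  have := bracket_aPlus_aMinus ρ σ hη p q
  rw [one_smul, ncoeff_smul, zpowField_ncoeff] at this
  rw [this]
  by_cases h : p + q = 0
  · rw [if_pos h, if_pos (by omega)]
  · rw [if_neg h, if_neg (by omega), smul_zero]

theorem nop_aMinus_deriv_cχ :
    nop (aMinus ρ σ) (deriv (nopOdd gc gχ)) = nop (deriv (nopOdd gc gχ)) (aMinus ρ σ) := by
  have h := fun g => (superCommute_ghost_aMinus ρ σ g).symm (by norm_num)
  have h' := (h .c).normalProd_right (h .χ) (by norm_num) (-1)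
  rw [one_mul] at h'
  rw [nop, h'.deriv_right.normalProd_comm (by norm_num)]
  module

theorem T_eq (hη : η + ηbar = 0) (hη0 : η ≠ 0) : T ρ σ =
    (1 / (4 * η)) • (nop (aPlus ρ σ) (aMinus ρ σ) + nop (deriv (nopOdd gc gχ)) (aMinus ρ σ)
      + nopOdd (deriv (nop gc (aMinus ρ σ))) gχ) + nopOdd (deriv gψ) gχ := by
  rw [T, tilde_aPlus ρ σ hη hη0, tilde_aMinus ρ σ hη, tilde_ψ ρ σ hη, tilde_χ ρ σ hη]
  simp only [nop, nopOdd, normalProd_add_left, deriv_add, deriv_smul, normalProd_smul_left]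
  module

/-- The term `4η ∂ψ` in the variation of `a⁻` yields exactly `:∂ψ χ:`, and `a⁺` in the variation of
`χ` yields `(1/4η) :a⁺ a⁻:`. The remaining terms in `c a⁻ χ` are those by which the tilded fields in
`T` differ from the untilded ones. -/
theorem bracket_Q_S (hη : η + ηbar = 0) (hη0 : η ≠ 0) : Bracket (-1) (Q ρ σ) (S ρ σ) (T ρ σ) := by
  refine (((bracket_Q_aMinus ρ σ hη).nop_even_odd (bracket_Q_χ ρ σ)).smul (1 / (4 * η))).congr ?_
  have h1 := nop_aMinus_aPlus ρ σ hη
  have h2 := nop_aMinus_deriv_cχ ρ σ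
  rw [T_eq ρ σ hη hη0]
  simp only [nop, nopOdd] at h1 h2 ⊢
  simp only [normalProd_add_left, normalProd_add_right, normalProd_smul_left, h1, h2, smul_add,
    smul_smul]
  rw [show 1 / (4 * η) * (4 * η) = 1 by field_simp]
  module

theorem commutator_S (hη : η + ηbar = 0) (hη0 : η ≠ 0) :
    Q ρ σ * zeroMode₂ (S ρ σ) + zeroMode₂ (S ρ σ) * Q ρ σ = T₀ ρ σ := by
  rw [T₀, zeroMode₂, zeroMode₂, bracket_Q_S ρ σ hη hη0 1]
  module

/-- Because `η̄ = -η`, the two subtracted squares combine into `a² - ā²`, which factors as `a⁺ a⁻`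
since `a` and `ā` commute. -/
theorem virL_add_virLbar (hη : η + ηbar = 0) :
    virL ρ + virLbar σ = matterVir ρ σ - (1 / (4 * η)) • nop (aPlus ρ σ) (aMinus ρ σ) := by
  obtain rfl : ηbar = -η := by linear_combination hη
  have h := (superCommute_aField_abarField ρ σ).normalProd_comm (by norm_num)
  rw [virL, virLbar, matterVir, aPlus, aMinus]
  simp only [nop, normalProd_add_left, normalProd_sub_right, h]
  rw [show 1 / (4 * -η) = -(1 / (4 * η)) by rw [mul_neg, one_div_neg_eq_neg_one_div] ]
  module

theorem tilde_virBC (hη : η + ηbar = 0) : tilde ρ σ (virBC W Wbar) =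
    virBC W Wbar - (2 : ℂ) • nopOdd (deriv gc) (S ρ σ) - nopOdd gc (deriv (S ρ σ)) := by
  rw [virBC, tilde_add, tilde_smul, nopOdd, nopOdd, tilde_normalProd ρ σ hη,
    tilde_normalProd ρ σ hη, tilde_deriv, tilde_deriv, tilde_c ρ σ hη, tilde_b ρ σ hη]
  simp only [deriv_sub, normalProd_sub_right]
  module

theorem nopOdd_nop_eq {C X A : VertexOperator ℂ (BRSTComplex W Wbar)}
    (hCA : SuperCommute 1 C A) (hXA : SuperCommute 1 X A) (hCX : SuperCommute (-1) C X) :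
    nopOdd (nop C A) X = nopOdd C (nop A X) := by
  have := normalProd_assoc hCA hCX (hXA.symm (by norm_num))
  rwa [mul_one, one_mul] at this

theorem nop_nopOdd_eq {C X A : VertexOperator ℂ (BRSTComplex W Wbar)}
    (hCA : SuperCommute 1 C A) (hXA : SuperCommute 1 X A) (hCX : SuperCommute (-1) C X) :
    nop (nopOdd C X) A = nopOdd C (nop A X) := by
  have := normalProd_assoc hCX hCA hXA
  rw [hXA.normalProd_comm (by norm_num), mul_one, mul_one, one_smul] at this
  exact this

/-- The term `(1/4η) :a⁺ a⁻:` of `T` changes `𝓛 + 𝓛̄` into `L + L̄`, the term `:∂ψ χ:` removes the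
second ghost system, and the terms in `c a⁻ χ` are the correction from `L^Λ` to `L̃^Λ`. -/
theorem totalVir_sub_T (hη : η + ηbar = 0) (hη0 : η ≠ 0) :
    totalVir ρ σ - T ρ σ = virL ρ + virLbar σ + tilde ρ σ (virBC W Wbar) := by
  have cA := superCommute_ghost_aMinus ρ σ .c
  have χA := superCommute_ghost_aMinus ρ σ .χ
  have cχ := superCommute_c_χ (W := W) (Wbar := Wbar)
  rw [virL_add_virLbar ρ σ hη, tilde_virBC ρ σ hη, T_eq ρ σ hη hη0, totalVir, virM, S]
  have e1 := nopOdd_nop_eq cA.deriv_left χA cχ.deriv_left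
  have e2 := nopOdd_nop_eq cA.deriv_right χA.deriv_right cχ
  have e3 := nop_nopOdd_eq cA.deriv_left χA cχ.deriv_left
  have e4 := nop_nopOdd_eq cA χA.deriv_left cχ.deriv_right
  simp only [nop, nopOdd] at e1 e2 e3 e4 ⊢
  simp only [deriv_smul, deriv_normalProd, normalProd_add_left, normalProd_add_right,
    normalProd_smul_right, e1, e2, e3, e4]
  module

theorem energyBC_eq (hη : η + ηbar = 0) (hη0 : η ≠ 0) :
    energyBC ρ σ = (totalVir ρ σ)[[1]] - (T ρ σ)[[1]] := by
  rw [← ncoeff_sub, totalVir_sub_T ρ σ hη hη0, ncoeff_add, ncoeff_add]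
  rfl

/-- Since `b̃ = b - S`, this is the difference of `{Q, b} = K` and `{Q, S} = T` at the level of zero
modes. -/
theorem commutator_b (hη : η + ηbar = 0) (hη0 : η ≠ 0) :
    Q ρ σ * zeroMode₂ (tilde ρ σ gb) + zeroMode₂ (tilde ρ σ gb) * Q ρ σ = energyBC ρ σ := by
  have := ((bracket_Q_b ρ σ).sub (bracket_Q_S ρ σ hη hη0)) 1
  rw [ncoeff_sub (totalVir ρ σ)] at this
  rw [energyBC_eq ρ σ hη hη0, tilde_b ρ σ hη, zeroMode₂, this]
  module

/-! ### Triviality on cohomology -/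

theorem HasWeight.mem_ghostDegree {A : VertexOperator ℂ (BRSTComplex W Wbar)} {d k : ℤ}
    (h : HasWeight (ghostNumber W Wbar) 0 d A) (n : ℤ) {v : BRSTComplex W Wbar} (hv : v ∈ ghostDegree W Wbar k) :
    (A[[n]]) v ∈ ghostDegree W Wbar (k + d) := by
  rw [W2BRST.mem_ghostDegree] at hv ⊢
  have := LinearMap.congr_fun (h n) v
  rw [Module.End.mul_apply, LinearMap.add_apply, Module.End.mul_apply, hv, map_smul,
    LinearMap.smul_apply] at this
  rw [this]
  push_cast
  module

theorem hasWeight_ghostNumber_S : HasWeight (ghostNumber W Wbar) 0 (-1) (S ρ σ) :=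
  (((hasWeight_ghostNumber_aMinus ρ σ).normalProd (hasWeight_ghostNumber_ghost .χ) 1).smul
    _).congr (by norm_num [Ghost.number])

theorem cls_eq_zero_iff {k : ℤ} {Φ : cycles ρ σ k} :
    cls ρ σ k Φ = 0 ↔ (Φ : BRSTComplex W Wbar) ∈ boundaries ρ σ k := by
  rw [cls, Submodule.mkQ_apply, Submodule.Quotient.mk_eq_zero]
  rfl

/-- `X` is a chain homotopy: on a cycle `Φ` the commutator reduces to `Q (X Φ)`, a boundary of the
right ghost number. -/
theorem killsCohomology_of_commutator {O X : Module.End ℂ (BRSTComplex W Wbar)}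
    (hQ : Q ρ σ * Q ρ σ = 0) (hO : Q ρ σ * X + X * Q ρ σ = O)
    (hX : ∀ k, ∀ v ∈ ghostDegree W Wbar k, X v ∈ ghostDegree W Wbar (k - 1)) :
    KillsCohomology ρ σ O := by
  have hcomm : Commute (Q ρ σ) O := by
    rw [Commute, SemiconjBy, ← hO, mul_add, add_mul, ← mul_assoc, hQ, mul_assoc X, hQ, mul_assoc]
    simp
  refine ⟨hcomm, fun k Φ => ?_⟩
  obtain ⟨Φ, h1, h2⟩ := Φ
  rw [SetLike.mem_coe] at h1
  have h2 : Q ρ σ Φ = 0 := h2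
  have e : O Φ = Q ρ σ (X Φ) := by
    rw [← hO, LinearMap.add_apply, Module.End.mul_apply, Module.End.mul_apply, h2, map_zero,
      add_zero]
  have h3 := Q_mem_ghostDegree ρ σ (hX k Φ h1)
  rw [sub_add_cancel, ← e] at h3
  refine ⟨⟨h3, ?_⟩, ?_⟩
  · change Q ρ σ (O Φ) = 0
    rw [e, ← Module.End.mul_apply, hQ, LinearMap.zero_apply]
  · rw [cls_eq_zero_iff]
    exact ⟨X Φ, hX k Φ h1, e.symm⟩

/-- For `δ ≠ 0` the exactness of `δ • Φ` implies that of `Φ`. -/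
theorem KillsCohomology.nontrivialEigencyclesInKer {O : Module.End ℂ (BRSTComplex W Wbar)}
    (h : KillsCohomology ρ σ O) : NontrivialEigencyclesInKer ρ σ O := by
  intro k Φ δ hΦ hne
  obtain ⟨h1, h2⟩ := h.2 k Φ
  rw [cls_eq_zero_iff] at h2
  by_contra h0
  have hδ : δ ≠ 0 := by
    rintro rfl
    exact h0 (by rw [hΦ, zero_smul])
  refine hne ((cls_eq_zero_iff ρ σ).2 ?_)
  have h3 : O Φ ∈ boundaries ρ σ k := h2
  rwa [hΦ, Submodule.smul_mem_iff _ hδ] at h3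

theorem killsCohomology_charge (hc : c + cbar = 28) (hη : η + ηbar = 0) :
    KillsCohomology ρ σ (charge ρ σ) := by
  refine killsCohomology_of_commutator ρ σ (Q_mul_Q ρ σ hc hη) (commutator_χ ρ σ hη) fun k v hv => ?_
  rw [tilde_χ ρ σ hη]
  exact HasWeight.mem_ghostDegree (d := -1)
    ((hasWeight_ghostNumber_ghost .χ).congr (by simp [Ghost.number])) 0 hv

theorem killsCohomology_T₀ (hc : c + cbar = 28) (hη : η + ηbar = 0) (hη0 : η ≠ 0) :
    KillsCohomology ρ σ (T₀ ρ σ) := by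
  refine killsCohomology_of_commutator ρ σ (Q_mul_Q ρ σ hc hη) (commutator_S ρ σ hη hη0)
    fun k v hv => ?_
  exact HasWeight.mem_ghostDegree (d := -1)
    ((hasWeight_ghostNumber_S ρ σ).congr (by simp)) 1 hv

theorem killsCohomology_energyBC (hc : c + cbar = 28) (hη : η + ηbar = 0) (hη0 : η ≠ 0) :
    KillsCohomology ρ σ (energyBC ρ σ) := by
  refine killsCohomology_of_commutator ρ σ (Q_mul_Q ρ σ hc hη) (commutator_b ρ σ hη hη0)
    fun k v hv => ?_
  rw [tilde_b ρ σ hη]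
  exact HasWeight.mem_ghostDegree (d := -1)
    (((hasWeight_ghostNumber_ghost .b).sub ((hasWeight_ghostNumber_S ρ σ).congr
      (by simp [Ghost.number]))).congr (by simp [Ghost.number])) 1 hv

end Commutators


/-! ### Commuting operators, weights and conjugation by exponentials. -/

section Operators

variable {V : Type*} [AddCommGroup V] [Module ℂ V]

theorem HasWeight.add_op {X Y : Module.End ℂ V} {κ κ' α α' : ℂ} {A : VertexOperator ℂ V}
    (h : HasWeight X κ α A) (k : HasWeight Y κ' α' A) : HasWeight (X + Y) (κ + κ') (α + α') A :=
  fun n => by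
    rw [add_mul, mul_add, h n, k n]
    module

theorem SuperCommute.commute {A B : VertexOperator ℂ V} (h : SuperCommute 1 A B) (p q : ℤ) :
    Commute (A[[p]]) (B[[q]]) := by
  rw [Commute, SemiconjBy, h p q]
  module

theorem SuperCommute.hasWeight {A B : VertexOperator ℂ V} (h : SuperCommute 1 A B) (p : ℤ) :
    HasWeight (A[[p]]) 0 0 B := fun q => by
  rw [h p q]
  module

theorem commute_locExp {R X : Module.End ℂ V} (hR : LocallyNilpotent R) (h : Commute R X) :
    Commute (locExp R) X := by
  have := locExp_mul_of_bracket (A := X) (B := 0) hR (by rw [add_zero]; exact h) (by simp)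
  rwa [add_zero] at this

theorem mul_commute_conj {g g' X Y : Module.End ℂ V} (h : g' * g = 1) (hXY : Commute X Y) :
    Commute (g * X * g') (g * Y * g') := by
  have e : ∀ X Y : Module.End ℂ V, g * X * g' * (g * Y * g') = g * (X * Y) * g' := fun X Y => by
    rw [mul_assoc (g * X), ← mul_assoc g' (g * Y), ← mul_assoc g', h, one_mul]
    simp only [mul_assoc]
  rw [Commute, SemiconjBy, e, e, hXY]

end Operators

section Energy

variable {W Wbar : Type*} [AddCommGroup W] [Module ℂ W] [AddCommGroup Wbar] [Module ℂ Wbar]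
variable {c cbar η ηbar : ℂ} (ρ : W2Module c η W) (σ : W2Module cbar ηbar Wbar)

local notation "gc" => ghost W Wbar Ghost.c
local notation "gb" => ghost W Wbar Ghost.b
local notation "gψ" => ghost W Wbar Ghost.ψ
local notation "gχ" => ghost W Wbar Ghost.χ

/-! ### The total energy -/

/-- The zero mode `K₀` of the total Virasoro field. -/
def totalEnergy : Module.End ℂ (BRSTComplex W Wbar) := (totalVir ρ σ)[[1]]

variable (W Wbar) in
/-- The zero mode of `:∂ψ χ:`. -/
def ghostEnergy : Module.End ℂ (BRSTComplex W Wbar) := (nopOdd (deriv gψ) gχ)[[1]]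

/-- The weights `Δ - 1` of the ghost fields, `Δ` being the conformal weight. -/
def Ghost.weight : Ghost → ℂ
  | .b => 1
  | .c => -2
  | .ψ => -1
  | .χ => 0

theorem hasWeight_totalEnergy_ghost (g : Ghost) :
    HasWeight (totalEnergy ρ σ) 1 g.weight (ghost W Wbar g) := by
  have hL := fun m => (superCommute_ghost_matterVir ρ σ g).bracket m
  cases g
  · refine hasWeight_of_bracket (fun m => (hL m).add
      ((((bracket_ghost_dual .b m).deriv.nopOdd_odd
        (bracket_ghost_of_ne (by simp [Ghost.dual]) m)).smul 2).add
      ((bracket_ghost_dual .b m).nopOdd_odd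
        (bracket_ghost_of_ne (by simp [Ghost.dual]) m).deriv) |>.add
      ((bracket_ghost_of_ne (by simp [Ghost.dual]) m).deriv.nopOdd_odd
        (bracket_ghost_of_ne (by simp [Ghost.dual]) m)))) fun m => ?_
    simp only [nop, deriv_zpowField, deriv_zero, normalProd_zpowField_left,
      normalProd_zero_left, normalProd_zero_right,
      normalProd_smul_left, ncoeff_add, ncoeff_sub, ncoeff_smul,
      ncoeff_zero, shift_ncoeff, deriv_ncoeff, Ghost.weight]
    rw [show 1 + m - 1 = m by ring]
    rw [show 1 + (m - 1) = m by ring]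
    push_cast
    module
  · refine hasWeight_of_bracket (fun m => (hL m).add
      ((((bracket_ghost_of_ne (by simp [Ghost.dual]) m).deriv.nopOdd_odd
        (bracket_ghost_dual .c m)).smul 2).add
      ((bracket_ghost_of_ne (by simp [Ghost.dual]) m).nopOdd_odd
        (bracket_ghost_dual .c m).deriv) |>.add
      ((bracket_ghost_of_ne (by simp [Ghost.dual]) m).deriv.nopOdd_odd
        (bracket_ghost_of_ne (by simp [Ghost.dual]) m)))) fun m => ?_
    simp only [nop, deriv_zpowField, deriv_zero,
      normalProd_zpowField_right, normalProd_zero_left, normalProd_zero_right,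
      normalProd_smul_right, ncoeff_add, ncoeff_sub, ncoeff_smul,
      ncoeff_zero, shift_ncoeff, deriv_ncoeff, Ghost.weight]
    rw [show 1 + m - 1 = m by ring]
    rw [show 1 + (m - 1) = m by ring]
    push_cast
    module
  · refine hasWeight_of_bracket (fun m => (hL m).add
      ((((bracket_ghost_of_ne (by simp [Ghost.dual]) m).deriv.nopOdd_odd
        (bracket_ghost_of_ne (by simp [Ghost.dual]) m)).smul 2).add
      ((bracket_ghost_of_ne (by simp [Ghost.dual]) m).nopOdd_odd
        (bracket_ghost_of_ne (by simp [Ghost.dual]) m).deriv) |>.add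
      ((bracket_ghost_of_ne (by simp [Ghost.dual]) m).deriv.nopOdd_odd
        (bracket_ghost_dual .ψ m)))) fun m => ?_
    simp only [nop, deriv_zero,
      normalProd_zpowField_right, normalProd_zero_left, normalProd_zero_right,
      ncoeff_add, ncoeff_sub, ncoeff_smul,
      ncoeff_zero, shift_ncoeff, deriv_ncoeff, Ghost.weight]
    rw [show 1 + m - 1 = m by ring]
    push_cast
    module
  · refine hasWeight_of_bracket (fun m => (hL m).add
      ((((bracket_ghost_of_ne (by simp [Ghost.dual]) m).deriv.nopOdd_odd
        (bracket_ghost_of_ne (by simp [Ghost.dual]) m)).smul 2).add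
      ((bracket_ghost_of_ne (by simp [Ghost.dual]) m).nopOdd_odd
        (bracket_ghost_of_ne (by simp [Ghost.dual]) m).deriv) |>.add
      ((bracket_ghost_dual .χ m).deriv.nopOdd_odd
        (bracket_ghost_of_ne (by simp [Ghost.dual]) m)))) fun m => ?_
    simp only [nop, deriv_zpowField, deriv_zero, normalProd_zpowField_left,
      normalProd_zero_left, normalProd_zero_right,
      normalProd_smul_left, ncoeff_add, ncoeff_sub, ncoeff_smul,
      ncoeff_zero, shift_ncoeff, Ghost.weight]
    rw [show 1 + (m - 1) = m by ring]
    module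

theorem hasWeight_ghostEnergy_ψ : HasWeight (ghostEnergy W Wbar) 1 (-1) gψ := by
  refine hasWeight_of_bracket (fun m => (bracket_ghost_of_ne (by simp [Ghost.dual]) m).deriv.nopOdd_odd
    (bracket_ghost_dual .ψ m)) fun m => ?_
  simp only [nop, deriv_zero, normalProd_zero_left, normalProd_zpowField_right, ncoeff_sub,
    ncoeff_zero, shift_ncoeff, deriv_ncoeff]
  rw [show 1 + m - 1 = m by ring]
  push_cast
  module

theorem hasWeight_ghostEnergy_χ : HasWeight (ghostEnergy W Wbar) 1 0 gχ := by
  refine hasWeight_of_bracket (fun m => (bracket_ghost_dual .χ m).deriv.nopOdd_odd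
    (bracket_ghost_of_ne (by simp [Ghost.dual]) m)) fun m => ?_
  simp only [nop, deriv_zpowField, normalProd_smul_left, normalProd_zero_right,
    normalProd_zpowField_left, ncoeff_sub, ncoeff_smul, ncoeff_zero, shift_ncoeff]
  rw [show 1 + (m - 1) = m by ring]
  module

theorem hasWeight_ghostEnergy_of_superCommute {A : VertexOperator ℂ (BRSTComplex W Wbar)} {s : ℂ}
    (hs : s * s = 1) (hψ : SuperCommute s A gψ) (hχ : SuperCommute s A gχ) :
    HasWeight (ghostEnergy W Wbar) 0 0 A := by
  have h := hψ.deriv_right.normalProd_right hχ hs (-1)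
  rw [hs] at h
  exact (h.symm (by norm_num)).hasWeight 1

theorem superCommute_virM {A : VertexOperator ℂ (BRSTComplex W Wbar)}
    (h : ∀ g, SuperCommute 1 (ghost W Wbar g) A) : SuperCommute 1 A (virM W Wbar) := by
  have h' := fun g => (h g).symm (by norm_num)
  have h1 := (h' .c).deriv_right.normalProd_right (h' .b) (by norm_num) (-1)
  have h2 := (h' .c).normalProd_right (h' .b).deriv_right (by norm_num) (-1)
  have h3 := (h' .ψ).deriv_right.normalProd_right (h' .χ) (by norm_num) (-1)
  rw [one_mul] at h1 h2 h3
  exact ((h1.smul_right 2).add_right h2).add_right h3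

theorem hasWeight_totalEnergy_aField : HasWeight (totalEnergy ρ σ) 1 0 (aField ρ) := by
  refine hasWeight_of_bracket (fun m => (bracket_aField_matterVir ρ σ m).add
    ((superCommute_virM (superCommute_ghost_aField ρ)).bracket m)) fun m => ?_
  rw [add_zero, ncoeff_smul, shift_ncoeff, add_sub_cancel]
  module

theorem hasWeight_totalEnergy_abarField : HasWeight (totalEnergy ρ σ) 1 0 (abarField σ) := by
  refine hasWeight_of_bracket (fun m => (bracket_abarField_matterVir ρ σ m).add
    ((superCommute_virM (superCommute_ghost_abarField σ)).bracket m)) fun m => ?_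
  rw [add_zero, ncoeff_smul, shift_ncoeff, add_sub_cancel]
  module

theorem hasWeight_totalEnergy_aPlus : HasWeight (totalEnergy ρ σ) 1 0 (aPlus ρ σ) :=
  (hasWeight_totalEnergy_aField ρ σ).add (hasWeight_totalEnergy_abarField ρ σ)

theorem hasWeight_totalEnergy_aMinus : HasWeight (totalEnergy ρ σ) 1 0 (aMinus ρ σ) :=
  (hasWeight_totalEnergy_aField ρ σ).sub (hasWeight_totalEnergy_abarField ρ σ)

theorem hasWeight_totalEnergy_S : HasWeight (totalEnergy ρ σ) 1 1 (S ρ σ) :=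
  (((hasWeight_totalEnergy_aMinus ρ σ).normalProd (hasWeight_totalEnergy_ghost ρ σ .χ) 1).smul
    _).congr (by norm_num [Ghost.weight])

/-- The current `c S` has conformal weight one, and the residue of such a field has energy zero. -/
theorem commute_totalEnergy_R : Commute (totalEnergy ρ σ) (R ρ σ) := by
  rw [R_eq]
  exact HasWeight.commute ((hasWeight_totalEnergy_ghost ρ σ .c).normalProd
    (hasWeight_totalEnergy_S ρ σ) (-1)) (by norm_num [Ghost.weight])

theorem commute_totalEnergy_charge : Commute (totalEnergy ρ σ) (charge ρ σ) := by
  rw [charge_eq]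
  exact (hasWeight_totalEnergy_aPlus ρ σ).commute (by simp)

theorem commute_totalEnergy_ghostEnergy :
    Commute (totalEnergy ρ σ) (ghostEnergy W Wbar) :=
  HasWeight.commute ((hasWeight_totalEnergy_ghost ρ σ .ψ).deriv.normalProd
    (hasWeight_totalEnergy_ghost ρ σ .χ) (-1)) (by norm_num [Ghost.weight])

/-- The zero mode of `(1/4η) :a⁺ a⁻:`. -/
def matterEnergy : Module.End ℂ (BRSTComplex W Wbar) :=
  (1 / (4 * η)) • (nop (aPlus ρ σ) (aMinus ρ σ))[[1]]

theorem commute_totalEnergy_matterEnergy :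
    Commute (totalEnergy ρ σ) (matterEnergy ρ σ) :=
  Commute.smul_right (HasWeight.commute ((hasWeight_totalEnergy_aPlus ρ σ).normalProd
    (hasWeight_totalEnergy_aMinus ρ σ) 1) (by norm_num)) _

theorem commute_matterEnergy_ghostEnergy :
    Commute (matterEnergy ρ σ) (ghostEnergy W Wbar) := by
  have h : ∀ g, SuperCommute 1 (ghost W Wbar g) (nop (aPlus ρ σ) (aMinus ρ σ)) := fun g => by
    have := (superCommute_ghost_aPlus ρ σ g).normalProd_right
      (superCommute_ghost_aMinus ρ σ g) (by norm_num) 1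
    rwa [one_mul] at this
  have h' := fun g => (h g).symm (by norm_num)
  have k := (h' .ψ).deriv_right.normalProd_right (h' .χ) (by norm_num) (-1)
  rw [one_mul] at k
  exact Commute.smul_left (k.commute 1 1) _

/-- Conjugation respects normally ordered products, so questions about `T₀` become questions about
the untilded zero modes of `:a⁺ a⁻:` and `:∂ψ χ:`, which act on separate factors. -/
theorem T₀_eq_conj (hη : η + ηbar = 0) : T₀ ρ σ = locExp (R ρ σ) *
    (matterEnergy ρ σ + ghostEnergy W Wbar) * locExp (-R ρ σ) := by
  have h : T ρ σ = tilde ρ σ ((1 / (4 * η)) • nop (aPlus ρ σ) (aMinus ρ σ)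
      + nopOdd (deriv gψ) gχ) := by
    rw [tilde_add, tilde_smul, nop, nopOdd, tilde_normalProd ρ σ hη, tilde_normalProd ρ σ hη,
      tilde_deriv]
    rfl
  rw [T₀, zeroMode₂, h, tilde, conjField_ncoeff, ncoeff_add, ncoeff_smul]
  rfl

/-- The full ghost energy exceeds the energy `K₀ - T₀`, known to be a BRST commutator, by a
conjugate of the energy of the `(ψ, χ)` ghosts. That last term is the one requiring the positive
energy hypothesis. -/
theorem energyM_eq (hη : η + ηbar = 0) (hη0 : η ≠ 0) : energyM ρ σ =
    totalEnergy ρ σ - T₀ ρ σ + locExp (R ρ σ) * ghostEnergy W Wbar * locExp (-R ρ σ) := by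
  have h : energyM ρ σ = energyBC ρ σ + (tilde ρ σ (nopOdd (deriv gψ) gχ))[[1]] := by
    rw [energyM, energyBC, virM, tilde_add, zeroMode₂, zeroMode₂, zeroMode₂, zeroMode₂,
      ncoeff_add]
    abel
  rw [h, energyBC_eq ρ σ hη hη0, tilde, conjField_ncoeff]
  rfl

theorem commute_charge_ghost (g : Ghost) (n : ℤ) :
    Commute (charge ρ σ) ((ghost W Wbar g)[[n]]) := by
  rw [charge_eq]
  exact ((superCommute_ghost_aPlus ρ σ g).commute n 0).symm

theorem commute_charge_ghostEnergy : Commute (charge ρ σ) (ghostEnergy W Wbar) := by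
  have h := fun g => (superCommute_ghost_aPlus ρ σ g).symm (by norm_num)
  have k := (h .ψ).deriv_right.normalProd_right (h .χ) (by norm_num) (-1)
  rw [one_mul] at k
  rw [charge_eq]
  exact k.commute 0 1

theorem bracket_aPlus_aPlus (hη : η + ηbar = 0) (m : ℤ) :
    Bracket 1 ((aPlus ρ σ)[[m]]) (aPlus ρ σ) 0 := by
  obtain rfl : ηbar = -η := by linear_combination hη
  rw [aPlus, ncoeff_add]
  refine ((bracket_aField_aPlus ρ σ m).add_op (bracket_abarField_aPlus ρ σ m)).congr ?_
  module

theorem bracket_charge_aPlus (hη : η + ηbar = 0) : Bracket 1 (charge ρ σ) (aPlus ρ σ) 0 := by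
  rw [charge_eq]
  exact bracket_aPlus_aPlus ρ σ hη 0

theorem bracket_charge_aMinus (hη : η + ηbar = 0) : Bracket 1 (charge ρ σ) (aMinus ρ σ) 0 := by
  rw [charge_eq]
  refine (bracket_aPlus_aMinus ρ σ hη 0).congr ?_
  push_cast
  module

theorem commute_charge_matterEnergy (hη : η + ηbar = 0) :
    Commute (charge ρ σ) (matterEnergy ρ σ) := by
  have := (bracket_charge_aPlus ρ σ hη).normalProd_even (bracket_charge_aMinus ρ σ hη) 1 1
  rw [normalProd_zero_left, normalProd_zero_right, add_zero, ncoeff_zero, add_zero] at this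
  refine Commute.smul_right ?_ _
  rw [Commute, SemiconjBy, this]
  module

theorem commute_charge_R (hη : η + ηbar = 0) (hη0 : η ≠ 0) : Commute (R ρ σ) (charge ρ σ) := by
  have := bracket_R_aPlus ρ σ hη hη0 0
  rw [← charge_eq, deriv_ncoeff] at this
  rw [Commute, SemiconjBy, this]
  push_cast
  module

section

variable {X : Module.End ℂ (BRSTComplex W Wbar)}

theorem commute_conj_of_commute (hη : η + ηbar = 0) {Y : Module.End ℂ (BRSTComplex W Wbar)}
    (hX : Commute (R ρ σ) X) (hXY : Commute X Y) :
    Commute X (locExp (R ρ σ) * Y * locExp (-R ρ σ)) :=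
  have hR := locallyNilpotent_R ρ σ hη
  ((commute_locExp hR hX).symm.mul_right hXY).mul_right (commute_locExp hR.neg hX.neg_left).symm

theorem commute_T₀_of_commute (hη : η + ηbar = 0) (hX : Commute (R ρ σ) X)
    (h1 : Commute X (matterEnergy ρ σ)) (h2 : Commute X (ghostEnergy W Wbar)) :
    Commute X (T₀ ρ σ) := by
  rw [T₀_eq_conj ρ σ hη]
  exact commute_conj_of_commute ρ σ hη hX (h1.add_right h2)

end

theorem commute_totalEnergy_T₀ (hη : η + ηbar = 0) : Commute (totalEnergy ρ σ) (T₀ ρ σ) :=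
  commute_T₀_of_commute ρ σ hη (commute_totalEnergy_R ρ σ).symm
    (commute_totalEnergy_matterEnergy ρ σ) (commute_totalEnergy_ghostEnergy ρ σ)

theorem commute_charge_T₀ (hη : η + ηbar = 0) (hη0 : η ≠ 0) : Commute (charge ρ σ) (T₀ ρ σ) :=
  commute_T₀_of_commute ρ σ hη (commute_charge_R ρ σ hη hη0)
    (commute_charge_matterEnergy ρ σ hη) (commute_charge_ghostEnergy ρ σ)

/-- These commutations ensure that passing to the harmonic representative, through polynomials in
the three operators, preserves eigenvectors of `energyM`. -/
theorem commute_energyM (hη : η + ηbar = 0) (hη0 : η ≠ 0) :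
    Commute (energyM ρ σ) (totalEnergy ρ σ) ∧ Commute (energyM ρ σ) (charge ρ σ) ∧
      Commute (energyM ρ σ) (T₀ ρ σ) := by
  rw [energyM_eq ρ σ hη hη0]
  have h1 := (commute_totalEnergy_T₀ ρ σ hη).symm
  have h2 := commute_charge_T₀ ρ σ hη hη0
  refine ⟨((Commute.refl _).sub_left h1).add_left ?_,
    ((commute_totalEnergy_charge ρ σ).sub_left h2.symm).add_left ?_,
    (h1.symm.sub_left (Commute.refl _)).add_left ?_⟩
  · exact (commute_conj_of_commute ρ σ hη (commute_totalEnergy_R ρ σ).symm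
      (commute_totalEnergy_ghostEnergy ρ σ)).symm
  · exact (commute_conj_of_commute ρ σ hη (commute_charge_R ρ σ hη hη0)
      (commute_charge_ghostEnergy ρ σ)).symm
  · rw [T₀_eq_conj ρ σ hη]
    exact mul_commute_conj (expNegR_mul_expR ρ σ hη)
      ((commute_matterEnergy_ghostEnergy ρ σ).symm.add_right (Commute.refl _))

end Energy


section Semisimple

variable {V : Type*} [AddCommGroup V] [Module ℂ V]

/-! ### Diagonalizable operators -/

/-- A product of factors `1 - X/μ` over the nonzero eigenvalues involved annihilates all components
of `v` outside the kernel. The normalization at `0` will keep the cohomology class unchanged. -/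
theorem exists_polynomial_of_mem_iSup_eigenspace {O : Module.End ℂ V} {v : V}
    (hv : v ∈ ⨆ μ : ℂ, O.eigenspace μ) :
    ∃ p : Polynomial ℂ, p.eval 0 = 1 ∧ O (Polynomial.aeval O p v) = 0 := by
  have comm : ∀ p q : Polynomial ℂ, ∀ v, Polynomial.aeval O p (Polynomial.aeval O q v) =
      Polynomial.aeval O q (Polynomial.aeval O p v) := fun p q v => by
    rw [← Module.End.mul_apply, ← map_mul, mul_comm, map_mul, Module.End.mul_apply]
  have comm' : ∀ p : Polynomial ℂ, ∀ v, O (Polynomial.aeval O p v) = Polynomial.aeval O p (O v) :=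
    fun p v => by simpa using comm Polynomial.X p v
  refine Submodule.iSup_induction O.eigenspace (motive := fun v =>
    ∃ p : Polynomial ℂ, p.eval 0 = 1 ∧ O (Polynomial.aeval O p v) = 0) hv ?_ ?_ ?_
  · intro μ v hv
    rw [Module.End.mem_eigenspace_iff] at hv
    by_cases hμ : μ = 0
    · refine ⟨1, by simp, ?_⟩
      simp [hv, hμ]
    · refine ⟨1 - Polynomial.C μ⁻¹ * Polynomial.X, by simp, ?_⟩
      rw [comm']
      simp [hv, smul_smul, hμ, ← Algebra.smul_def]
  · exact ⟨1, by simp, by simp⟩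
  · rintro x y ⟨p, hp, hp'⟩ ⟨q, hq, hq'⟩
    refine ⟨p * q, by rw [Polynomial.eval_mul, hp, hq, one_mul], ?_⟩
    rw [map_mul, Module.End.mul_apply, map_add, map_add, map_add, comm p q x,
      comm' q (Polynomial.aeval O p x), hp', comm' p (Polynomial.aeval O q y), hq', map_zero,
      map_zero, add_zero]

theorem Commute.aeval_apply_eq_zero {O X : Module.End ℂ V} (h : Commute X O) (p : Polynomial ℂ)
    {v : V} (hv : X v = 0) : X (Polynomial.aeval O p v) = 0 := by
  have : Commute X (Polynomial.aeval O p) := by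
    induction p using Polynomial.induction_on' with
    | add p q hp hq => rw [map_add]; exact hp.add_right hq
    | monomial n a =>
      rw [Polynomial.aeval_monomial]
      exact (Algebra.commute_algebraMap_right a X).mul_right (h.pow_right n)
  rw [← Module.End.mul_apply, this, Module.End.mul_apply, hv, map_zero]

theorem aeval_mem {O : Module.End ℂ V} {p : Submodule ℂ V} (h : ∀ v ∈ p, O v ∈ p)
    (q : Polynomial ℂ) {v : V} (hv : v ∈ p) : Polynomial.aeval O q v ∈ p := by
  have hpow : ∀ n : ℕ, (O ^ n) v ∈ p := fun n => by
    induction n with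
    | zero => exact hv
    | succ n ih =>
      rw [pow_succ', Module.End.mul_apply]
      exact h _ ih
  induction q using Polynomial.induction_on' with
  | add q r hq hr => rw [map_add]; exact p.add_mem hq hr
  | monomial n a =>
    rw [Polynomial.aeval_monomial, ← Algebra.smul_def]
    exact p.smul_mem _ (hpow n)

/-- Polynomials in operators that agree on an invariant subspace agree there. -/
theorem aeval_apply_congr {O O' : Module.End ℂ V} {p : Submodule ℂ V} (h : ∀ v ∈ p, O v ∈ p)
    (hO : ∀ v ∈ p, O' v = O v) (q : Polynomial ℂ) {v : V} (hv : v ∈ p) :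
    Polynomial.aeval O' q v = Polynomial.aeval O q v := by
  have hpow : ∀ n : ℕ, (O ^ n) v ∈ p ∧ (O' ^ n) v = (O ^ n) v := fun n => by
    induction n with
    | zero => exact ⟨hv, rfl⟩
    | succ n ih =>
      rw [pow_succ', pow_succ', Module.End.mul_apply, Module.End.mul_apply, ih.2, hO _ ih.1]
      exact ⟨h _ ih.1, rfl⟩
  induction q using Polynomial.induction_on' with
  | add q r hq hr => rw [map_add, map_add, LinearMap.add_apply, LinearMap.add_apply, hq, hr]
  | monomial n a =>
    rw [Polynomial.aeval_monomial, Polynomial.aeval_monomial, ← Algebra.smul_def,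
      ← Algebra.smul_def, LinearMap.smul_apply, LinearMap.smul_apply, (hpow n).2]

theorem aeval_conj_apply {g g' O : Module.End ℂ V} (h : g' * g = 1) (hg : g * g' = 1)
    (p : Polynomial ℂ) (v : V) :
    Polynomial.aeval (g * O * g') p v = g (Polynomial.aeval O p (g' v)) := by
  have hpow : ∀ n : ℕ, (g * O * g') ^ n = g * O ^ n * g' := fun n => by
    induction n with
    | zero => rw [pow_zero, pow_zero, mul_one, hg]
    | succ n ih =>
      rw [pow_succ, ih, pow_succ, mul_assoc (g * O ^ n), mul_assoc g O g', ← mul_assoc g' g, h,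
        one_mul]
      simp only [mul_assoc]
  induction p using Polynomial.induction_on' with
  | add p q hp hq => simp only [map_add, LinearMap.add_apply, hp, hq]
  | monomial n a =>
    rw [Polynomial.aeval_monomial, Polynomial.aeval_monomial, ← Algebra.smul_def,
      ← Algebra.smul_def, hpow, LinearMap.smul_apply, LinearMap.smul_apply, map_smul]
    rfl

/-! ### Graded operators -/

theorem mem_eigenspace_of_bracket {O X : Module.End ℂ V} {r μ : ℂ} (h : O * X = X * O + r • X)
    {v : V} (hv : v ∈ O.eigenspace μ) : X v ∈ O.eigenspace (μ + r) := by
  rw [Module.End.mem_eigenspace_iff] at hv ⊢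
  have := LinearMap.congr_fun h v
  rw [Module.End.mul_apply, LinearMap.add_apply, Module.End.mul_apply, hv, map_smul,
    LinearMap.smul_apply] at this
  rw [this]
  module

theorem iSup_eigenspace_le_comap {O X : Module.End ℂ V} {r : ℂ} (h : O * X = X * O + r • X) :
    (⨆ μ : ℂ, O.eigenspace μ) ≤ (⨆ μ : ℂ, O.eigenspace μ).comap X :=
  iSup_le fun μ _ hv => le_iSup O.eigenspace (μ + r) (mem_eigenspace_of_bracket h hv)

variable (O G : Module.End ℂ V)

/-- The span of the eigenvectors of `O` in `ker G` with positive integral eigenvalues. -/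
def positivePart : Submodule ℂ V :=
  ⨆ n : ℕ, O.eigenspace ((n : ℂ) + 1) ⊓ LinearMap.ker G

/-- The span of the eigenvectors of `O` in `ker G` with nonnegative integral eigenvalues. -/
def nonnegPart : Submodule ℂ V := (LinearMap.ker O ⊓ LinearMap.ker G) ⊔ positivePart O G

/-- The span of `ker O ⊓ ker G` and the eigenvectors of `O` with positive integral eigenvalues. -/
def gradedPart : Submodule ℂ V :=
  (LinearMap.ker O ⊓ LinearMap.ker G) ⊔ ⨆ n : ℕ, O.eigenspace ((n : ℂ) + 1)

variable {O G}

theorem nonnegPart_le_gradedPart : nonnegPart O G ≤ gradedPart O G :=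
  sup_le_sup_left (iSup_mono fun _ => inf_le_left) _

theorem positivePart_le_ker : positivePart O G ≤ LinearMap.ker G := iSup_le fun _ => inf_le_right

/-- Strictly raising operators land in the strictly positive part, on which `O` can be inverted. -/
theorem nonnegPart_le_comap {X : Module.End ℂ V} {j : ℕ} (hO : O * X = X * O + ((j : ℂ) + 1) • X)
    (hG : Commute G X) : nonnegPart O G ≤ (positivePart O G).comap X := by
  have hG' : ∀ v, v ∈ LinearMap.ker G → X v ∈ LinearMap.ker G := fun v hv => by
    rw [LinearMap.mem_ker] at hv ⊢
    rw [← Module.End.mul_apply, hG, Module.End.mul_apply, hv, map_zero]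
  refine sup_le (fun v hv => ?_) (iSup_le fun n v hv => ?_)
  · refine (le_iSup (fun n : ℕ => O.eigenspace ((n : ℂ) + 1) ⊓ LinearMap.ker G) j) ⟨?_, hG' v hv.2⟩
    have := mem_eigenspace_of_bracket hO (μ := 0) (v := v) (by
      rw [Module.End.eigenspace_zero]; exact hv.1)
    rwa [zero_add] at this
  · refine (le_iSup (fun n : ℕ => O.eigenspace ((n : ℂ) + 1) ⊓ LinearMap.ker G) (n + 1 + j))
      ⟨?_, hG' v hv.2⟩
    have := mem_eigenspace_of_bracket hO hv.1
    rwa [show ((n : ℂ) + 1 + (j + 1)) = ((n + 1 + j : ℕ) : ℂ) + 1 by push_cast; ring] at this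

theorem exists_mem_positivePart {y : V} (hy : y ∈ positivePart O G) :
    ∃ z ∈ positivePart O G, O z = y := by
  refine Submodule.iSup_induction (fun n : ℕ => O.eigenspace ((n : ℂ) + 1) ⊓ LinearMap.ker G)
    (motive := fun y => ∃ z ∈ positivePart O G, O z = y) hy ?_ ⟨0, Submodule.zero_mem _, map_zero _⟩
    ?_
  · intro n y hy
    have hn : (n : ℂ) + 1 ≠ 0 := by exact_mod_cast Nat.succ_ne_zero n
    refine ⟨((n : ℂ) + 1)⁻¹ • y, Submodule.smul_mem _ _
      (le_iSup (fun n : ℕ => O.eigenspace ((n : ℂ) + 1) ⊓ LinearMap.ker G) n hy), ?_⟩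
    rw [map_smul, Module.End.mem_eigenspace_iff.1 hy.1, smul_smul, inv_mul_cancel₀ hn, one_smul]
  · rintro x y ⟨z, hz, rfl⟩ ⟨z', hz', rfl⟩
    exact ⟨z + z', Submodule.add_mem _ hz hz', map_add _ _ _⟩

/-- Solving `O z = O v` with `z` in the positive part leaves `v - z` in the common kernel. This
yields a decomposition of `v` from information on `O v` alone. -/
theorem mem_nonnegPart {v : V} (hO : O v ∈ positivePart O G) (hG : G v = 0) :
    v ∈ nonnegPart O G := by
  obtain ⟨z, hz, e⟩ := exists_mem_positivePart hO
  rw [← sub_add_cancel v z]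
  refine Submodule.add_mem _ (Submodule.mem_sup_left ⟨?_, ?_⟩) (Submodule.mem_sup_right hz)
  · change O (v - z) = 0
    rw [map_sub, e, sub_self]
  · change G (v - z) = 0
    rw [map_sub, hG, positivePart_le_ker hz, sub_zero]

/-- It is essential that `X` has the same weight for `O` and `G`: weight zero preserves the common
kernel, and a positive weight moves it to a positive eigenvalue of `O`, where nothing is required of
`G`. -/
theorem gradedPart_le_comap {X : Module.End ℂ V} {j : ℕ} (hO : O * X = X * O + (j : ℂ) • X)
    (hG : G * X = X * G + (j : ℂ) • X) : gradedPart O G ≤ (gradedPart O G).comap X := by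
  refine sup_le (fun v hv => ?_) (iSup_le fun n v hv => ?_)
  · have h0 : v ∈ O.eigenspace 0 := by
      rw [Module.End.eigenspace_zero]; exact hv.1
    have h1 := mem_eigenspace_of_bracket hO h0
    rcases j with _ | j
    · refine Submodule.mem_sup_left ⟨?_, ?_⟩
      · rwa [Nat.cast_zero, add_zero, Module.End.eigenspace_zero] at h1
      · have hv' : G v = 0 := hv.2
        have := LinearMap.congr_fun hG v
        rw [Nat.cast_zero] at this
        change G (X v) = 0
        simpa [hv'] using this
    · refine Submodule.mem_sup_right (le_iSup (fun n : ℕ => O.eigenspace ((n : ℂ) + 1)) j ?_)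
      rwa [zero_add, Nat.cast_succ] at h1
  · refine Submodule.mem_sup_right (le_iSup (fun n : ℕ => O.eigenspace ((n : ℂ) + 1)) (n + j) ?_)
    have := mem_eigenspace_of_bracket hO hv
    rwa [show ((n : ℂ) + 1 + j) = ((n + j : ℕ) : ℂ) + 1 by push_cast; ring] at this

theorem iSup_eigenspace_eq_top_of_gradedPart (h : gradedPart O G = ⊤) :
    ⨆ μ : ℂ, O.eigenspace μ = ⊤ := by
  rw [eq_top_iff, ← h]
  refine sup_le (fun v hv => le_iSup O.eigenspace 0 ?_)
    (iSup_le fun n => le_iSup O.eigenspace ((n : ℂ) + 1))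
  rw [Module.End.eigenspace_zero]
  exact hv.1

/-- Eigenspaces are independent, so a vector of `ker O` has no component at positive eigenvalues and
lies in the common kernel. -/
theorem ker_le_ker_of_gradedPart (h : gradedPart O G = ⊤) : LinearMap.ker O ≤ LinearMap.ker G := by
  intro v hv
  have hv' : v ∈ gradedPart O G := h ▸ Submodule.mem_top
  obtain ⟨x, hx, y, hy, rfl⟩ := Submodule.mem_sup.1 hv'
  have h1 : y ∈ O.eigenspace 0 := by
    rw [Module.End.eigenspace_zero]
    have := Submodule.sub_mem _ hv hx.1
    rwa [add_sub_cancel_left] at this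
  have h2 : y ∈ ⨆ (μ : ℂ) (_ : μ ≠ 0), O.eigenspace μ := by
    refine (iSup_le fun n => ?_ : (⨆ n : ℕ, O.eigenspace ((n : ℂ) + 1)) ≤ _) hy
    exact le_iSup₂_of_le ((n : ℂ) + 1) (by exact_mod_cast Nat.succ_ne_zero n) le_rfl
  have h3 : y = 0 := Submodule.disjoint_def.1 (O.eigenspaces_iSupIndep 0) y h1 h2
  rw [h3, add_zero]
  exact hx.2

end Semisimple


/-! ### Further rules for weights of operators. -/

section Operators

variable {V : Type*} [AddCommGroup V] [Module ℂ V]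

theorem HasWeight.smul_op {X : Module.End ℂ V} {κ α : ℂ} {A : VertexOperator ℂ V}
    (h : HasWeight X κ α A) (r : ℂ) : HasWeight (r • X) (r * κ) (r * α) A := fun n => by
  rw [smul_mul_assoc, mul_smul_comm, h n]
  module

theorem hasWeight_zero_of_commute {X : Module.End ℂ V} {A : VertexOperator ℂ V}
    (h : ∀ n, Commute X (A[[n]])) : HasWeight X 0 0 A := fun n => by
  rw [h n]
  module

end Operators

section Diagonalization

variable {W Wbar : Type*} [AddCommGroup W] [Module ℂ W] [AddCommGroup Wbar] [Module ℂ Wbar]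
variable {c cbar η ηbar : ℂ} (ρ : W2Module c η W) (σ : W2Module cbar ηbar Wbar)

local notation "gc" => ghost W Wbar Ghost.c
local notation "gb" => ghost W Wbar Ghost.b
local notation "gψ" => ghost W Wbar Ghost.ψ
local notation "gχ" => ghost W Wbar Ghost.χ

/-! ### Diagonalizability on the complex -/

theorem vacTensor_mem_of_eigenvectors {p : Submodule ℂ (BRSTComplex W Wbar)}
    {f : Module.End ℂ W} {g : Module.End ℂ Wbar} (hf : ⨆ μ : ℂ, f.eigenspace μ = ⊤)
    (hg : ⨆ μ : ℂ, g.eigenspace μ = ⊤)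
    (h : ∀ μ ν : ℂ, ∀ w ∈ f.eigenspace μ, ∀ wbar ∈ g.eigenspace ν, vacTensor w wbar ∈ p)
    (w : W) (wbar : Wbar) : vacTensor w wbar ∈ p := by
  have hw : w ∈ ⨆ μ : ℂ, f.eigenspace μ := hf ▸ Submodule.mem_top
  have hwbar : wbar ∈ ⨆ μ : ℂ, g.eigenspace μ := hg ▸ Submodule.mem_top
  refine Submodule.iSup_induction f.eigenspace (motive := fun w => vacTensor w wbar ∈ p) hw
    (fun μ w hw => ?_) ?_ fun x y hx hy => ?_
  · refine Submodule.iSup_induction g.eigenspace (motive := fun wbar => vacTensor w wbar ∈ p) hwbar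
      (fun ν wbar hwbar => h μ ν w hw wbar hwbar) ?_ fun x y hx hy => ?_
    · rw [vacTensor, TensorProduct.zero_tmul, TensorProduct.tmul_zero]
      exact p.zero_mem
    · rw [vacTensor, TensorProduct.add_tmul, TensorProduct.tmul_add]
      exact p.add_mem hx hy
  · rw [vacTensor, TensorProduct.zero_tmul]
    exact p.zero_mem
  · rw [vacTensor, TensorProduct.add_tmul]
    exact p.add_mem hx hy

/-- A subspace that contains all `w ⊗ w̄ ⊗ 𝟏` and is stable under the ghost creation operators is
the whole complex. -/
theorem eq_top_of_creation {p : Submodule ℂ (BRSTComplex W Wbar)}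
    (vac : ∀ w wbar, vacTensor w wbar ∈ p)
    (h : ∀ (g : Ghost) (j : ℕ), ∀ x ∈ p, ((ghost W Wbar g)[[-(j : ℤ) - 1]]) x ∈ p) : p = ⊤ :=
  Submodule.eq_top_iff'.2 (creation_induction p.zero_mem (fun _ _ => p.add_mem)
    (fun r _ => p.smul_mem r) vac h)

/-- Tensor products of eigenvectors with the ghost vacuum are eigenvectors, and each ghost creation
mode shifts eigenvalues by a constant. -/
theorem iSup_eigenspace_eq_top {X : Module.End ℂ (BRSTComplex W Wbar)}
    {f : Module.End ℂ W} {g : Module.End ℂ Wbar} (hf : ⨆ μ : ℂ, f.eigenspace μ = ⊤)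
    (hg : ⨆ μ : ℂ, g.eigenspace μ = ⊤)
    (hX : ∀ w wbar, X (vacTensor w wbar) = vacTensor (f w) wbar + vacTensor w (g wbar))
    {κ : ℂ} {α : Ghost → ℂ} (h : ∀ i, HasWeight X κ (α i) (ghost W Wbar i)) :
    ⨆ μ : ℂ, X.eigenspace μ = ⊤ := by
  refine eq_top_of_creation (vacTensor_mem_of_eigenvectors hf hg fun μ ν w hw wbar hwbar =>
    le_iSup X.eigenspace (μ + ν) ?_) fun i j x hx => iSup_eigenspace_le_comap (h i _) hx
  rw [Module.End.mem_eigenspace_iff] at hw hwbar ⊢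
  rw [hX, hw, hwbar, vacTensor, vacTensor, vacTensor, ← TensorProduct.smul_tmul',
    ← TensorProduct.smul_tmul', TensorProduct.tmul_smul, add_smul]

theorem aPlus_vacTensor (n : ℤ) (w : W) (wbar : Wbar) : ((aPlus ρ σ)[[n]]) (vacTensor w wbar) =
    vacTensor (ρ.a n w) wbar + vacTensor w (σ.a n wbar) := by
  rw [aPlus, ncoeff_add, aField_ncoeff, abarField_ncoeff]
  rfl

theorem aMinus_vacTensor (n : ℤ) (w : W) (wbar : Wbar) : ((aMinus ρ σ)[[n]]) (vacTensor w wbar) =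
    vacTensor (ρ.a n w) wbar - vacTensor w (σ.a n wbar) := by
  rw [aMinus, ncoeff_sub, aField_ncoeff, abarField_ncoeff]
  rfl

theorem iSup_eigenspace_charge (hρ : ⨆ μ : ℂ, (ρ.a 0).eigenspace μ = ⊤)
    (hσ : ⨆ μ : ℂ, (σ.a 0).eigenspace μ = ⊤) : ⨆ μ : ℂ, (charge ρ σ).eigenspace μ = ⊤ := by
  refine iSup_eigenspace_eq_top (κ := 0) (α := fun _ => 0) hρ hσ (fun w wbar => ?_) fun g =>
    hasWeight_zero_of_commute fun n => commute_charge_ghost ρ σ g n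
  rw [charge_eq, aPlus_vacTensor]

theorem ghostEnergy_vacTensor (w : W) (wbar : Wbar) :
    ghostEnergy W Wbar (vacTensor w wbar) = 0 :=
  ((annihilates_ghost .ψ w wbar).deriv.normalProd (annihilates_ghost .χ w wbar) (-1)) 1 zero_le_one

theorem totalEnergy_vacTensor (w : W) (wbar : Wbar) : totalEnergy ρ σ (vacTensor w wbar) =
    vacTensor (ρ.L 0 w) wbar + vacTensor w (σ.L 0 wbar) := by
  have h := fun g => annihilates_ghost (W := W) (Wbar := Wbar) g w wbar
  have hM : ((virM W Wbar)[[1]]) (vacTensor w wbar) = 0 :=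
    (((((h .c).deriv.normalProd (h .b) (-1)).smul 2).add
      ((h .c).normalProd (h .b).deriv (-1))).add
      ((h .ψ).deriv.normalProd (h .χ) (-1))) 1 zero_le_one
  rw [totalEnergy, totalVir, ncoeff_add, LinearMap.add_apply, hM, add_zero, matterVir, ncoeff_add,
    calL_ncoeff, calLbar_ncoeff]
  rfl

theorem iSup_eigenspace_totalEnergy (hρ : ⨆ μ : ℂ, (ρ.L 0).eigenspace μ = ⊤)
    (hσ : ⨆ μ : ℂ, (σ.L 0).eigenspace μ = ⊤) : ⨆ μ : ℂ, (totalEnergy ρ σ).eigenspace μ = ⊤ :=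
  iSup_eigenspace_eq_top hρ hσ (totalEnergy_vacTensor ρ σ) (hasWeight_totalEnergy_ghost ρ σ)

/-! ### The oscillator part of `T₀` -/

/-- The operator `(1/4η) ∑_{j ≥ 1} (a⁺₋ⱼ a⁻ⱼ + a⁻₋ⱼ a⁺ⱼ)`. -/
def oscillatorEnergy : Module.End ℂ (BRSTComplex W Wbar) :=
  matterEnergy ρ σ + (-(1 / (4 * η))) • ((aMinus ρ σ)[[0]] * charge ρ σ)

theorem bracket_aMinus_aPlus (hη : η + ηbar = 0) (m : ℤ) : Bracket 1 ((aMinus ρ σ)[[m]])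
    (aPlus ρ σ) ((4 * η * m) • zpowField _ (m - 1)) := fun n => by
  have := bracket_aPlus_aMinus ρ σ hη n m
  rw [ncoeff_smul, zpowField_ncoeff] at this ⊢
  rw [this]
  by_cases h : m + n = 0
  · obtain rfl : m = -n := by omega
    rw [if_pos (by omega), if_pos (by omega)]
    push_cast
    module
  · rw [if_neg (by omega), if_neg (by omega)]
    module

theorem commute_zeroModes_aPlus (hη : η + ηbar = 0) (n : ℤ) :
    Commute ((aMinus ρ σ)[[0]] * charge ρ σ) ((aPlus ρ σ)[[n]]) := by
  refine Commute.mul_left ?_ ?_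
  · have := bracket_aMinus_aPlus ρ σ hη 0 n
    rw [Commute, SemiconjBy, this, Int.cast_zero, mul_zero, ncoeff_smul]
    module
  · have := bracket_charge_aPlus ρ σ hη n
    rw [Commute, SemiconjBy, this, ncoeff_zero]
    module

theorem commute_zeroModes_aMinus (hη : η + ηbar = 0) (n : ℤ) :
    Commute ((aMinus ρ σ)[[0]] * charge ρ σ) ((aMinus ρ σ)[[n]]) := by
  refine Commute.mul_left ((superCommute_aMinus_aMinus ρ σ hη).commute 0 n) ?_
  have := bracket_charge_aMinus ρ σ hη n
  rw [Commute, SemiconjBy, this, ncoeff_zero]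
  module

theorem hasWeight_matterEnergy_aPlus (hη : η + ηbar = 0) (hη0 : η ≠ 0) :
    HasWeight (matterEnergy ρ σ) 1 0 (aPlus ρ σ) := by
  have h : HasWeight ((nop (aPlus ρ σ) (aMinus ρ σ))[[1]]) (4 * η) 0 (aPlus ρ σ) := by
    refine hasWeight_of_bracket (fun m => (bracket_aPlus_aPlus ρ σ hη m).normalProd_even
      (bracket_aPlus_aMinus ρ σ hη m) 1) fun m => ?_
    rw [normalProd_zero_left, zero_add, normalProd_smul_right, normalProd_zpowField_right,
      ncoeff_smul, shift_ncoeff, add_sub_cancel]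
    module
  have := h.smul_op (1 / (4 * η))
  rwa [show 1 / (4 * η) * (4 * η) = 1 by field_simp, mul_zero] at this

theorem hasWeight_matterEnergy_aMinus (hη : η + ηbar = 0) (hη0 : η ≠ 0) :
    HasWeight (matterEnergy ρ σ) 1 0 (aMinus ρ σ) := by
  have h : HasWeight ((nop (aPlus ρ σ) (aMinus ρ σ))[[1]]) (4 * η) 0 (aMinus ρ σ) := by
    refine hasWeight_of_bracket (fun m => (bracket_aMinus_aPlus ρ σ hη m).normalProd_even
      ((superCommute_aMinus_aMinus ρ σ hη).bracket m) 1) fun m => ?_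
    rw [normalProd_zero_right, add_zero, normalProd_smul_left, normalProd_zpowField_left,
      ncoeff_smul, shift_ncoeff, add_sub_cancel]
    module
  have := h.smul_op (1 / (4 * η))
  rwa [show 1 / (4 * η) * (4 * η) = 1 by field_simp, mul_zero] at this

theorem hasWeight_oscillatorEnergy_ghost (g : Ghost) :
    HasWeight (oscillatorEnergy ρ σ) 0 0 (ghost W Wbar g) := by
  have h := (superCommute_ghost_aPlus ρ σ g).normalProd_right
    (superCommute_ghost_aMinus ρ σ g) (by norm_num) 1
  rw [one_mul] at h
  refine hasWeight_zero_of_commute fun n => Commute.add_left (Commute.smul_left (h.commute n 1).symm _)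
    (Commute.smul_left (Commute.mul_left ?_ (commute_charge_ghost ρ σ g n)) _)
  exact ((superCommute_ghost_aMinus ρ σ g).commute n 0).symm

/-- The operator that agrees with `e^{-R} T₀ e^R` on the kernel of `a₀ + ā₀`. -/
def relativeEnergy : Module.End ℂ (BRSTComplex W Wbar) :=
  ghostEnergy W Wbar + oscillatorEnergy ρ σ

theorem hasWeight_relativeEnergy_aPlus (hη : η + ηbar = 0) (hη0 : η ≠ 0) :
    HasWeight (relativeEnergy ρ σ) 1 0 (aPlus ρ σ) := by
  have h := fun g => (superCommute_ghost_aPlus ρ σ g).symm (by norm_num)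
  have := (hasWeight_ghostEnergy_of_superCommute (by norm_num) (h .ψ) (h .χ)).add_op
    ((hasWeight_matterEnergy_aPlus ρ σ hη hη0).add_op
    ((hasWeight_zero_of_commute (commute_zeroModes_aPlus ρ σ hη)).smul_op (-(1 / (4 * η)))))
  simp only [mul_zero, add_zero, zero_add] at this
  exact this

theorem hasWeight_relativeEnergy_aMinus (hη : η + ηbar = 0) (hη0 : η ≠ 0) :
    HasWeight (relativeEnergy ρ σ) 1 0 (aMinus ρ σ) := by
  have h := fun g => (superCommute_ghost_aMinus ρ σ g).symm (by norm_num)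
  have := (hasWeight_ghostEnergy_of_superCommute (by norm_num) (h .ψ) (h .χ)).add_op
    ((hasWeight_matterEnergy_aMinus ρ σ hη hη0).add_op
    ((hasWeight_zero_of_commute (commute_zeroModes_aMinus ρ σ hη)).smul_op (-(1 / (4 * η)))))
  simp only [mul_zero, add_zero, zero_add] at this
  exact this

theorem commute_ghostEnergy_of_superCommute {A : VertexOperator ℂ (BRSTComplex W Wbar)}
    (h : ∀ g, SuperCommute 1 (ghost W Wbar g) A) (n : ℤ) :
    Commute (ghostEnergy W Wbar) (A[[n]]) :=
  (hasWeight_ghostEnergy_of_superCommute (s := 1) (by norm_num) ((h .ψ).symm (by norm_num))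
    ((h .χ).symm (by norm_num))).commute (by simp)

/-- Each ghost creation operator has a nonnegative integral weight for `:∂ψ χ:` and for the relative
energy. -/
theorem exists_weight_creation (g : Ghost) (j : ℕ) : ∃ m : ℕ,
    ghostEnergy W Wbar * (ghost W Wbar g)[[-(j : ℤ) - 1]] =
      (ghost W Wbar g)[[-(j : ℤ) - 1]] * ghostEnergy W Wbar
        + (m : ℂ) • (ghost W Wbar g)[[-(j : ℤ) - 1]] ∧
    relativeEnergy ρ σ * (ghost W Wbar g)[[-(j : ℤ) - 1]] =
      (ghost W Wbar g)[[-(j : ℤ) - 1]] * relativeEnergy ρ σ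
        + (m : ℂ) • (ghost W Wbar g)[[-(j : ℤ) - 1]] := by
  obtain ⟨κ, α, h, m, hm⟩ : ∃ κ α, HasWeight (ghostEnergy W Wbar) κ α (ghost W Wbar g) ∧
      ∃ m : ℕ, α - κ * ((-(j : ℤ) - 1 : ℤ) : ℂ) = m := by
    cases g
    · exact ⟨0, 0, hasWeight_ghostEnergy_of_superCommute (s := -1) (by norm_num)
        (superCommute_ghost (by simp [Ghost.dual])) (superCommute_ghost (by simp [Ghost.dual])),
        0, by simp⟩
    · exact ⟨0, 0, hasWeight_ghostEnergy_of_superCommute (s := -1) (by norm_num)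
        (superCommute_ghost (by simp [Ghost.dual])) (superCommute_ghost (by simp [Ghost.dual])),
        0, by simp⟩
    · exact ⟨1, -1, hasWeight_ghostEnergy_ψ, j, by push_cast; ring⟩
    · exact ⟨1, 0, hasWeight_ghostEnergy_χ, j + 1, by push_cast; ring⟩
  refine ⟨m, ?_, ?_⟩
  · rw [h, hm]
  · have := h.add_op (hasWeight_oscillatorEnergy_ghost ρ σ g)
    rw [add_zero, add_zero] at this
    rw [relativeEnergy, this, hm]

/-- In the sum for the zero mode of `:a⁺ a⁻:`, the summand with both indices zero is `a⁻₀ (a₀ +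
ā₀)`, which the definition of `oscillatorEnergy` subtracts. Every remaining summand is a lowering
mode followed by a raising mode. -/
theorem oscillatorEnergy_apply_mem {p : Submodule ℂ (BRSTComplex W Wbar)}
    {v : BRSTComplex W Wbar}
    (h1 : ∀ j : ℤ, 0 < j → ((aPlus ρ σ)[[-j]]) (((aMinus ρ σ)[[j]]) v) ∈ p)
    (h2 : ∀ j : ℤ, 0 < j → ((aMinus ρ σ)[[-j]]) (((aPlus ρ σ)[[j]]) v) ∈ p) :
    oscillatorEnergy ρ σ v ∈ p := by
  set f := fun q => ordTerm 1 (aPlus ρ σ) (aMinus ρ σ) 1 q v with hf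
  have hfin : Function.HasFiniteSupport f := ordTerm_finite _ _ _ _ _
  have hg : ∑ᶠ q : ℤ, (if q = 0 then f 0 else 0) = f 0 := by
    rw [finsum_eq_single _ 0 fun q hq => if_neg hq, if_pos rfl]
  have hgfin : Function.HasFiniteSupport fun q : ℤ => (if q = 0 then f 0 else 0) :=
    (Set.finite_singleton 0).subset fun q hq => by
      by_contra h
      exact hq (if_neg h)
  have h0 : f 0 = ((aMinus ρ σ)[[0]]) (charge ρ σ v) := by
    simp only [hf, ordTerm, lt_irrefl, if_false, one_smul, charge_eq]
    rfl
  have e : oscillatorEnergy ρ σ v =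
      (1 / (4 * η)) • ∑ᶠ q : ℤ, (f q - if q = 0 then f 0 else 0) := by
    rw [finsum_sub_distrib hfin hgfin, hg, hf, ← normalProd_apply, ← hf, h0, oscillatorEnergy,
      LinearMap.add_apply, matterEnergy, LinearMap.smul_apply, LinearMap.smul_apply,
      Module.End.mul_apply]
    module
  rw [e]
  refine p.smul_mem _ (finsum_induction (· ∈ p) p.zero_mem (fun _ _ => p.add_mem) fun q => ?_)
  rcases lt_trichotomy q 0 with hq | rfl | hq
  · rw [if_neg hq.ne, sub_zero]
    simp only [hf, ordTerm, if_pos hq]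
    have := h1 (-q) (by omega)
    rwa [neg_neg, show -q = 1 - 1 - q by ring] at this
  · rw [if_pos rfl, sub_self]
    exact p.zero_mem
  · rw [if_neg hq.ne', sub_zero]
    simp only [hf, ordTerm, if_neg hq.not_gt, one_smul]
    have := h2 q hq
    rwa [show -q = 1 - 1 - q by ring] at this

theorem W2Module.a_mem_eigenspace {μ : ℂ} {w : W} (hw : w ∈ (ρ.L 0).eigenspace μ) (j : ℤ) :
    ρ.a j w ∈ (ρ.L 0).eigenspace (μ - j) := by
  refine mem_eigenspace_of_bracket (r := -(j : ℂ)) ?_ hw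
  have := ρ.L_a 0 j
  rw [zero_add, Ring.lie_def] at this
  exact eq_add_of_sub_eq' this

/-- The induction is on the energy above the lower bound `B + Bbar`. The oscillator energy first
lowers the energy by at least one, where the induction hypothesis applies, and then raises the
relative energy strictly. Thus its diagonalizability is obtained without diagonalizing the
individual oscillators. -/
theorem vacTensor_mem_nonnegPart (hη : η + ηbar = 0) (hη0 : η ≠ 0) {B Bbar : ℝ}
    (hB : ∀ μ : ℂ, (ρ.L 0).HasEigenvalue μ → B ≤ μ.re)
    (hBbar : ∀ μ : ℂ, (σ.L 0).HasEigenvalue μ → Bbar ≤ μ.re) (n : ℕ) :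
    ∀ μ ν : ℂ, μ.re + ν.re < B + Bbar + n → ∀ w ∈ (ρ.L 0).eigenspace μ,
      ∀ wbar ∈ (σ.L 0).eigenspace ν,
        vacTensor w wbar ∈ nonnegPart (relativeEnergy ρ σ) (ghostEnergy W Wbar) := by
  induction n with
  | zero =>
    intro μ ν hμν w hw wbar hwbar
    -- Two nonzero eigenvectors would give real parts adding up to at least `B + Bbar`, so below the
    -- bound there is nothing to prove.
    have : w = 0 ∨ wbar = 0 := by
      by_contra! h
      have h1 := hB μ (Module.End.hasEigenvalue_of_hasEigenvector ⟨hw, h.1⟩)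
      have h2 := hBbar ν (Module.End.hasEigenvalue_of_hasEigenvector ⟨hwbar, h.2⟩)
      rw [Nat.cast_zero] at hμν
      linarith
    rcases this with rfl | rfl
    · rw [vacTensor, TensorProduct.zero_tmul]
      exact Submodule.zero_mem _
    · rw [vacTensor, TensorProduct.zero_tmul, TensorProduct.tmul_zero]
      exact Submodule.zero_mem _
  | succ n ih =>
    intro μ ν hμν w hw wbar hwbar
    have lower : ∀ j : ℤ, 0 < j →
        vacTensor (ρ.a j w) wbar ∈ nonnegPart (relativeEnergy ρ σ) (ghostEnergy W Wbar) ∧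
        vacTensor w (σ.a j wbar) ∈ nonnegPart (relativeEnergy ρ σ) (ghostEnergy W Wbar) := by
      intro j hj
      have hj' : (1 : ℝ) ≤ j := by exact_mod_cast hj
      push_cast at hμν
      refine ⟨ih (μ - j) ν ?_ _ (ρ.a_mem_eigenspace hw j) _ hwbar,
        ih μ (ν - j) ?_ _ hw _ (σ.a_mem_eigenspace hwbar j)⟩
      · rw [Complex.sub_re, Complex.intCast_re]
        linarith
      · rw [Complex.sub_re, Complex.intCast_re]
        linarith
    have raise : ∀ {A : VertexOperator ℂ (BRSTComplex W Wbar)},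
        HasWeight (relativeEnergy ρ σ) 1 0 A → (∀ n, Commute (ghostEnergy W Wbar) (A[[n]])) →
        ∀ j : ℤ, 0 < j → ∀ v ∈ nonnegPart (relativeEnergy ρ σ) (ghostEnergy W Wbar),
          (A[[-j]]) v ∈ positivePart (relativeEnergy ρ σ) (ghostEnergy W Wbar) := by
      intro A hA hA' j hj v hv
      obtain ⟨i, rfl⟩ : ∃ i : ℕ, j = i + 1 := ⟨(j - 1).toNat, by omega⟩
      refine nonnegPart_le_comap (j := i) ?_ (hA' _) hv
      rw [hA]
      push_cast
      congr 2
      ring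
    -- The vector lies in the kernel of the ghost energy, so only its image under the oscillator
    -- part has to be placed in the positive part.
    refine mem_nonnegPart ?_ (ghostEnergy_vacTensor w wbar)
    rw [relativeEnergy, LinearMap.add_apply, ghostEnergy_vacTensor, zero_add]
    refine oscillatorEnergy_apply_mem ρ σ (fun j hj => ?_) fun j hj => ?_
    · refine raise (hasWeight_relativeEnergy_aPlus ρ σ hη hη0)
        (commute_ghostEnergy_of_superCommute (superCommute_ghost_aPlus ρ σ)) j hj _ ?_
      rw [aMinus_vacTensor]
      exact Submodule.sub_mem _ (lower j hj).1 (lower j hj).2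
    · refine raise (hasWeight_relativeEnergy_aMinus ρ σ hη hη0)
        (commute_ghostEnergy_of_superCommute (superCommute_ghost_aMinus ρ σ)) j hj _ ?_
      rw [aPlus_vacTensor]
      exact Submodule.add_mem _ (lower j hj).1 (lower j hj).2

/-- For `w ⊗ w̄ ⊗ 𝟏` the ghost energy is zero and the oscillators supply nonnegative eigenvalues;
each ghost creation mode then raises the ghost energy and the relative energy by the same
nonnegative integer. -/
theorem gradedPart_eq_top (hη : η + ηbar = 0) (hη0 : η ≠ 0) (hρ : ρ.IsPositiveEnergy)
    (hσ : σ.IsPositiveEnergy) :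
    gradedPart (relativeEnergy ρ σ) (ghostEnergy W Wbar) = ⊤ := by
  obtain ⟨h1, -, B, hB⟩ := hρ
  obtain ⟨h2, -, Bbar, hBbar⟩ := hσ
  refine eq_top_of_creation (vacTensor_mem_of_eigenvectors h1 h2 fun μ ν w hw wbar hwbar => ?_)
    fun g j x hx => ?_
  · obtain ⟨n, hn⟩ := exists_nat_gt (μ.re + ν.re - B - Bbar)
    exact nonnegPart_le_gradedPart
      (vacTensor_mem_nonnegPart ρ σ hη hη0 hB hBbar n μ ν (by linarith) w hw wbar hwbar)
  · obtain ⟨m, hG, hO⟩ := exists_weight_creation ρ σ g j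
    exact gradedPart_le_comap hO hG hx

end Diagonalization


section Representatives

variable {W Wbar : Type*} [AddCommGroup W] [Module ℂ W] [AddCommGroup Wbar] [Module ℂ Wbar]
variable {c cbar η ηbar : ℂ} (ρ : W2Module c η W) (σ : W2Module cbar ηbar Wbar)

/-! ### Harmonic representatives -/

theorem KillsCohomology.add {O O' : Module.End ℂ (BRSTComplex W Wbar)}
    (h : KillsCohomology ρ σ O) (h' : KillsCohomology ρ σ O') : KillsCohomology ρ σ (O + O') := by
  refine ⟨h.1.add_right h'.1, fun k Φ => ?_⟩
  obtain ⟨h1, h2⟩ := h.2 k Φ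
  obtain ⟨h1', h2'⟩ := h'.2 k Φ
  rw [cls_eq_zero_iff] at h2 h2'
  refine ⟨Submodule.add_mem _ h1 h1', ?_⟩
  rw [cls_eq_zero_iff]
  exact Submodule.add_mem _ h2 h2'

/-- `K₀` is the sum of two operators already known to kill cohomology, `energyBC` and `T₀`. Unlike
`energyBC` it is visibly diagonalizable, so it takes its place in the construction of
representatives. -/
theorem killsCohomology_totalEnergy (hc : c + cbar = 28) (hη : η + ηbar = 0) (hη0 : η ≠ 0) :
    KillsCohomology ρ σ (totalEnergy ρ σ) := by
  have := (killsCohomology_energyBC ρ σ hc hη hη0).add ρ σ (killsCohomology_T₀ ρ σ hc hη hη0)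
  rw [energyBC_eq ρ σ hη hη0] at this
  change KillsCohomology ρ σ (totalEnergy ρ σ - T₀ ρ σ + T₀ ρ σ) at this
  rwa [sub_add_cancel] at this

/-- Since `p(0) = 1`, the difference `p(O) - 1` is `O` times a polynomial in `O`, and `O` turns
cycles into boundaries. -/
theorem KillsCohomology.exists_aeval {O : Module.End ℂ (BRSTComplex W Wbar)}
    (h : KillsCohomology ρ σ O) {k : ℤ} (Φ : cycles ρ σ k) {p : Polynomial ℂ}
    (hp : p.eval 0 = 1) : ∃ Ψ : cycles ρ σ k, cls ρ σ k Ψ = cls ρ σ k Φ ∧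
      (Ψ : BRSTComplex W Wbar) = Polynomial.aeval O p (Φ : BRSTComplex W Wbar) := by
  have hO : ∀ v ∈ cycles ρ σ k, O v ∈ cycles ρ σ k := fun v hv => (h.2 k ⟨v, hv⟩).1
  refine ⟨⟨_, aeval_mem hO p Φ.2⟩, ?_, rfl⟩
  rw [← sub_eq_zero, ← map_sub, cls_eq_zero_iff]
  have e : Polynomial.aeval O p (Φ : BRSTComplex W Wbar) - Φ =
      O (Polynomial.aeval O p.divX (Φ : BRSTComplex W Wbar)) := by
    conv_lhs => rw [← Polynomial.divX_mul_X_add p, Polynomial.coeff_zero_eq_eval_zero, hp]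
    rw [mul_comm, map_add, map_mul, Polynomial.aeval_X, map_one, map_one, LinearMap.add_apply,
      Module.End.mul_apply, Module.End.one_apply, add_sub_cancel_right]
  obtain ⟨h1, h2⟩ := h.2 k ⟨_, aeval_mem hO p.divX Φ.2⟩
  rw [cls_eq_zero_iff] at h2
  change Polynomial.aeval O p (Φ : BRSTComplex W Wbar) - Φ ∈ boundaries ρ σ k
  rw [e]
  exact h2

/-- The two operators differ by a multiple of `a⁻₀ (a₀ + ā₀)`, which vanishes here. -/
theorem relativeEnergy_apply {v : BRSTComplex W Wbar} (hv : charge ρ σ v = 0) :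
    relativeEnergy ρ σ v = (matterEnergy ρ σ + ghostEnergy W Wbar) v := by
  simp only [relativeEnergy, oscillatorEnergy, LinearMap.add_apply, LinearMap.smul_apply,
    Module.End.mul_apply, hv, map_zero, smul_zero, add_zero]
  rw [add_comm]

theorem charge_expNegR (hη : η + ηbar = 0) (hη0 : η ≠ 0) {v : BRSTComplex W Wbar}
    (hv : charge ρ σ v = 0) : charge ρ σ (locExp (-R ρ σ) v) = 0 := by
  have h := commute_locExp (locallyNilpotent_R ρ σ hη).neg (commute_charge_R ρ σ hη hη0).neg_left
  rw [← Module.End.mul_apply, ← h, Module.End.mul_apply, hv, map_zero]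

theorem matterEnergy_add_ghostEnergy_mem_ker (hη : η + ηbar = 0) {v : BRSTComplex W Wbar}
    (hv : v ∈ LinearMap.ker (charge ρ σ)) :
    (matterEnergy ρ σ + ghostEnergy W Wbar) v ∈ LinearMap.ker (charge ρ σ) := by
  have h := (commute_charge_matterEnergy ρ σ hη).add_right (commute_charge_ghostEnergy ρ σ)
  rw [LinearMap.mem_ker] at hv ⊢
  rw [← Module.End.mul_apply, h, Module.End.mul_apply, hv, map_zero]

/-- On the kernel of `a₀ + ā₀`, which is invariant under all the operators involved, `T₀` is the
conjugate by `e^R` of `relativeEnergy`. The latter is diagonalizable on the whole complex, so its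
polynomial can be transported. -/
theorem exists_polynomial_T₀ (hη : η + ηbar = 0) (hη0 : η ≠ 0) (hρ : ρ.IsPositiveEnergy)
    (hσ : σ.IsPositiveEnergy) {v : BRSTComplex W Wbar} (hv : charge ρ σ v = 0) :
    ∃ p : Polynomial ℂ, p.eval 0 = 1 ∧ T₀ ρ σ (Polynomial.aeval (T₀ ρ σ) p v) = 0 := by
  have htop := iSup_eigenspace_eq_top_of_gradedPart (gradedPart_eq_top ρ σ hη hη0 hρ hσ)
  obtain ⟨p, hp, hp'⟩ := exists_polynomial_of_mem_iSup_eigenspace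
    (v := locExp (-R ρ σ) v) (htop ▸ Submodule.mem_top)
  refine ⟨p, hp, ?_⟩
  have e : ∀ q : Polynomial ℂ, Polynomial.aeval (T₀ ρ σ) q v =
      locExp (R ρ σ) (Polynomial.aeval (relativeEnergy ρ σ) q (locExp (-R ρ σ) v)) := fun q => by
    rw [T₀_eq_conj ρ σ hη, aeval_conj_apply (expNegR_mul_expR ρ σ hη) (expR_mul_expNegR ρ σ hη),
      aeval_apply_congr (O' := relativeEnergy ρ σ) (p := LinearMap.ker (charge ρ σ))
        (fun v hv => matterEnergy_add_ghostEnergy_mem_ker ρ σ hη hv)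
        (fun v hv => relativeEnergy_apply ρ σ hv) q (charge_expNegR ρ σ hη hη0 hv)]
  have e' := e (Polynomial.X * p)
  rw [map_mul, map_mul, Polynomial.aeval_X, Polynomial.aeval_X, Module.End.mul_apply,
    Module.End.mul_apply, hp', map_zero] at e'
  exact e'

/-- After conjugation by `e^{-R}` the vector is in the kernel of `relativeEnergy`. Nonnegativity of
the oscillator and ghost contributions then forces the ghost energy to vanish by itself. -/
theorem conj_ghostEnergy_apply (hη : η + ηbar = 0) (hη0 : η ≠ 0) (hρ : ρ.IsPositiveEnergy)
    (hσ : σ.IsPositiveEnergy) {v : BRSTComplex W Wbar} (hv : charge ρ σ v = 0)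
    (hv' : T₀ ρ σ v = 0) :
    (locExp (R ρ σ) * ghostEnergy W Wbar * locExp (-R ρ σ)) v = 0 := by
  have h1 : relativeEnergy ρ σ (locExp (-R ρ σ) v) = 0 := by
    rw [relativeEnergy_apply ρ σ (charge_expNegR ρ σ hη hη0 hv)]
    have := congrArg (locExp (-R ρ σ)) hv'
    rw [T₀_eq_conj ρ σ hη, map_zero, mul_assoc, ← Module.End.mul_apply, ← mul_assoc,
      expNegR_mul_expR ρ σ hη, one_mul] at this
    exact this
  have h2 : ghostEnergy W Wbar (locExp (-R ρ σ) v) = 0 :=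
    ker_le_ker_of_gradedPart (gradedPart_eq_top ρ σ hη hη0 hρ hσ) h1
  rw [Module.End.mul_apply, Module.End.mul_apply, h2, map_zero]

/-- Under the positive energy assumption, each cycle is cohomologous to one in the kernels of all
the zero modes; the representative is the image of the cycle under polynomials in these. -/
theorem exists_representative (hc : c + cbar = 28) (hη : η + ηbar = 0) (hη0 : η ≠ 0)
    (hρ : ρ.IsPositiveEnergy) (hσ : σ.IsPositiveEnergy) {k : ℤ} (Φ : cycles ρ σ k) :
    ∃ Ψ : cycles ρ σ k, cls ρ σ k Ψ = cls ρ σ k Φ ∧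
      (energyM ρ σ Ψ = 0 ∧ energyBC ρ σ Ψ = 0 ∧ charge ρ σ Ψ = 0 ∧ T₀ ρ σ Ψ = 0) ∧
      ∀ δ : ℂ, energyM ρ σ Φ = δ • (Φ : BRSTComplex W Wbar) →
        energyM ρ σ Ψ = δ • (Ψ : BRSTComplex W Wbar) := by
  obtain ⟨p₁, hp₁, h₁⟩ := exists_polynomial_of_mem_iSup_eigenspace
    (v := (Φ : BRSTComplex W Wbar)) (iSup_eigenspace_totalEnergy ρ σ hρ.1 hσ.1 ▸ Submodule.mem_top)
  obtain ⟨Φ₁, c₁, e₁⟩ := (killsCohomology_totalEnergy ρ σ hc hη hη0).exists_aeval ρ σ Φ hp₁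
  obtain ⟨p₂, hp₂, h₂⟩ := exists_polynomial_of_mem_iSup_eigenspace
    (v := (Φ₁ : BRSTComplex W Wbar)) (iSup_eigenspace_charge ρ σ hρ.2.1 hσ.2.1 ▸ Submodule.mem_top)
  obtain ⟨Φ₂, c₂, e₂⟩ := (killsCohomology_charge ρ σ hc hη).exists_aeval ρ σ Φ₁ hp₂
  rw [← e₁] at h₁
  rw [← e₂] at h₂
  -- `T₀` has to come after the charge, since its polynomial is available only for vectors of zero
  -- charge.
  obtain ⟨p₃, hp₃, h₃⟩ := exists_polynomial_T₀ ρ σ hη hη0 hρ hσ h₂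
  obtain ⟨Φ₃, c₃, e₃⟩ := (killsCohomology_T₀ ρ σ hc hη hη0).exists_aeval ρ σ Φ₂ hp₃
  rw [← e₃] at h₃
  -- The kernels reached earlier survive the later polynomials because the three operators commute.
  have hA : charge ρ σ Φ₃ = 0 := by
    rw [e₃]
    exact Commute.aeval_apply_eq_zero (commute_charge_T₀ ρ σ hη hη0) p₃ h₂
  have hK : totalEnergy ρ σ Φ₃ = 0 := by
    rw [e₃]
    refine Commute.aeval_apply_eq_zero (commute_totalEnergy_T₀ ρ σ hη) p₃ ?_
    rw [e₂]
    exact Commute.aeval_apply_eq_zero (commute_totalEnergy_charge ρ σ) p₂ h₁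
  refine ⟨Φ₃, by rw [c₃, c₂, c₁], ⟨?_, ?_, hA, h₃⟩, fun δ hδ => ?_⟩
  · rw [energyM_eq ρ σ hη hη0, LinearMap.add_apply, LinearMap.sub_apply, hK, h₃,
      conj_ghostEnergy_apply ρ σ hη hη0 hρ hσ hA h₃, sub_zero, add_zero]
  · rw [energyBC_eq ρ σ hη hη0]
    change (totalEnergy ρ σ - T₀ ρ σ) Φ₃ = 0
    rw [LinearMap.sub_apply, hK, h₃, sub_zero]
  · obtain ⟨k₁, k₂, k₃⟩ := commute_energyM ρ σ hη hη0
    have hcomm : ∀ {X}, Commute (energyM ρ σ) X → Commute (energyM ρ σ - algebraMap ℂ _ δ) X :=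
      fun h => h.sub_left (Algebra.commute_algebraMap_left δ _)
    -- Writing the eigenvalue equation as membership in the kernel of `energyM - δ` allows the same
    -- commutation argument to carry it from `Φ` to the representative.
    have hM : ∀ v : BRSTComplex W Wbar, energyM ρ σ v = δ • v ↔
        (energyM ρ σ - algebraMap ℂ _ δ) v = 0 := fun v => by
      rw [LinearMap.sub_apply, sub_eq_zero, Module.algebraMap_end_apply]
    rw [hM] at hδ ⊢
    rw [e₃]
    refine Commute.aeval_apply_eq_zero (hcomm k₃) p₃ ?_
    rw [e₂]
    refine Commute.aeval_apply_eq_zero (hcomm k₂) p₂ ?_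
    rw [e₁]
    exact Commute.aeval_apply_eq_zero (hcomm k₁) p₁ hδ

/-- The harmonic representative is an eigenvector with the same eigenvalue `δ` and also lies in the
kernel. Either `δ = 0`, or the representative is zero and the class is trivial. -/
theorem nontrivialEigencyclesInKer_energyM (hc : c + cbar = 28) (hη : η + ηbar = 0) (hη0 : η ≠ 0)
    (hρ : ρ.IsPositiveEnergy) (hσ : σ.IsPositiveEnergy) :
    NontrivialEigencyclesInKer ρ σ (energyM ρ σ) := by
  intro k Φ δ hΦ hne
  obtain ⟨Ψ, h1, ⟨h2, -⟩, h3⟩ := exists_representative ρ σ hc hη hη0 hρ hσ Φ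
  have h4 := h3 δ hΦ
  rw [h2] at h4
  rcases smul_eq_zero.1 h4.symm with rfl | h5
  · rw [hΦ, zero_smul]
  · refine absurd ?_ hne
    rw [← h1, Subtype.ext (a2 := (0 : cycles ρ σ k)) h5, map_zero]

end Representatives

end W2BRST

end

theorem corollary3p2 {W Wbar : Type*} [AddCommGroup W] [Module ℂ W] [AddCommGroup Wbar]
    [Module ℂ Wbar] {c cbar η ηbar : ℂ} (hc : c + cbar = 28) (hη : η + ηbar = 0) (hη0 : η ≠ 0)
    (ρ : W2BRST.W2Module c η W) (σ : W2BRST.W2Module cbar ηbar Wbar) :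
    -- the complex and the operator `e^R` are well defined
    (W2BRST.LocallyNilpotent (W2BRST.R ρ σ) ∧
      W2BRST.Q ρ σ * W2BRST.Q ρ σ = 0 ∧
      ∀ k : ℤ, ∀ Φ ∈ W2BRST.ghostDegree W Wbar k,
        W2BRST.Q ρ σ Φ ∈ W2BRST.ghostDegree W Wbar (k + 1)) ∧
    -- the three operators are BRST commutators
    (W2BRST.Q ρ σ * W2BRST.zeroMode₂ (W2BRST.tilde ρ σ (W2BRST.ghost W Wbar .b)) +
        W2BRST.zeroMode₂ (W2BRST.tilde ρ σ (W2BRST.ghost W Wbar .b)) * W2BRST.Q ρ σ =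
          W2BRST.energyBC ρ σ ∧
      W2BRST.Q ρ σ * W2BRST.zeroMode₁ (W2BRST.tilde ρ σ (W2BRST.ghost W Wbar .χ)) +
        W2BRST.zeroMode₁ (W2BRST.tilde ρ σ (W2BRST.ghost W Wbar .χ)) * W2BRST.Q ρ σ =
          W2BRST.charge ρ σ ∧
      W2BRST.Q ρ σ * W2BRST.zeroMode₂ (W2BRST.S ρ σ) +
        W2BRST.zeroMode₂ (W2BRST.S ρ σ) * W2BRST.Q ρ σ = W2BRST.T₀ ρ σ) ∧
    -- every class lies in the kernels of the operators induced on cohomology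
    (W2BRST.KillsCohomology ρ σ (W2BRST.energyBC ρ σ) ∧
      W2BRST.KillsCohomology ρ σ (W2BRST.charge ρ σ) ∧
      W2BRST.KillsCohomology ρ σ (W2BRST.T₀ ρ σ)) ∧
    -- nontrivial cycles that are eigenvectors lie in the kernels
    (W2BRST.NontrivialEigencyclesInKer ρ σ (W2BRST.energyBC ρ σ) ∧
      W2BRST.NontrivialEigencyclesInKer ρ σ (W2BRST.charge ρ σ) ∧
      W2BRST.NontrivialEigencyclesInKer ρ σ (W2BRST.T₀ ρ σ)) ∧
    -- weight modules with energy bounded below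
    (ρ.IsPositiveEnergy → σ.IsPositiveEnergy →
      W2BRST.NontrivialEigencyclesInKer ρ σ (W2BRST.energyM ρ σ) ∧
      ∀ (k : ℤ) (x : W2BRST.Cohomology ρ σ k), ∃ Φ : W2BRST.cycles ρ σ k,
        W2BRST.cls ρ σ k Φ = x ∧
        W2BRST.energyM ρ σ Φ = 0 ∧ W2BRST.energyBC ρ σ Φ = 0 ∧
        W2BRST.charge ρ σ Φ = 0 ∧ W2BRST.T₀ ρ σ Φ = 0) := by
  have kE := W2BRST.killsCohomology_energyBC ρ σ hc hη hη0
  have kA := W2BRST.killsCohomology_charge ρ σ hc hη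
  have kT := W2BRST.killsCohomology_T₀ ρ σ hc hη hη0
  refine ⟨⟨W2BRST.locallyNilpotent_R ρ σ hη, W2BRST.Q_mul_Q ρ σ hc hη,
      fun k Φ hΦ => W2BRST.Q_mem_ghostDegree ρ σ hΦ⟩,
    ⟨W2BRST.commutator_b ρ σ hη hη0, W2BRST.commutator_χ ρ σ hη, W2BRST.commutator_S ρ σ hη hη0⟩,
    ⟨kE, kA, kT⟩,
    ⟨kE.nontrivialEigencyclesInKer, kA.nontrivialEigencyclesInKer, kT.nontrivialEigencyclesInKer⟩,
    fun hρ hσ => ⟨W2BRST.nontrivialEigencyclesInKer_energyM ρ σ hc hη hη0 hρ hσ, fun k x => ?_⟩⟩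
  obtain ⟨Φ, rfl⟩ := Submodule.mkQ_surjective _ x
  obtain ⟨Ψ, h1, h2, -⟩ := W2BRST.exists_representative ρ σ hc hη hη0 hρ hσ Φ
  exact ⟨Ψ, h1, h2⟩
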